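/- Let $k$ be an algebraically closed field, $n\ge 0$, $a,b\ge 1$, let $0\le d_1<\dots<d_a<e_1<\dots<e_b$ be integers and let $s_1,\dots,s_a,t_1,\dots,t_b$ be nonnegative integers. On $\mathbb{P}^n=\mathbb{P}^n_k$ put $V_1=\bigoplus_{i=1}^a\mathcal{O}(d_i)^{s_i}$ and $V_2=\bigoplus_{j=1}^b\mathcal{O}(e_j)^{t_j}$, and suppose that $$\max\left\{\sum_{i=1}^a s_i\binom{d_i+n}{n},\ \sum_{j=1}^b t_j\binom{e_j+n}{n}\right\}\ \ge\ \frac14\binom{d_a+n}{n}\binom{e_b+n}{n}\sum_{i=1}^a\binom{d_i+n}{n}^2 .$$ Then for a general $M\in\operatorname{Hom}(V_1,V_2)$ (that is, for all $M$ in a nonempty Zariski open subset of this finite-dimensional $k$-vector space) the induced map $H^0(V_1)\to H^0(V_2)$ has maximal rank, i.e. it is injective or surjective. If moreover $\sum_i s_i\ge \sum_j t_j+n$, then for a general $M$ the sheaf $V=\ker M$ is locally free of finite rank, all the $H^i(\mathbb{P}^n,V)$ are finite-dimensional, and, with $h^i(V)=\dim_k H^i(\mathbb{P}^n,V)$ and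 $\chi(V)=\sum_{i=0}^n(-1)^ih^i(V)$, $$h^0(V)=\max(\chi(V),0),\qquad h^1(V)=\max(-\chi(V),0),\qquad h^i(V)=0\ \text{ for all } i\ge 2 .$$ -/

import Mathlib

universe u
open CategoryTheory CategoryTheory.Limits AlgebraicGeometry

namespace KernelBundle
open TopologicalSpace Opposite

noncomputable section

/-- The grading of the polynomial ring `S = k[x₀, …, xₙ]` by total degree. -/
abbrev projGrading (n : ℕ) (k : Type u) [Field k] :
    ℕ → Submodule k (MvPolynomial (Fin (n + 1)) k) :=
  MvPolynomial.homogeneousSubmodule (Fin (n + 1)) k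

instance projGradedAlgebra (n : ℕ) (k : Type u) [Field k] : GradedAlgebra (projGrading n k) :=
  MvPolynomial.gradedAlgebra

/-- Projective `n`-space over `k`: the scheme `Proj k[x₀, …, xₙ]`. -/
abbrev ProjSpace (n : ℕ) (k : Type u) [Field k] : Scheme.{u} := Proj (projGrading n k)

/-- The fraction field of `S = k[x₀, …, xₙ]`; rational sections of `𝒪(d)` are its homogeneous
elements of degree `d`. -/
abbrev RatField (n : ℕ) (k : Type u) [Field k] : Type u :=
  FractionRing (MvPolynomial (Fin (n + 1)) k)

section Twist

lemma algebraMap_ne_zero_of_notMem {n : ℕ} {k : Type u} [Field k]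
    (x : ProjectiveSpectrum (projGrading n k)) {s : MvPolynomial (Fin (n + 1)) k}
    (hs : s ∉ x.asHomogeneousIdeal) : algebraMap _ (RatField n k) s ≠ 0 := fun h => hs (by
  rw [(IsFractionRing.injective (MvPolynomial (Fin (n + 1)) k) (RatField n k))
    (h.trans (map_zero _).symm)]
  exact zero_mem _)

variable (n : ℕ) (k : Type u) [Field k] (d : ℕ)

variable {n k} in
/-- The inclusion `S_(x) → Frac S`, `a/b ↦ a/b`, of the local ring of `ℙⁿ` at `x` (fractions of two
forms of the same degree, with denominator not in `x`) into the fraction field. -/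
def localToRat (x : ProjectiveSpectrum (projGrading n k)) :
    HomogeneousLocalization.AtPrime (projGrading n k) x.asHomogeneousIdeal.toIdeal →+*
      RatField n k :=
  (IsLocalization.lift (M := x.asHomogeneousIdeal.toIdeal.primeCompl)
    (S := Localization.AtPrime x.asHomogeneousIdeal.toIdeal)
    (g := algebraMap (MvPolynomial (Fin (n + 1)) k) (RatField n k))
    (fun s => IsUnit.mk0 _ (algebraMap_ne_zero_of_notMem x s.2))).comp
    (algebraMap _ (Localization.AtPrime x.asHomogeneousIdeal.toIdeal))

variable {n k} in
lemma localToRat_mk (x : ProjectiveSpectrum (projGrading n k))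
    (c : HomogeneousLocalization.NumDenSameDeg (projGrading n k)
      x.asHomogeneousIdeal.toIdeal.primeCompl) :
    localToRat x (HomogeneousLocalization.mk c) =
      algebraMap _ (RatField n k) (c.num : MvPolynomial (Fin (n + 1)) k) /
        algebraMap _ (RatField n k) (c.den : MvPolynomial (Fin (n + 1)) k) := by
  have hne : algebraMap _ (RatField n k) (c.den : MvPolynomial (Fin (n + 1)) k) ≠ 0 :=
    algebraMap_ne_zero_of_notMem x c.den_mem
  rw [localToRat, RingHom.comp_apply, HomogeneousLocalization.algebraMap_apply,
    HomogeneousLocalization.val_mk, Localization.mk_eq_mk', IsLocalization.lift_mk'_spec]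
  exact (mul_div_cancel₀ _ hne).symm

variable {n k} in
/-- `f` is, on all of `U`, given by one fraction `r/s` with `r` and `s` forms,
`deg r = deg s + d`, and `s` not vanishing at any point of `U`. -/
def IsFractionOfDegree {U : Opens (ProjectiveSpectrum.top (projGrading n k))}
    (f : U → RatField n k) : Prop :=
  ∃ (i : ℕ) (r : projGrading n k (i + d)) (s : projGrading n k i),
    ∀ x : U, s.1 ∉ x.1.asHomogeneousIdeal ∧
      f x = algebraMap _ (RatField n k) r.1 / algebraMap _ (RatField n k) s.1

/-- `f` is locally a fraction of degree `d`, regular at the points where it is considered. -/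
def isLocallyFractionOfDegree :
    TopCat.LocalPredicate (fun _ : ProjectiveSpectrum.top (projGrading n k) => RatField n k) :=
  TopCat.PrelocalPredicate.sheafify
    { pred := fun f => IsFractionOfDegree d f
      res := by rintro V U i f ⟨j, r, s, h⟩; exact ⟨j, r, s, fun x => h (i x)⟩ }

lemma mul_notMem {n : ℕ} {k : Type u} [Field k]
    (x : ProjectiveSpectrum (projGrading n k)) {s t : MvPolynomial (Fin (n + 1)) k}
    (hs : s ∉ x.asHomogeneousIdeal) (ht : t ∉ x.asHomogeneousIdeal) :
    s * t ∉ x.asHomogeneousIdeal :=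
  x.asHomogeneousIdeal.toIdeal.primeCompl.mul_mem hs ht

/-- The sections of `𝒪(d)` over `U`: functions to `Frac S` that near each point of `U` are a fraction
`r/s` of forms with `deg r = deg s + d` and `s` vanishing nowhere nearby. -/
def twistSections (U : Opens (ProjectiveSpectrum.top (projGrading n k))) :
    AddSubgroup (U → RatField n k) where
  carrier := {f | (isLocallyFractionOfDegree n k d).pred f}
  zero_mem' := fun x =>
    ⟨U, x.2, 𝟙 U, 0, ⟨0, zero_mem _⟩, ⟨1, SetLike.GradedOne.one_mem⟩, fun y =>
      ⟨(Ideal.ne_top_iff_one _).mp (ProjectiveSpectrum.isPrime y.1).ne_top, by simp⟩⟩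
  add_mem' := by
    intro a b ha hb x
    rcases ha x with ⟨Va, ma, ia, ja, ⟨ra, ra_mem⟩, ⟨sa, sa_mem⟩, wa⟩
    rcases hb x with ⟨Vb, mb, ib, jb, ⟨rb, rb_mem⟩, ⟨sb, sb_mem⟩, wb⟩
    refine ⟨Va ⊓ Vb, ⟨ma, mb⟩, Opens.infLELeft _ _ ≫ ia, ja + jb,
      ⟨ra * sb + sa * rb, add_mem ?_ ?_⟩, ⟨sa * sb, SetLike.mul_mem_graded sa_mem sb_mem⟩, ?_⟩
    · have := SetLike.mul_mem_graded ra_mem sb_mem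
      rwa [show ja + d + jb = ja + jb + d by ring] at this
    · have := SetLike.mul_mem_graded sa_mem rb_mem
      rwa [← add_assoc] at this
    · rintro ⟨y, hy⟩
      obtain ⟨h1, e1⟩ := wa ⟨y, hy.1⟩
      obtain ⟨h2, e2⟩ := wb ⟨y, hy.2⟩
      refine ⟨mul_notMem y h1 h2, ?_⟩
      have h : (a + b) (((Va.infLELeft Vb ≫ ia)) ⟨y, hy⟩) =
        a (ia ⟨y, hy.1⟩) + b (ib ⟨y, hy.2⟩) := rfl
      simp only [map_add, map_mul]
      rw [← div_add_div _ _ (algebraMap_ne_zero_of_notMem y h1)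
        (algebraMap_ne_zero_of_notMem y h2)]
      exact h.trans (congrArg₂ _ e1 e2)
  neg_mem' := by
    intro a ha x
    rcases ha x with ⟨V, m, i, j, ⟨r, r_mem⟩, ⟨s, s_mem⟩, w⟩
    refine ⟨V, m, i, j, ⟨-r, neg_mem r_mem⟩, ⟨s, s_mem⟩, fun y => ⟨(w y).1, ?_⟩⟩
    simp only [map_neg, neg_div]
    exact congrArg _ (w y).2

variable {n k d} in
lemma smul_mem_twistSections {U : Opens (ProjectiveSpectrum.top (projGrading n k))}
    (r : (ProjectiveSpectrum.Proj.structureSheaf (projGrading n k)).1.obj (op U))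
    (f : twistSections n k d U) :
    (fun x : U => localToRat x.1 (r.1 x) * f.1 x) ∈ twistSections n k d U := by
  intro x
  rcases r.2 x with ⟨Va, ma, ia, ja, ⟨ra, ra_mem⟩, ⟨sa, sa_mem⟩, ha, wa⟩
  rcases f.2 x with ⟨Vb, mb, ib, jb, ⟨rb, rb_mem⟩, ⟨sb, sb_mem⟩, wb⟩
  refine ⟨Va ⊓ Vb, ⟨ma, mb⟩, Opens.infLELeft _ _ ≫ ia, ja + jb,
    ⟨ra * rb, ?_⟩, ⟨sa * sb, SetLike.mul_mem_graded sa_mem sb_mem⟩, ?_⟩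
  · have := SetLike.mul_mem_graded ra_mem rb_mem
    rwa [← add_assoc] at this
  · rintro ⟨y, hy⟩
    obtain ⟨h2, e2⟩ := wb ⟨y, hy.2⟩
    refine ⟨mul_notMem y (ha ⟨y, hy.1⟩) h2, ?_⟩
    simp only [map_mul]
    rw [mul_div_mul_comm]
    have e1 := (congrArg (localToRat y) (wa ⟨y, hy.1⟩)).trans (localToRat_mk y _)
    exact congrArg₂ (· * ·) e1 e2

/-- The action of the regular functions on `U` on the sections of `𝒪(d)`, by multiplication. -/
instance twistSectionsModule (U : Opens (ProjectiveSpectrum.top (projGrading n k))) :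
    Module ((ProjectiveSpectrum.Proj.structureSheaf (projGrading n k)).1.obj (op U))
      (twistSections n k d U) where
  smul r f := ⟨fun x => localToRat x.1 (r.1 x) * f.1 x, smul_mem_twistSections r f⟩
  one_smul f := Subtype.ext (funext fun x => by
    exact (congrArg (· * f.1 x) (map_one (localToRat x.1))).trans (one_mul _))
  mul_smul r s f := Subtype.ext (funext fun x => by
    exact (congrArg (· * f.1 x) (map_mul (localToRat x.1) (r.1 x) (s.1 x))).trans (mul_assoc _ _ _))
  smul_zero r := Subtype.ext (funext fun x => by exact mul_zero _)
  smul_add r f g := Subtype.ext (funext fun x => by exact mul_add _ _ _)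
  add_smul r s f := Subtype.ext (funext fun x => by
    exact (congrArg (· * f.1 x) (map_add (localToRat x.1) (r.1 x) (s.1 x))).trans (add_mul _ _ _))
  zero_smul f := Subtype.ext (funext fun x => by
    exact (congrArg (· * f.1 x) (map_zero (localToRat x.1))).trans (zero_mul _))

/-- `𝒪(d)` as a presheaf of abelian groups, with the restriction of functions. -/
def twistPresheaf : TopCat.Presheaf Ab.{u} (ProjectiveSpectrum.top (projGrading n k)) where
  obj U := AddCommGrpCat.of (twistSections n k d U.unop)
  map {U V} i := AddCommGrpCat.ofHom
    { toFun := fun f => ⟨fun x => f.1 (i.unop x), fun x =>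
        (isLocallyFractionOfDegree n k d).res i.unop f.1 f.2 x⟩
      map_zero' := rfl
      map_add' := fun _ _ => rfl }

lemma twistPresheaf_isSheaf : (twistPresheaf n k d).IsSheaf := by
  have e : twistPresheaf n k d ⋙ forget Ab ≅
      (TopCat.subsheafToTypes (isLocallyFractionOfDegree n k d)).1 :=
    NatIso.ofComponents (fun _ => Iso.refl _) (by intros; rfl)
  exact (TopCat.Presheaf.isSheaf_iff_isSheaf_comp (forget Ab) _).mpr
    (TopCat.Presheaf.isSheaf_of_iso e.symm
      (TopCat.subsheafToTypes (isLocallyFractionOfDegree n k d)).2)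

instance twistPresheafModule (U : (ProjSpace n k).Opensᵒᵖ) :
    Module ((ProjSpace n k).ringCatSheaf.obj.obj U) ((twistPresheaf n k d).obj U) :=
  twistSectionsModule n k d U.unop

/-- The line bundle `𝒪(d)` on `ℙⁿ`, for `d ≥ 0`, as a sheaf of modules. -/
def twist : (ProjSpace n k).Modules where
  val := PresheafOfModules.ofPresheaf (R := (ProjSpace n k).ringCatSheaf.obj)
    (twistPresheaf n k d) (fun _ _ _ _ _ => rfl)
  isSheaf := twistPresheaf_isSheaf n k d

variable {n k} in
/-- The constant `c ∈ k` as an element of the local ring at `x`. -/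
def constantAt (x : ProjectiveSpectrum (projGrading n k)) :
    k →+* HomogeneousLocalization.AtPrime (projGrading n k) x.asHomogeneousIdeal.toIdeal :=
  (HomogeneousLocalization.fromZeroRingHom (projGrading n k)
    x.asHomogeneousIdeal.toIdeal.primeCompl).comp (algebraMap k (projGrading n k 0))

/-- The constants `k → Γ(ℙⁿ, 𝒪)`. -/
def constants : k →+* (ProjectiveSpectrum.Proj.structureSheaf (projGrading n k)).1.obj (op ⊤) where
  toFun c := ⟨fun x => constantAt x.1 c, fun x =>
    ⟨⊤, x.2, 𝟙 _, 0, algebraMap k (projGrading n k 0) c, 1, fun y =>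
      (Ideal.ne_top_iff_one _).mp (ProjectiveSpectrum.isPrime y.1).ne_top, fun _ => rfl⟩⟩
  map_one' := Subtype.ext (funext fun x => map_one (constantAt x.1))
  map_zero' := Subtype.ext (funext fun x => map_zero (constantAt x.1))
  map_add' a b := Subtype.ext (funext fun x => map_add (constantAt x.1) a b)
  map_mul' a b := Subtype.ext (funext fun x => map_mul (constantAt x.1) a b)

/-- An `𝒪`-module on `ℙⁿ`, regarded as a presheaf of `k`-vector spaces. -/
def sectionsFunctor : (ProjSpace n k).Modules ⥤ ((ProjSpace n k).Opensᵒᵖ ⥤ ModuleCat.{u} k) :=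
  SheafOfModules.forget (ProjSpace n k).ringCatSheaf ⋙
    PresheafOfModules.forgetToPresheafModuleCat (op ⊤)
      (Limits.initialOpOfTerminal Limits.isTerminalTop) ⋙
    (Functor.whiskeringRight _ _ _).obj (ModuleCat.restrictScalars (constants n k))

variable {n k}

/-- The constant `c ∈ k` as a regular function on `U`. -/
def constantOn (U : (ProjSpace n k).Opensᵒᵖ) (c : k) : (ProjSpace n k).ringCatSheaf.obj.obj U :=
  (ProjSpace n k).ringCatSheaf.obj.map (homOfLE le_top : U.unop ⟶ ⊤).op (constants n k c)

lemma map_constantOn {U V : (ProjSpace n k).Opensᵒᵖ} (i : U ⟶ V) (c : k) :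
    (ProjSpace n k).ringCatSheaf.obj.map i (constantOn U c) = constantOn V c := rfl

lemma constantOn_mul_comm (U : (ProjSpace n k).Opensᵒᵖ) (c : k)
    (r : (ProjSpace n k).ringCatSheaf.obj.obj U) : constantOn U c * r = r * constantOn U c :=
  mul_comm (G := (ProjSpace n k).presheaf.obj U) _ _

/-- Multiplication by the constant `c` on an `𝒪`-module. -/
def scalarEnd (F : (ProjSpace n k).Modules) (c : k) : F ⟶ F :=
  SheafOfModules.Hom.mk (PresheafOfModules.homMk
    { app := fun U => AddCommGrpCat.ofHom
        (DistribSMul.toAddMonoidHom (F.val.obj U) (constantOn U c))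
      naturality := fun U V i => by
        ext m
        exact (F.val.map_smul i (constantOn U c) m).symm }
    (fun U r m => by
      change constantOn U c • (r • m) = r • (constantOn U c • m)
      rw [← mul_smul, ← mul_smul, constantOn_mul_comm]))

lemma constantOn_eq (U : (ProjSpace n k).Opensᵒᵖ) (c : k) :
    constantOn U c = (((ProjSpace n k).ringCatSheaf.obj.map
      (homOfLE le_top : U.unop ⟶ ⊤).op).hom.comp (constants n k)) c := rfl

lemma modulesHom_ext {F G : (ProjSpace n k).Modules} {f g : F ⟶ G}
    (h : ∀ (U : (ProjSpace n k).Opensᵒᵖ) (m : F.val.obj U), f.val.app U m = g.val.app U m) :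
    f = g := by
  apply SheafOfModules.hom_ext
  ext U m
  exact h U m

/-- The ring homomorphism from `k` to the endomorphisms of an `𝒪`-module. -/
def scalarHom (F : (ProjSpace n k).Modules) : k →+* End F where
  toFun c := scalarEnd F c
  map_one' := modulesHom_ext fun U m => by
    change constantOn U 1 • m = m
    rw [constantOn_eq, map_one, one_smul]
  map_zero' := modulesHom_ext fun U m => by
    change constantOn U 0 • m = 0
    rw [constantOn_eq, map_zero, zero_smul]
  map_add' a b := modulesHom_ext fun U m => by
    change constantOn U (a + b) • m = constantOn U a • m + constantOn U b • m
    rw [constantOn_eq, map_add, add_smul]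
    rfl
  map_mul' a b := modulesHom_ext fun U m => by
    change constantOn U (a * b) • m = constantOn U a • constantOn U b • m
    rw [constantOn_eq, map_mul, mul_smul]
    rfl

/-- `Hom(F, G)` as a `k`-vector space. -/
instance homModule (F G : (ProjSpace n k).Modules) : Module k (F ⟶ G) :=
  Module.compHom (F ⟶ G) (scalarHom G)

/-- The Čech complex of `F` for the standard affine cover of `ℙⁿ` by the `n + 1` open sets
`D₊(xᵢ) = {xᵢ ≠ 0}`. -/
def cechComplex (F : (ProjSpace n k).Modules) : CochainComplex (ModuleCat.{u} k) ℕ :=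
  (cechComplexFunctor (fun i : Fin (n + 1) =>
    Proj.basicOpen (projGrading n k) (MvPolynomial.X i))).obj
    ((sectionsFunctor n k).obj F)

/-- The cohomology `Hⁱ(ℙⁿ, F)` of a quasi-coherent sheaf `F`, as the Čech cohomology of the
standard affine cover (whose finite intersections are affine). -/
abbrev cohomology (F : (ProjSpace n k).Modules) (i : ℕ) : ModuleCat.{u} k :=
  (cechComplex F).homology i

/-- `hⁱ(F) = dim_k Hⁱ(ℙⁿ, F)`. -/
def hDim (F : (ProjSpace n k).Modules) (i : ℕ) : ℕ := Module.finrank k (cohomology F i)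

/-- The Euler characteristic `χ(F) = ∑ (-1)ⁱ hⁱ(F)`. -/
def eulerChar (F : (ProjSpace n k).Modules) : ℤ :=
  ∑ i ∈ Finset.range (n + 1), (-1) ^ i * (hDim F i : ℤ)

/-- `F` is locally free of finite rank: each point has an open neighbourhood `U` such that `F` is
isomorphic on `U` to a finite direct power of the structure sheaf. -/
def IsVectorBundle (F : (ProjSpace n k).Modules) : Prop :=
  ∀ x : ProjSpace n k, ∃ (U : (ProjSpace n k).Opens) (r : ℕ), x ∈ U ∧
    Nonempty (F.restrict U.ι ≅
      (SheafOfModules.free (R := U.toScheme.ringCatSheaf) (ULift.{u} (Fin r)) : U.toScheme.Modules))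

instance modulesHasFiniteBiproducts : HasFiniteBiproducts (ProjSpace n k).Modules :=
  Abelian.hasFiniteBiproducts

/-- The direct sum `⨁ᵢ 𝒪(dᵢ)^{sᵢ}`. -/
def lineBundleSum (n : ℕ) (k : Type u) [Field k] {a : ℕ} (d s : Fin a → ℕ) :
    (ProjSpace n k).Modules :=
  ⨁ fun p : (i : Fin a) × Fin (s i) => twist n k (d p.1)

/-- The induced map `H⁰(M) : H⁰(F) → H⁰(G)` has maximal rank. -/
def HasMaximalRankOnSections {F G : (ProjSpace n k).Modules} (M : F ⟶ G) : Prop :=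
  Function.Injective (M.app ⊤) ∨ Function.Surjective (M.app ⊤)

/-- `P` holds for a general element of the finite-dimensional `k`-vector space `H`: it holds on a
nonempty Zariski open subset, namely outside the zero locus of some nonzero polynomial in the
coordinates with respect to some basis. -/
def ForGeneral (k : Type u) [Field k] {H : Type u} [AddCommGroup H] [Module k H]
    (P : H → Prop) : Prop :=
  ∃ (m : ℕ) (b : Module.Basis (Fin m) k H) (p : MvPolynomial (Fin m) k), p ≠ 0 ∧
    ∀ v : H, MvPolynomial.eval (b.repr v) p ≠ 0 → P v

end Twist
end

end KernelBundle

/-! A map of the two bundles is a matrix `M` of forms, and on global sections it acts on tuples `v`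
of forms. Since maximal rank is an open condition, one good `M` suffices. It is found over a finite
field of order q by counting pairs (M, v) with Mv = 0 (`exists_maximalRank_of_count`). If no `M` had
maximal rank, every kernel would exceed the expected dimension, which makes too many pairs. From the
side of `v`, the number of `M` killing `v` depends on the rank of M ↦ Mv. The tuples are sorted by
the dimensions p_i of the spans P_i of their components of degree d_i. There are at most a constant
times q^(∑ p_i (w_i - p_i) + p_i s_i) tuples of a given type, where w_i = dim S_{d_i}. The rank of M
↦ Mv is at least ∑_j dim S_{e_j - d_m} P_m for each m.

The decisive input is a growth theorem for spaces of forms: multiplication by forms of positive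
degree strictly increases the relative dimension of a proper nonzero subspace
(`finrank_mul_choose_lt`). By initial monomials it reduces to a weighted count of shadows of sets of
monomials. Applied to the block m of largest relative dimension p_m / w_m, it makes the rank large
enough; p(w - p) ≤ w²/4 and the numerical hypothesis do the rest (`exponent_bound`). Maximal minors
are polynomials with integer coefficients in the coefficients of the forms, so the result passes
from finite fields to any infinite field (`exists_maximalRank_transfer`).

For the kernel bundle, a band matrix in powers of the variables has cokernel of finite length as
soon as there are n more columns than rows (`exists_formMap_surjective`). Hence a general `M` is
surjective on the standard affine pieces, and its kernel is locally free there because some maximal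
minor is locally invertible. The sheaves O(d) with d ≥ 0 have no higher Čech cohomology
(`exists_cech_preimage`). The long exact sequence then leaves only H⁰ and H¹ of the kernel, namely
the kernel and the cokernel of H⁰(M), and maximal rank kills one of them (`cohomology_kernel`). -/

namespace KernelBundle
open Finset

/-! ### Shadows of sets of monomials. -/

section Shadow
variable {σ : Type*} [Fintype σ]

lemma degree_eq_univ_sum (m : σ →₀ ℕ) : m.degree = ∑ i, m i :=
  Finset.sum_subset (subset_univ _) fun i _ hi => by simpa using hi

variable [DecidableEq σ]

/-- The monomials obtained from those of `T` by multiplication with one variable. -/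
noncomputable def upperShadow (T : Finset (σ →₀ ℕ)) : Finset (σ →₀ ℕ) :=
  (T ×ˢ univ).image fun p => p.1 + Finsupp.single p.2 1

lemma mem_upperShadow {T : Finset (σ →₀ ℕ)} {m : σ →₀ ℕ} :
    m ∈ upperShadow T ↔ ∃ t ∈ T, ∃ i, t + Finsupp.single i 1 = m := by
  simp [upperShadow]

/-- Double counting of the products of t in `T` with the i-th variable, with weight t_i + 1, the
exponent of that variable in the product. For fixed t the weights add up to d + |σ|; the exponents
of a monomial of the shadow add up to d + 1. The additional sum collects the pairs that do not arise
from `T`, so it measures how far the inequality is from equality. -/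
lemma weighted_card_upperShadow {d : ℕ} {T : Finset (σ →₀ ℕ)} (hT : ∀ m ∈ T, m.degree = d) :
    (d + Fintype.card σ) * #T + ∑ p ∈ (upperShadow T ×ˢ univ).filter
      (fun p => ∀ t ∈ T, t + Finsupp.single p.2 1 ≠ p.1), p.1 p.2 = (d + 1) * #(upperShadow T) := by
  classical
  have h1 : ∑ p ∈ T ×ˢ (univ : Finset σ), (p.1 p.2 + 1) = (d + Fintype.card σ) * #T := by
    rw [sum_product]
    have : ∀ m ∈ T, ∑ i, (m i + 1) = d + Fintype.card σ := fun m hm => by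
      rw [sum_add_distrib, ← degree_eq_univ_sum, hT m hm]; simp
    rw [sum_congr rfl this]; simp [mul_comm]
  have h2 : ∑ p ∈ upperShadow T ×ˢ (univ : Finset σ), p.1 p.2 = (d + 1) * #(upperShadow T) := by
    rw [sum_product]
    have : ∀ m ∈ upperShadow T, ∑ i, m i = d + 1 := fun m hm => by
      obtain ⟨t, ht, i, rfl⟩ := mem_upperShadow.mp hm
      rw [← degree_eq_univ_sum, map_add, hT t ht]; simp
    rw [sum_congr rfl this]; simp [mul_comm]
  have h3 : ∑ p ∈ (upperShadow T ×ˢ univ).filter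
      (fun p => ¬ ∀ t ∈ T, t + Finsupp.single p.2 1 ≠ p.1), p.1 p.2 =
      ∑ p ∈ T ×ˢ (univ : Finset σ), (p.1 p.2 + 1) := by
    symm
    refine sum_bij (fun p _ => (p.1 + Finsupp.single p.2 1, p.2)) ?_ ?_ ?_ ?_
    · rintro ⟨m, i⟩ h
      simp only [mem_product, mem_univ, and_true] at h
      simp only [mem_filter, mem_product, mem_univ, and_true, mem_upperShadow]
      exact ⟨⟨m, h, i, rfl⟩, fun h' => h' m h rfl⟩
    · rintro ⟨m, i⟩ _ ⟨m', i'⟩ _ h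
      simp only [Prod.mk.injEq] at h
      obtain ⟨h, rfl⟩ := h
      simpa using h
    · rintro ⟨m, i⟩ h
      simp only [mem_filter, not_forall, not_not] at h
      obtain ⟨_, t, ht, h⟩ := h
      exact ⟨(t, i), by simp [ht], by simp [h]⟩
    · rintro ⟨m, i⟩ _; simp
  rw [← h1, ← h2, ← h3, add_comm, sum_filter_add_sum_filter_not]

lemma card_upperShadow_le {d : ℕ} {T : Finset (σ →₀ ℕ)} (hT : ∀ m ∈ T, m.degree = d) :
    (d + Fintype.card σ) * #T ≤ (d + 1) * #(upperShadow T) := by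
  rw [← weighted_card_upperShadow hT]; exact Nat.le_add_right _ _

/-- Take m in `T` at least distance from m' in the sum norm. Moving one unit from an exponent of m
that is too large to one that is too small brings it closer to m', hence leaves `T`. -/
lemma exists_exchange_notMem {d : ℕ} {T : Finset (σ →₀ ℕ)} (hT : ∀ m ∈ T, m.degree = d)
    (hne : T.Nonempty) {m' : σ →₀ ℕ} (hm' : m'.degree = d) (hm'T : m' ∉ T) :
    ∃ m ∈ T, ∃ i j, 0 < m i ∧ m + Finsupp.single j 1 - Finsupp.single i 1 ∉ T := by
  by_contra! H
  obtain ⟨m, hm, hmin⟩ := exists_min_image T (fun m => ∑ i, Nat.dist (m i) (m' i)) hne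
  have hneq : m ≠ m' := fun h => hm'T (h ▸ hm)
  have hsum : ∑ i, m i = ∑ i, m' i := by
    rw [← degree_eq_univ_sum, ← degree_eq_univ_sum, hT m hm, hm']
  obtain ⟨i, hi⟩ : ∃ i, m' i < m i := by
    by_contra! h
    exact hneq (Finsupp.ext fun i => (sum_eq_sum_iff_of_le fun i _ => h i).mp hsum i (mem_univ i))
  obtain ⟨j, hj⟩ : ∃ j, m j < m' j := by
    by_contra! h
    exact hneq (Finsupp.ext fun i =>
      ((sum_eq_sum_iff_of_le fun i _ => h i).mp hsum.symm i (mem_univ i)).symm)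
  have hij : i ≠ j := by rintro rfl; omega
  refine absurd (hmin _ (H m hm i j (by omega))) (not_le.mpr ?_)
  refine sum_lt_sum (fun l _ => ?_) ⟨i, mem_univ i, ?_⟩
  · by_cases hli : l = i
    · subst hli; simp [Nat.dist, hij.symm]; omega
    · by_cases hlj : l = j
      · subst hlj; simp [Nat.dist, hij]; omega
      · simp [Ne.symm hli, Ne.symm hlj]
  · simp [Nat.dist, hij.symm]; omega

/-- With m, i, j from the exchange, the pair (m + e_j, i) does not arise from `T`, although its
weight is positive. -/
lemma card_upperShadow_lt {d : ℕ} {T : Finset (σ →₀ ℕ)} (hT : ∀ m ∈ T, m.degree = d)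
    (hne : T.Nonempty) {m' : σ →₀ ℕ} (hm' : m'.degree = d) (hm'T : m' ∉ T) :
    (d + Fintype.card σ) * #T < (d + 1) * #(upperShadow T) := by
  obtain ⟨m, hm, i, j, hi, hmij⟩ := exists_exchange_notMem hT hne hm' hm'T
  rw [← weighted_card_upperShadow hT]
  refine Nat.lt_add_of_pos_right (lt_of_lt_of_le ?_ (single_le_sum (f := fun p : (σ →₀ ℕ) × σ => p.1 p.2)
    (fun _ _ => Nat.zero_le _) (a := (m + Finsupp.single j 1, i)) ?_))
  · simp; omega
  · simp only [mem_filter, mem_product, mem_univ, and_true, mem_upperShadow]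
    refine ⟨⟨m, hm, j, rfl⟩, fun t ht h => hmij ?_⟩
    rw [← h, add_tsub_cancel_right]; exact ht

end Shadow

/-! ### Initial monomials and dimension. -/

section Initial
variable {σ F : Type*} [Field F] (μ : MonomialOrder σ)
open MvPolynomial

/-- The initial monomials of the nonzero elements of a space of polynomials. -/
def initialMonomials (P : Submodule F (MvPolynomial σ F)) : Set (σ →₀ ℕ) :=
  {m | ∃ f ∈ P, f ≠ 0 ∧ μ.degree f = m}

/-- Elements with distinct initial monomials are linearly independent, which gives one inequality.
Conversely, a nonzero element has a nonzero coefficient at its own initial monomial, so the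
coefficients at the initial monomials determine the elements of `P`. -/
lemma ncard_initialMonomials (P : Submodule F (MvPolynomial σ F)) [Module.Finite F P] :
    (initialMonomials μ P).Finite ∧ (initialMonomials μ P).ncard = Module.finrank F P := by
  classical
  choose f hfP hf0 hfd using fun m : initialMonomials μ P => m.2
  have hli : LinearIndependent F fun m => (⟨f m, hfP m⟩ : P) := by
    rw [← LinearMap.linearIndependent_iff_of_injOn P.subtype (P.injective_subtype.injOn)]
    rw [linearIndependent_iff']
    intro s g hg
    by_contra! hne
    obtain ⟨i, his, hi⟩ := hne
    obtain ⟨m, hm, hmax⟩ := exists_max_image (s.filter (fun m => g m ≠ 0))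
      (fun m => μ.toSyn m.1) ⟨i, by simp [his, hi]⟩
    simp only [mem_filter] at hm hmax
    have := congrArg (coeff m.1) hg
    rw [coeff_sum, coeff_zero, sum_eq_single_of_mem m hm.1] at this
    · rw [Function.comp_apply, Submodule.subtype_apply, coeff_smul, smul_eq_mul] at this
      refine mul_ne_zero hm.2 ?_ this
      conv => rw [← hfd m]
      exact μ.coeff_degree_ne_zero_iff.mpr (hf0 m)
    · intro b hb hbm
      by_cases hgb : g b = 0
      · simp [hgb]
      rw [Function.comp_apply, Submodule.subtype_apply, coeff_smul, μ.coeff_eq_zero_of_lt, smul_zero]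
      rw [hfd b]
      exact lt_of_le_of_ne (hmax b ⟨hb, hgb⟩) fun h => hbm (Subtype.ext (μ.toSyn.injective h))
  have hfin : Finite (initialMonomials μ P) := hli.finite
  have := Fintype.ofFinite (initialMonomials μ P)
  refine ⟨Set.toFinite _, le_antisymm ?_ ?_⟩
  · rw [← Nat.card_coe_set_eq, Nat.card_eq_fintype_card]
    exact hli.fintype_card_le_finrank
  · let φ : P →ₗ[F] (initialMonomials μ P → F) :=
      LinearMap.pi fun m => (lcoeff F m.1).comp P.subtype
    have hφ : Function.Injective φ := by
      rw [← LinearMap.ker_eq_bot, LinearMap.ker_eq_bot']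
      intro p hp
      by_contra hp0
      have hp0' : p.1 ≠ 0 := fun h => hp0 (Subtype.ext h)
      exact μ.coeff_degree_ne_zero_iff.mpr hp0'
        (congrFun hp ⟨μ.degree p.1, p.1, p.2, hp0', rfl⟩)
    have := LinearMap.finrank_le_finrank_of_injective hφ
    rwa [Module.finrank_fintype_fun_eq_card, ← Nat.card_eq_fintype_card, Nat.card_coe_set_eq] at this

end Initial

/-! ### Growth of spaces of forms under multiplication. -/

section Expansion
variable {σ F : Type*} [Field F] [Finite σ]
open MvPolynomial

instance finite_homogeneousSubmodule (d : ℕ) : Module.Finite F (homogeneousSubmodule σ F d) :=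
  Module.Finite.iff_fg.mpr (homogeneousSubmodule_fg σ F d)

omit [Finite σ] in
lemma homogeneousSubmodule_mul_eq (c d : ℕ) :
    homogeneousSubmodule σ F c * homogeneousSubmodule σ F d = homogeneousSubmodule σ F (c + d) := by
  rw [← homogeneousSubmodule_one_pow (R := F) (σ := σ) c,
    ← homogeneousSubmodule_one_pow (R := F) (σ := σ) d,
    ← homogeneousSubmodule_one_pow (R := F) (σ := σ) (c + d), pow_add]

omit [Finite σ] in
lemma initialMonomials_homogeneousSubmodule (μ : MonomialOrder σ) (d : ℕ) :
    initialMonomials μ (homogeneousSubmodule σ F d) = {m | m.degree = d} := by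
  classical
  ext m
  constructor
  · rintro ⟨f, hf, hf0, rfl⟩
    by_contra h
    exact μ.coeff_degree_ne_zero_iff.mpr hf0 (IsHomogeneous.coeff_eq_zero hf h)
  · intro h
    refine ⟨monomial m 1, isHomogeneous_monomial 1 h, by simp, ?_⟩
    rw [μ.degree_monomial, if_neg one_ne_zero]

variable (F) in
lemma finrank_homogeneousSubmodule (n d : ℕ) :
    Module.finrank F (homogeneousSubmodule (Fin (n + 1)) F d) = (d + n).choose n := by
  rw [← (ncard_initialMonomials MonomialOrder.lex _).2, initialMonomials_homogeneousSubmodule]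
  have : {m : Fin (n + 1) →₀ ℕ | m.degree = d} =
      (finsuppAntidiag univ d : Finset (Fin (n + 1) →₀ ℕ)) := by
    ext m
    simp [mem_finsuppAntidiag, degree_eq_univ_sum]
  rw [this, Set.ncard_coe_finset, card_finsuppAntidiag_nat_eq_choose, Finset.card_univ,
    Fintype.card_fin, show n + 1 + d - 1 = d + n by omega]
  exact (Nat.choose_symm_add (a := d) (b := n))

/-- Initial monomials are multiplicative, so multiplication by a variable shifts them. Equality may
fail, but only a lower bound for the product space is needed. -/
lemma upperShadow_subset_initialMonomials {n : ℕ} (μ : MonomialOrder (Fin (n + 1)))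
    (P : Submodule F (MvPolynomial (Fin (n + 1)) F)) [Module.Finite F P] :
    (upperShadow (ncard_initialMonomials μ P).1.toFinset : Set (Fin (n + 1) →₀ ℕ)) ⊆
      initialMonomials μ (homogeneousSubmodule (Fin (n + 1)) F 1 * P) := by
  intro m hm
  obtain ⟨t, ht, i, rfl⟩ := mem_upperShadow.mp hm
  obtain ⟨f, hf, hf0, rfl⟩ := (Set.Finite.mem_toFinset _).mp ht
  refine ⟨X i * f, Submodule.mul_mem_mul (isHomogeneous_X F i) hf,
    mul_ne_zero (X_ne_zero i) hf0, ?_⟩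
  rw [μ.degree_mul (X_ne_zero i) hf0, μ.degree_X]
  exact add_comm _ _

instance finite_homogeneousSubmodule_mul (c : ℕ) (P : Submodule F (MvPolynomial σ F))
    [Module.Finite F P] : Module.Finite F (homogeneousSubmodule σ F c * P : Submodule F _) :=
  Module.Finite.iff_fg.mpr ((homogeneousSubmodule_fg σ F c).mul (Module.Finite.iff_fg.mp ‹_›))

variable {n d : ℕ} {P : Submodule F (MvPolynomial (Fin (n + 1)) F)}

lemma finite_of_le_homogeneousSubmodule {P : Submodule F (MvPolynomial σ F)}
    (hP : P ≤ homogeneousSubmodule σ F d) : Module.Finite F P :=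
  Submodule.finiteDimensional_of_le hP

lemma degree_of_mem_initialMonomials {μ : MonomialOrder (Fin (n + 1))}
    (hP : P ≤ homogeneousSubmodule (Fin (n + 1)) F d) {m} (hm : m ∈ initialMonomials μ P) :
    m.degree = d := by
  have : m ∈ initialMonomials μ (homogeneousSubmodule (Fin (n + 1)) F d) := by
    obtain ⟨f, hf, h⟩ := hm
    exact ⟨f, hP hf, h⟩
  rwa [initialMonomials_homogeneousSubmodule] at this

/-- The shadow inequality for the initial monomials of `P`. The factors d + n + 1 and d + 1 are in
the ratio of dim S_{d+1} to dim S_d (`choose_succ_mul`), so this compares relative dimensions. -/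
lemma finrank_linear_mul_le (hP : P ≤ homogeneousSubmodule (Fin (n + 1)) F d) :
    (d + n + 1) * Module.finrank F P ≤
      (d + 1) * Module.finrank F (homogeneousSubmodule (Fin (n + 1)) F 1 * P : Submodule F _) := by
  have := finite_of_le_homogeneousSubmodule hP
  let μ : MonomialOrder (Fin (n + 1)) := MonomialOrder.lex
  obtain ⟨hfin, hcard⟩ := ncard_initialMonomials μ P
  have h' := ncard_initialMonomials μ (homogeneousSubmodule (Fin (n + 1)) F 1 * P)
  have h1 := card_upperShadow_le (T := hfin.toFinset) (d := d) fun m hm =>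
    degree_of_mem_initialMonomials hP ((Set.Finite.mem_toFinset _).mp hm)
  rw [← Set.ncard_eq_toFinset_card _ hfin, hcard, Fintype.card_fin,
    ← add_assoc] at h1
  refine h1.trans (Nat.mul_le_mul_left _ ?_)
  rw [← h'.2, ← Set.ncard_coe_finset]
  exact Set.ncard_le_ncard (upperShadow_subset_initialMonomials μ P) h'.1

lemma finrank_linear_mul_lt (hP : P < homogeneousSubmodule (Fin (n + 1)) F d) (hP0 : P ≠ ⊥) :
    (d + n + 1) * Module.finrank F P <
      (d + 1) * Module.finrank F (homogeneousSubmodule (Fin (n + 1)) F 1 * P : Submodule F _) := by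
  have := finite_of_le_homogeneousSubmodule hP.le
  let μ : MonomialOrder (Fin (n + 1)) := MonomialOrder.lex
  obtain ⟨hfin, hcard⟩ := ncard_initialMonomials μ P
  have h' := ncard_initialMonomials μ (homogeneousSubmodule (Fin (n + 1)) F 1 * P)
  have hne : hfin.toFinset.Nonempty := by
    obtain ⟨f, hf, hf0⟩ := Submodule.exists_mem_ne_zero_of_ne_bot hP0
    exact ⟨μ.degree f, (Set.Finite.mem_toFinset _).mpr ⟨f, hf, hf0, rfl⟩⟩
  -- Otherwise `P` would have all monomials of degree d as initial monomials, hence the dimension of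
  -- the whole space.
  obtain ⟨m', hm', hm'P⟩ : ∃ m' : Fin (n + 1) →₀ ℕ, m'.degree = d ∧ m' ∉ hfin.toFinset := by
    by_contra! H
    refine (Submodule.finrank_lt_finrank_of_lt hP).not_ge ?_
    rw [← hcard, ← (ncard_initialMonomials μ _).2, initialMonomials_homogeneousSubmodule]
    exact Set.ncard_le_ncard (fun m hm => (Set.Finite.mem_toFinset _).mp (H m hm)) hfin
  have h1 := card_upperShadow_lt (T := hfin.toFinset) (d := d) (fun m hm =>
    degree_of_mem_initialMonomials hP.le ((Set.Finite.mem_toFinset _).mp hm)) hne hm' hm'P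
  rw [← Set.ncard_eq_toFinset_card _ hfin, hcard, Fintype.card_fin,
    ← add_assoc] at h1
  refine h1.trans_le (Nat.mul_le_mul_left _ ?_)
  rw [← h'.2, ← Set.ncard_coe_finset]
  exact Set.ncard_le_ncard (upperShadow_subset_initialMonomials μ P) h'.1

lemma choose_succ_mul (n d : ℕ) :
    (d + 1 + n).choose n * (d + 1) = (d + n).choose n * (d + n + 1) := by
  have := Nat.choose_mul_succ_eq (d + n) n
  rw [this, show d + 1 + n = d + n + 1 by ring, show d + n + 1 - n = d + 1 by omega]

lemma homogeneousSubmodule_mul_le (c : ℕ) (hP : P ≤ homogeneousSubmodule (Fin (n + 1)) F d) :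
    homogeneousSubmodule (Fin (n + 1)) F c * P ≤ homogeneousSubmodule (Fin (n + 1)) F (c + d) :=
  (mul_le_mul' le_rfl hP).trans (homogeneousSubmodule_mul c d)

/-- Multiplication by forms does not decrease the relative dimension of a space of forms. -/
lemma finrank_mul_choose_le (c : ℕ) (hP : P ≤ homogeneousSubmodule (Fin (n + 1)) F d) :
    Module.finrank F P * (d + c + n).choose n ≤
      Module.finrank F (homogeneousSubmodule (Fin (n + 1)) F c * P : Submodule F _) *
        (d + n).choose n := by
  induction c with
  | zero =>
    rw [homogeneousSubmodule_zero, one_mul, add_zero]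
  | succ c ih =>
    have h1 := finrank_linear_mul_le (homogeneousSubmodule_mul_le c hP)
    rw [← mul_assoc, homogeneousSubmodule_mul_eq, add_comm 1 c] at h1
    have h2 := choose_succ_mul n (d + c)
    have hpos : 0 < d + c + 1 := by omega
    refine Nat.le_of_mul_le_mul_left (c := d + c + 1) ?_ hpos
    calc (d + c + 1) * (Module.finrank F P * (d + (c + 1) + n).choose n)
        = (d + c + n + 1) * (Module.finrank F P * (d + c + n).choose n) := by
          rw [← add_assoc]; linear_combination (Module.finrank F P) * h2
      _ ≤ (d + c + n + 1) * (Module.finrank F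
            (homogeneousSubmodule (Fin (n + 1)) F c * P : Submodule F _) * (d + n).choose n) :=
          Nat.mul_le_mul_left _ ih
      _ = ((c + d + n + 1) * Module.finrank F
            (homogeneousSubmodule (Fin (n + 1)) F c * P : Submodule F _)) * (d + n).choose n := by
          ring
      _ ≤ _ := Nat.mul_le_mul_right _ h1
      _ = _ := by ring

/-- Multiplication by forms of positive degree strictly increases the relative dimension of a
proper nonzero space of forms. -/
lemma finrank_mul_choose_lt {c : ℕ} (hc : 0 < c)
    (hP : P < homogeneousSubmodule (Fin (n + 1)) F d) (hP0 : P ≠ ⊥) :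
    Module.finrank F P * (d + c + n).choose n <
      Module.finrank F (homogeneousSubmodule (Fin (n + 1)) F c * P : Submodule F _) *
        (d + n).choose n := by
  obtain ⟨c, rfl⟩ : ∃ c', c = c' + 1 := ⟨c - 1, by omega⟩
  -- The strict gain is made in the first multiplication by linear forms; the other c factors only
  -- have to preserve it.
  have h0 := finrank_linear_mul_lt hP hP0
  have h1 := finrank_mul_choose_le c (homogeneousSubmodule_mul_le 1 hP.le)
  rw [← mul_assoc, homogeneousSubmodule_mul_eq] at h1
  have h2 := choose_succ_mul n d
  rw [add_comm 1 d] at h1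
  have hpos : 0 < (d + 1 + n).choose n := Nat.choose_pos (by omega)
  have hpos' : 0 < (d + 1 + c + n).choose n := Nat.choose_pos (by omega)
  rw [show d + (c + 1) + n = d + 1 + c + n by ring]
  refine Nat.lt_of_mul_lt_mul_left (a := (d + 1) * (d + 1 + n).choose n) ?_
  calc (d + 1) * (d + 1 + n).choose n * (Module.finrank F P * (d + 1 + c + n).choose n)
      = (d + n).choose n * (d + 1 + c + n).choose n * ((d + n + 1) * Module.finrank F P) := by
        linear_combination (Module.finrank F P * (d + 1 + c + n).choose n) * h2
    _ < (d + n).choose n * (d + 1 + c + n).choose n * ((d + 1) * Module.finrank F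
          (homogeneousSubmodule (Fin (n + 1)) F 1 * P : Submodule F _)) :=
        Nat.mul_lt_mul_of_pos_left h0 (Nat.mul_pos (Nat.choose_pos (by omega)) hpos')
    _ = (d + n).choose n * (d + 1) * (Module.finrank F
          (homogeneousSubmodule (Fin (n + 1)) F 1 * P : Submodule F _) *
            (d + 1 + c + n).choose n) := by ring
    _ ≤ (d + n).choose n * (d + 1) * _ := Nat.mul_le_mul_left _ h1
    _ = _ := by rw [add_comm c 1]; ring

end Expansion
end KernelBundle

namespace KernelBundle
open Finset MvPolynomial

/-! ### Counting tuples of vectors by the dimension of their span. -/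

section RankCount
variable {F W : Type*} [Field F] [Fintype F] [AddCommGroup W] [Module F W] [Fintype W]

omit [Fintype F] [Fintype W] in
lemma exists_finset_span_eq {s : ℕ} (v : Fin s → W) :
    ∃ B : Finset (Fin s), #B = Module.finrank F (Submodule.span F (Set.range v)) ∧
      ∀ x, ∃ c : B → F, v x = ∑ b, c b • v b := by
  classical
  obtain ⟨κ, f, hf, hspan, hli⟩ := exists_linearIndependent' F v
  have : Finite κ := Finite.of_injective f hf
  have := Fintype.ofFinite κ
  refine ⟨univ.map ⟨f, hf⟩, ?_, fun x => ?_⟩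
  · rw [card_map, ← hspan, finrank_span_eq_card hli, Finset.card_univ]
  · have hx : v x ∈ Submodule.span F (Set.range (v ∘ f)) :=
      hspan ▸ Submodule.subset_span ⟨x, rfl⟩
    obtain ⟨c, hc⟩ := (Submodule.mem_span_range_iff_exists_fun F).mp hx
    refine ⟨fun b => ∑ j with f j = b, c j, ?_⟩
    rw [← hc, sum_coe_sort (univ.map ⟨f, hf⟩) (fun b => (∑ j with f j = b, c j) • v b), sum_map]
    refine sum_congr rfl fun j _ => ?_
    have : univ.filter (fun x => f x = f j) = {j} := by ext; simp [hf.eq_iff]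
    rw [Function.Embedding.coeFn_mk, this, sum_singleton]; rfl

/-- The number of `s`-tuples of vectors spanning a subspace of dimension `p`. -/
lemma card_finrank_span_le (s p : ℕ) [DecidableEq W] :
    Nat.card {v : Fin s → W // Module.finrank F (Submodule.span F (Set.range v)) = p} ≤
      2 ^ s * Fintype.card F ^ (p * Module.finrank F W + p * (s - p)) := by
  classical
  -- A tuple is encoded by the positions of a basis of its span, the vectors there, and the
  -- coordinates of the remaining vectors. The choice of positions accounts for the factor 2^s.
  let X := (B : {B : Finset (Fin s) // #B = p}) × (B.1 → W) × ({x // x ∉ B.1} → B.1 → F)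
  let φ : X → Fin s → W := fun x i =>
    if h : i ∈ x.1.1 then x.2.1 ⟨i, h⟩ else ∑ b, x.2.2 ⟨i, h⟩ b • x.2.1 b
  have hφ : ∀ v : {v : Fin s → W // Module.finrank F (Submodule.span F (Set.range v)) = p},
      ∃ x, φ x = v.1 := by
    rintro ⟨v, hv⟩
    obtain ⟨B, hB, hc⟩ := exists_finset_span_eq (F := F) v
    choose c hc using hc
    refine ⟨⟨⟨B, hB.trans hv⟩, fun b => v b, fun x => c x⟩, funext fun i => ?_⟩
    by_cases h : i ∈ B
    · simp [φ, h]
    · simp only [φ, h, dif_neg, not_false_eq_true]; exact (hc i).symm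
  choose ψ hψ using hφ
  have hinj : Function.Injective ψ := fun v v' h => Subtype.ext (by rw [← hψ v, h, hψ v'])
  have hX : Fintype.card X ≤ 2 ^ s * Fintype.card F ^ (p * Module.finrank F W + p * (s - p)) := by
    rw [Fintype.card_sigma]
    have hB : ∀ B : {B : Finset (Fin s) // #B = p},
        Fintype.card ((B.1 → W) × ({x // x ∉ B.1} → B.1 → F)) =
          Fintype.card F ^ (p * Module.finrank F W + p * (s - p)) := by
      intro B
      have h1 : Fintype.card {x // x ∉ B.1} = s - p := by
        rw [Fintype.card_subtype_compl, Fintype.card_fin]; simp [B.2]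
      rw [Fintype.card_prod, Fintype.card_fun, Fintype.card_fun, Fintype.card_fun, h1,
        Fintype.card_coe, B.2, Module.card_eq_pow_finrank (K := F) (V := W), ← pow_mul, ← pow_mul,
        ← pow_add, mul_comm p (Module.finrank F W)]
    rw [sum_congr rfl fun B _ => hB B, sum_const, smul_eq_mul]
    refine Nat.mul_le_mul_right _ ?_
    rw [Finset.card_univ]
    calc _ ≤ Fintype.card (Finset (Fin s)) := Fintype.card_subtype_le _
      _ = 2 ^ s := by simp
  rw [Nat.card_eq_fintype_card]
  exact (Fintype.card_le_of_injective ψ hinj).trans hX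

end RankCount

/-! ### Matrices of forms and evaluation at a tuple. -/

section FormMatrix
variable (F : Type*) [Field F] (n : ℕ) {I J : Type*} [Fintype I] {d : I → ℕ} {e : J → ℕ}

/-- Matrices of forms `(m_{ji})` with `deg m_{ji} = e_j - d_i`. -/
abbrev FormMatrix (d : I → ℕ) (e : J → ℕ) : Type _ :=
  ∀ (j : J) (i : I), homogeneousSubmodule (Fin (n + 1)) F (e j - d i)

/-- Tuples of forms of degrees `d_i`. -/
abbrev FormTuple (d : I → ℕ) : Type _ := ∀ i : I, homogeneousSubmodule (Fin (n + 1)) F (d i)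

/-- The linear map `⨁ S_{d_i + D} → ⨁ S_{e_j + D}` given by a matrix of forms. -/
noncomputable def formMap (h : ∀ j i, d i ≤ e j) (D : ℕ) :
    FormMatrix F n d e →ₗ[F] FormTuple F n (fun i => d i + D) →ₗ[F]
      FormTuple F n (fun j => e j + D) :=
  LinearMap.mk₂ F
    (fun M f j => ⟨∑ i, (M j i).1 * (f i).1, IsHomogeneous.sum _ _ _ fun i _ => by
      have := (M j i).2.mul (f i).2
      rwa [← add_assoc, Nat.sub_add_cancel (h j i)] at this⟩)
    (fun M M' f => by ext j : 2; simp [add_mul, sum_add_distrib])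
    (fun c M f => by ext j : 2; simp [smul_sum])
    (fun M f f' => by ext j : 2; simp [mul_add, sum_add_distrib])
    (fun c M f => by ext j : 2; simp [smul_sum])

variable {F n}

@[simp] lemma formMap_apply_coe (h : ∀ j i, d i ≤ e j) (D : ℕ) (M : FormMatrix F n d e)
    (f : FormTuple F n (fun i => d i + D)) (j : J) :
    (formMap F n h D M f j).1 = ∑ i, (M j i).1 * (f i).1 := rfl

lemma finrank_formTuple (d : I → ℕ) :
    Module.finrank F (FormTuple F n d) = ∑ i, (d i + n).choose n := by
  rw [Module.finrank_pi_fintype]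
  exact sum_congr rfl fun i _ => finrank_homogeneousSubmodule F n (d i)

/-- Scalars are absorbed into `N`, so one element of `N` for each generator is enough. These
elements will be the entries of one row of a matrix of forms. -/
lemma mem_mul_span_range {R : Type*} [CommRing R] [Algebra F R] (N : Submodule F R) {ι : Type*}
    [Fintype ι] (v : ι → R) {x : R} (hx : x ∈ N * Submodule.span F (Set.range v)) :
    ∃ g : ι → N, x = ∑ i, (g i).1 * v i := by
  induction hx using Submodule.mul_induction_on' with
  | mem_mul_mem m hm p hp =>
    obtain ⟨c, rfl⟩ := (Submodule.mem_span_range_iff_exists_fun F).mp hp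
    exact ⟨fun i => ⟨c i • m, N.smul_mem _ hm⟩, by simp [mul_sum]⟩
  | add x _ y _ hx hy =>
    obtain ⟨g, rfl⟩ := hx
    obtain ⟨g', rfl⟩ := hy
    exact ⟨g + g', by simp [add_mul, sum_add_distrib]⟩

end FormMatrix

section Evaluation
variable {F : Type*} [Field F] {n a : ℕ} {d s : Fin (a + 1) → ℕ}
  {J : Type*} [Fintype J] {e : J → ℕ}

/-- The span of the components of degree `d_i` of a tuple of forms. -/
noncomputable def blockSpan (v : FormTuple F n (fun p : (i : Fin (a + 1)) × Fin (s i) => d p.1 + 0))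
    (i : Fin (a + 1)) : Submodule F (MvPolynomial (Fin (n + 1)) F) :=
  Submodule.span F (Set.range fun l => (v ⟨i, l⟩).1)

lemma blockSpan_le (v : FormTuple F n (fun p : (i : Fin (a + 1)) × Fin (s i) => d p.1 + 0))
    (i : Fin (a + 1)) : blockSpan v i ≤ homogeneousSubmodule (Fin (n + 1)) F (d i) :=
  Submodule.span_le.mpr (by rintro _ ⟨l, rfl⟩; exact (v ⟨i, l⟩).2)

/-- Matrices that vanish outside the columns of block m already produce every tuple with j-th entry
in S_{e_j - d_m} P_m, because the rows can be chosen independently. -/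
lemma sum_finrank_mul_blockSpan_le
    (h : ∀ (j : J) (p : (i : Fin (a + 1)) × Fin (s i)), d p.1 ≤ e j)
    (v : FormTuple F n (fun p : (i : Fin (a + 1)) × Fin (s i) => d p.1 + 0)) (m : Fin (a + 1))
    (hm : ∀ j, d m ≤ e j) :
    ∑ j, Module.finrank F (homogeneousSubmodule (Fin (n + 1)) F (e j - d m) * blockSpan v m :
        Submodule F _) ≤
      Module.finrank F (LinearMap.range ((formMap F n h 0).flip v)) := by
  classical
  have hfin (j : J) : Module.Finite F (homogeneousSubmodule (Fin (n + 1)) F (e j - d m) *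
      blockSpan v m : Submodule F _) := by
    have := finite_of_le_homogeneousSubmodule (blockSpan_le v m)
    infer_instance
  rw [← Module.finrank_pi_fintype]
  have hle (j : J) : (homogeneousSubmodule (Fin (n + 1)) F (e j - d m) * blockSpan v m) ≤
      homogeneousSubmodule (Fin (n + 1)) F (e j + 0) := by
    have := homogeneousSubmodule_mul_le (e j - d m) (blockSpan_le v m)
    rwa [Nat.sub_add_cancel (hm j)] at this
  let ι : (∀ j, (homogeneousSubmodule (Fin (n + 1)) F (e j - d m) * blockSpan v m :
      Submodule F _)) →ₗ[F] FormTuple F n (fun j => e j + 0) :=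
    LinearMap.pi fun j => (Submodule.inclusion (hle j)).comp (LinearMap.proj j)
  have hι : ∀ x, ι x ∈ LinearMap.range ((formMap F n h 0).flip v) := by
    intro x
    choose g hg using fun j => mem_mul_span_range _ _ (x j).2
    refine ⟨fun j p => if hp : p.1 = m then ⟨(g j (hp ▸ p.2)).1, ?_⟩ else 0, ?_⟩
    · obtain ⟨i, l⟩ := p
      obtain rfl : i = m := hp
      exact (g j l).2
    · ext j : 2
      rw [LinearMap.flip_apply, formMap_apply_coe, Fintype.sum_sigma, sum_eq_single m]
      · simp [ι, hg j]
      · intro i _ hi; simp [hi]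
      · simp
  refine LinearMap.finrank_le_finrank_of_injective (f := ι.codRestrict _ hι) fun x y hxy => ?_
  funext j
  have := congrArg (fun z => (z.1 j).1) hxy
  exact Subtype.ext this

end Evaluation
end KernelBundle

namespace KernelBundle
open Finset MvPolynomial

/-! ### The numerical inequality. -/

section Numerics

/-- The numerical inequality behind the dimension count. -/
lemma exponent_bound {a : ℕ} {w s p : Fin (a + 1) → ℕ} {A B T r wa ub : ℕ} (m : Fin (a + 1))
    (hA : A = ∑ i, s i * w i) (hp : ∀ i, p i ≤ w i) (hpm : p m < w m)
    (hratio : ∀ i, p i * w m ≤ p m * w i) (hwa : w m ≤ wa) (hub : 0 < ub) (hT : B ≤ T * ub)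
    (hr : p m * B + T ≤ w m * r)
    (hmax : ((max A B : ℕ) : ℚ) ≥ 1 / 4 * wa * ub * ∑ i, (w i : ℚ) ^ 2) :
    ∑ i, (p i * (w i - p i) + p i * s i) < A - B + 1 + r := by
  -- In the application w_i = dim S_{d_i}, p_i is the dimension of the i-th span, A and B are the
  -- dimensions of source and target, T is the number of rows and r the rank of evaluation. Writing
  -- X = ∑ p_i (w_i - p_i) and Y = ∑ p_i s_i, the claim is multiplied by w_m: then w_m Y ≤ p_m A and
  -- w_m r ≥ p_m B + T, and it remains to dominate w_m X.
  have hwm : 0 < w m := by omega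
  zify
  rw [sum_congr rfl (g := fun i => (p i : ℤ) * (w i - p i) + p i * s i)
    (fun i _ => by rw [Nat.cast_sub (hp i)]), sum_add_distrib]
  rw [← Int.cast_lt (R := ℚ)]
  push_cast
  -- The constant 1/4 of the theorem is the maximum of x(1 - x).
  have hX : ∑ i, (p i : ℚ) * (w i - p i) ≤ 1 / 4 * ∑ i, (w i : ℚ) ^ 2 := by
    rw [mul_sum]
    exact sum_le_sum fun i _ => by nlinarith [sq_nonneg ((w i : ℚ) - 2 * p i)]
  have hX0 : 0 ≤ ∑ i, (w i : ℚ) ^ 2 := sum_nonneg fun i _ => sq_nonneg _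
  have hY : (w m : ℚ) * ∑ i, (p i : ℚ) * s i ≤ p m * A := by
    rw [hA]
    push_cast
    rw [mul_sum, mul_sum]
    refine sum_le_sum fun i _ => ?_
    have : (p i : ℚ) * w m ≤ p m * w i := by exact_mod_cast hratio i
    have hs : (0 : ℚ) ≤ s i := Nat.cast_nonneg _
    nlinarith
  set X := ∑ i, (p i : ℚ) * (w i - p i)
  set Y := ∑ i, (p i : ℚ) * s i
  set Z := ∑ i, (w i : ℚ) ^ 2
  have hr' : (p m : ℚ) * B + T ≤ w m * r := by exact_mod_cast hr
  have hT' : (B : ℚ) ≤ T * ub := by exact_mod_cast hT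
  have hub' : (1 : ℚ) ≤ ub := by exact_mod_cast hub
  have hwm' : (0 : ℚ) < w m := by exact_mod_cast hwm
  have hwa' : (w m : ℚ) ≤ wa := by exact_mod_cast hwa
  have hpm' : (p m : ℚ) + 1 ≤ w m := by exact_mod_cast hpm
  have hpm0 : (0 : ℚ) ≤ p m := Nat.cast_nonneg _
  have hwX : (w m : ℚ) * X ≤ 1 / 4 * wa * Z := by nlinarith
  refine lt_of_mul_lt_mul_left ?_ hwm'.le
  rcases le_total A B with hAB | hAB
  -- Here B ≤ T ub turns the hypothesis into w_m X ≤ T, while p_m (A - B) ≤ 0.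
  · rw [max_eq_right hAB] at hmax
    have h1 : 1 / 4 * wa * Z ≤ T := by
      refine le_of_mul_le_mul_right (a := (ub : ℚ)) ?_ (by linarith)
      linarith [show 1 / 4 * (wa : ℚ) * ub * Z = 1 / 4 * wa * Z * ub by ring]
    have hAB' : (A : ℚ) ≤ B := by exact_mod_cast hAB
    rw [Nat.sub_eq_zero_of_le hAB]
    push_cast
    nlinarith
  -- Since ub ≥ 1, A ≤ ((A - B) + T) ub, so w_m X ≤ (A - B) + T. The additional A - B is absorbed by
  -- p_m + 1 ≤ w_m.
  · rw [max_eq_left hAB] at hmax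
    have hAB' : (B : ℚ) ≤ A := by exact_mod_cast hAB
    have h1 : 1 / 4 * wa * Z ≤ (A - B) + T := by
      refine le_of_mul_le_mul_right (a := (ub : ℚ)) ?_ (by linarith)
      nlinarith
    rw [Nat.cast_sub hAB]
    nlinarith

end Numerics

/-! ### Counting pairs (M, v) with Mv = 0 over a finite field. -/

section Counting
variable {F : Type*} [Field F] [Fintype F]

lemma card_ker_eq {H V : Type*} [AddCommGroup H] [Module F H] [Module.Finite F H]
    [AddCommGroup V] [Module F V] [Module.Finite F V] (f : H →ₗ[F] V) :
    Nat.card (LinearMap.ker f) =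
      Fintype.card F ^ (Module.finrank F H - Module.finrank F (LinearMap.range f)) := by
  rw [Module.natCard_eq_pow_finrank (K := F), Nat.card_eq_fintype_card,
    ← LinearMap.finrank_range_add_finrank_ker f, Nat.add_sub_cancel_left]

omit [Fintype F] in
/-- A linear map that is neither injective nor surjective has a kernel at least as large as
one plus the expected dimension. -/
lemma lt_finrank_ker {V W : Type*} [AddCommGroup V] [Module F V] [Module.Finite F V]
    [AddCommGroup W] [Module F W] [Module.Finite F W] (f : V →ₗ[F] W)
    (hi : ¬ Function.Injective f) (hs : ¬ Function.Surjective f) :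
    Module.finrank F V - Module.finrank F W + 1 ≤ Module.finrank F (LinearMap.ker f) := by
  have h1 := LinearMap.finrank_range_add_finrank_ker f
  have h2 : Module.finrank F (LinearMap.range f) < Module.finrank F W :=
    Submodule.finrank_lt (fun h => hs (LinearMap.range_eq_top.mp h))
  have h3 : 0 < Module.finrank F (LinearMap.ker f) := by
    rw [Nat.pos_iff_ne_zero]
    exact fun h => hi (LinearMap.ker_eq_bot.mp (Submodule.finrank_eq_zero.mp h))
  omega

omit [Fintype F] in
lemma card_pairs_swap {H V W : Type*} [AddCommGroup H] [Module F H] [Fintype H]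
    [AddCommGroup V] [Module F V] [Fintype V]
    [AddCommGroup W] [Module F W] (Φ : H →ₗ[F] V →ₗ[F] W) :
    ∑ M, Nat.card (LinearMap.ker (Φ M)) = ∑ v, Nat.card (LinearMap.ker (Φ.flip v)) := by
  classical
  have h1 (M : H) : Nat.card (LinearMap.ker (Φ M)) = ∑ v, if Φ M v = 0 then 1 else 0 := by
    rw [Finset.sum_boole, Nat.cast_id]
    exact Nat.subtype_card _ (by simp)
  have h2 (v : V) : Nat.card (LinearMap.ker (Φ.flip v)) = ∑ M, if Φ M v = 0 then 1 else 0 := by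
    rw [Finset.sum_boole, Nat.cast_id]
    exact Nat.subtype_card _ (by simp)
  simp_rw [h1, h2]
  exact sum_comm

lemma sum_card_ker_le {H V W : Type*} [AddCommGroup H] [Module F H] [Module.Finite F H]
    [AddCommGroup W] [Module F W] [Module.Finite F W] (Ψ : V → (H →ₗ[F] W))
    (S : Finset V) {K E c : ℕ} (hS : #S ≤ K * Fintype.card F ^ E)
    (hE : ∀ v ∈ S, E ≤ c + Module.finrank F (LinearMap.range (Ψ v))) :
    ∑ v ∈ S, Nat.card (LinearMap.ker (Ψ v)) ≤
      K * Fintype.card F ^ (Module.finrank F H + c) := by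
  have hq : 0 < Fintype.card F := Fintype.card_pos
  -- Each kernel has q^(dim H - rank) elements. Multiplying by q^E first avoids a subtraction of
  -- exponents that could be truncated.
  refine Nat.le_of_mul_le_mul_left (c := Fintype.card F ^ E) ?_ (pow_pos hq _)
  rw [mul_sum]
  calc ∑ v ∈ S, Fintype.card F ^ E * Nat.card (LinearMap.ker (Ψ v))
      ≤ ∑ v ∈ S, Fintype.card F ^ (Module.finrank F H + c) := by
        refine sum_le_sum fun v hv => ?_
        rw [card_ker_eq, ← pow_add]
        have h1 := hE v hv
        have h2 := LinearMap.finrank_range_add_finrank_ker (Ψ v)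
        exact Nat.pow_le_pow_right hq (by omega)
    _ = #S * Fintype.card F ^ (Module.finrank F H + c) := by rw [sum_const, smul_eq_mul]
    _ ≤ (K * Fintype.card F ^ E) * Fintype.card F ^ (Module.finrank F H + c) :=
        Nat.mul_le_mul_right _ hS
    _ = _ := by ring

/-- Counting pairs `(M, v)` with `M v = 0`: if the vectors `v ≠ 0` fall into few classes, each
small compared with the rank of `M ↦ M v`, then some `M` has maximal rank. -/
lemma exists_maximalRank_of_count {H V W T : Type*} [AddCommGroup H] [Module F H] [Fintype H]
    [AddCommGroup V] [Module F V] [Fintype V] [AddCommGroup W] [Module F W] [Fintype W]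
    [Fintype T] [DecidableEq T] [DecidableEq V] (Φ : H →ₗ[F] V →ₗ[F] W) (τ : V → T) (E : T → ℕ)
    {K : ℕ} (hK : ∀ t, #{v | τ v = t ∧ v ≠ 0} ≤ K * Fintype.card F ^ E t)
    (hE : ∀ v ≠ 0, E (τ v) ≤
      (Module.finrank F V - Module.finrank F W) + Module.finrank F (LinearMap.range (Φ.flip v)))
    (hq : Fintype.card T * K + 1 < Fintype.card F) :
    ∃ M, Function.Injective (Φ M) ∨ Function.Surjective (Φ M) := by
  by_contra! hno
  set c := Module.finrank F V - Module.finrank F W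
  set q := Fintype.card F
  set h := Module.finrank F H
  have hq0 : 0 < q := by omega
  -- The truncated difference c is the expected dimension of the kernel; failure of maximal rank
  -- costs at least one more dimension for every `M`.
  have hlow : q ^ (h + (c + 1)) ≤ ∑ M, Nat.card (LinearMap.ker (Φ M)) := by
    calc q ^ (h + (c + 1)) = ∑ _M : H, q ^ (c + 1) := by
          rw [sum_const, smul_eq_mul, Finset.card_univ, Module.card_eq_pow_finrank (K := F),
            ← pow_add]
      _ ≤ _ := sum_le_sum fun M _ => by
          rw [Module.natCard_eq_pow_finrank (K := F), Nat.card_eq_fintype_card]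
          exact Nat.pow_le_pow_right hq0 (lt_finrank_ker (Φ M) (hno M).1 (hno M).2)
  -- The vector 0 is killed by all q^h matrices, and each class of nonzero vectors contributes at
  -- most K q^(h+c) pairs.
  have hhigh : ∑ v, Nat.card (LinearMap.ker (Φ.flip v)) ≤
      q ^ h + Fintype.card T * (K * q ^ (h + c)) := by
    rw [← sum_filter_add_sum_filter_not univ (fun v : V => v = 0), Finset.filter_eq',
      if_pos (mem_univ _), sum_singleton]
    refine add_le_add ?_ ?_
    · rw [card_ker_eq]
      exact Nat.pow_le_pow_right hq0 (Nat.sub_le _ _)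
    · rw [← sum_fiberwise_of_maps_to (t := univ) (g := τ) (fun _ _ => mem_univ _)]
      calc _ ≤ ∑ _t : T, K * q ^ (h + c) := by
            refine sum_le_sum fun t _ => sum_card_ker_le _ _ (E := E t) ?_ ?_
            · refine le_trans (le_of_eq ?_) (hK t)
              congr 1; ext v; simp [and_comm]
            · intro v hv
              simp only [mem_filter, mem_univ, true_and] at hv
              exact hv.2 ▸ hE v hv.1
        _ = _ := by rw [sum_const, smul_eq_mul, Finset.card_univ]
  rw [← card_pairs_swap] at hhigh
  have h1 := hlow.trans hhigh
  have h2 : q ^ h ≤ q ^ (h + c) := Nat.pow_le_pow_right hq0 (by omega)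
  have h3 : q ^ (h + (c + 1)) = q * q ^ (h + c) := by ring
  have h4 : 0 < q ^ (h + c) := pow_pos hq0 _
  have h5 : (Fintype.card T * K + 1) * q ^ (h + c) < q * q ^ (h + c) :=
    Nat.mul_lt_mul_of_pos_right hq h4
  nlinarith

end Counting
end KernelBundle

namespace KernelBundle
open Finset MvPolynomial

/-! ### Maximal rank over a large finite field. -/

section FiniteField
variable {n a b : ℕ} {d s : Fin (a + 1) → ℕ} {e t : Fin (b + 1) → ℕ}

/-- The components of degree `d_i` of a tuple of forms. -/
def blockTuple {F : Type*} [Field F]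
    (v : FormTuple F n (fun p : (i : Fin (a + 1)) × Fin (s i) => d p.1 + 0)) (i : Fin (a + 1))
    (l : Fin (s i)) : homogeneousSubmodule (Fin (n + 1)) F (d i) := v ⟨i, l⟩

lemma finrank_blockSpan_eq {F : Type*} [Field F]
    (v : FormTuple F n (fun p : (i : Fin (a + 1)) × Fin (s i) => d p.1 + 0)) (i : Fin (a + 1)) :
    Module.finrank F (blockSpan v i) = Module.finrank F (Submodule.span F
      (Set.range (blockTuple v i))) := by
  have : blockSpan v i = (Submodule.span F (Set.range (blockTuple v i))).map
        (homogeneousSubmodule (Fin (n + 1)) F (d i)).subtype := by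
    rw [Submodule.map_span, ← Set.range_comp]; rfl
  rw [this]
  exact (LinearEquiv.finrank_eq
    (Submodule.equivMapOfInjective _ (Submodule.injective_subtype _) _)).symm

lemma card_finrank_blockSpan_le {F : Type*} [Field F] [Fintype F] (p : Fin (a + 1) → ℕ) :
    Nat.card {v : FormTuple F n (fun p : (i : Fin (a + 1)) × Fin (s i) => d p.1 + 0) //
        ∀ i, Module.finrank F (blockSpan v i) = p i} ≤
      2 ^ (∑ i, s i) * Fintype.card F ^
        (∑ i, (p i * ((d i + n).choose n - p i) + p i * s i)) := by
  classical
  have hfin (i) : Finite (homogeneousSubmodule (Fin (n + 1)) F (d i)) := Module.finite_of_finite F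
  have (i : Fin (a + 1)) := Fintype.ofFinite (homogeneousSubmodule (Fin (n + 1)) F (d i))
  let X (i) := {v : Fin (s i) → homogeneousSubmodule (Fin (n + 1)) F (d i) //
    Module.finrank F (Submodule.span F (Set.range v)) = p i}
  let φ : {v : FormTuple F n (fun p : (i : Fin (a + 1)) × Fin (s i) => d p.1 + 0) //
        ∀ i, Module.finrank F (blockSpan v i) = p i} → ∀ i, X i :=
    fun v i => ⟨blockTuple v.1 i, (finrank_blockSpan_eq v.1 i).symm.trans (v.2 i)⟩
  have hφ : Function.Injective φ := fun v v' h => Subtype.ext <| funext fun ⟨i, l⟩ =>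
    congrFun (congrArg Subtype.val (congrFun h i)) l
  refine (Nat.card_le_card_of_injective φ hφ).trans ?_
  rw [Nat.card_pi, ← prod_pow_eq_pow_sum, ← prod_pow_eq_pow_sum, ← prod_mul_distrib]
  refine prod_le_prod' fun i _ => ?_
  -- The truncated differences s_i - p_i and w_i - p_i are only correct when p_i ≤ s_i and p_i ≤
  -- w_i, which holds as soon as some tuple has this rank; otherwise the count is zero.
  rcases isEmpty_or_nonempty (X i) with h | ⟨⟨v, hv⟩⟩
  · simp
  refine (card_finrank_span_le (F := F) (s i) (p i)).trans (le_of_eq ?_)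
  have h1 : p i ≤ s i := by
    rw [← hv]
    exact (finrank_range_le_card v).trans_eq (Fintype.card_fin _)
  have h2 : p i ≤ (d i + n).choose n := by
    rw [← hv, ← finrank_homogeneousSubmodule F]
    exact Submodule.finrank_le _
  rw [finrank_homogeneousSubmodule]
  congr 2
  zify [h1, h2]
  ring

/-- The class of a nonzero tuple none of whose blocks spans its full space of forms is small
compared with the rank of evaluation. The growth theorem is applied to a block of maximal relative
dimension, which is nonzero and proper. -/
lemma blockSpan_rank_bound {F : Type*} [Field F] (hd : StrictMono d) (he : StrictMono e)
    (hde : ∀ i j, d i < e j)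
    (hmax : max (∑ i, (s i : ℚ) * ((d i + n).choose n : ℚ))
        (∑ j, (t j : ℚ) * ((e j + n).choose n : ℚ)) ≥
      1 / 4 * ((d (Fin.last a) + n).choose n : ℚ) * ((e (Fin.last b) + n).choose n : ℚ) *
        ∑ i, ((d i + n).choose n : ℚ) ^ 2)
    (h : ∀ (j : (j : Fin (b + 1)) × Fin (t j)) (p : (i : Fin (a + 1)) × Fin (s i)),
      d p.1 ≤ e j.1)
    (v : FormTuple F n (fun p : (i : Fin (a + 1)) × Fin (s i) => d p.1 + 0)) (hv : v ≠ 0)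
    (hnf : ∀ i, Module.finrank F (blockSpan v i) < (d i + n).choose n) :
    ∑ i, (Module.finrank F (blockSpan v i) *
        ((d i + n).choose n - Module.finrank F (blockSpan v i)) +
        Module.finrank F (blockSpan v i) * s i) <
      (∑ i, s i * (d i + n).choose n) - (∑ j, t j * (e j + n).choose n) + 1 +
        Module.finrank F (LinearMap.range ((formMap F n h 0).flip v)) := by
  have hw (i) : 0 < (d i + n).choose n := Nat.choose_pos (by omega)
  obtain ⟨m, -, hm⟩ := exists_max_image univ
    (fun i => (Module.finrank F (blockSpan v i) : ℚ) / (d i + n).choose n) univ_nonempty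
  have hratio (i) : Module.finrank F (blockSpan v i) * (d m + n).choose n ≤
      Module.finrank F (blockSpan v m) * (d i + n).choose n := by
    have := hm i (mem_univ i)
    rw [div_le_div_iff₀ (by exact_mod_cast hw i) (by exact_mod_cast hw m)] at this
    exact_mod_cast this
  have hfinm : Module.Finite F (blockSpan v m) := finite_of_le_homogeneousSubmodule (blockSpan_le v m)
  -- If the largest relative dimension were zero, every block would vanish and so would v.
  have hPm : blockSpan v m ≠ ⊥ := by
    intro hbot
    refine hv (funext fun ⟨i, l⟩ => ?_)
    have hi := hratio i
    have : Module.Finite F (blockSpan v i) := finite_of_le_homogeneousSubmodule (blockSpan_le v i)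
    rw [hbot, finrank_bot, zero_mul, Nat.le_zero, mul_eq_zero, or_iff_left (hw m).ne',
      Submodule.finrank_eq_zero] at hi
    have hl : (v ⟨i, l⟩).1 ∈ blockSpan v i := Submodule.subset_span ⟨l, rfl⟩
    rw [hi] at hl
    exact Subtype.ext hl
  have hlt : blockSpan v m < homogeneousSubmodule (Fin (n + 1)) F (d m) :=
    lt_of_le_of_ne (blockSpan_le v m) fun heq => by
      have := hnf m
      rw [heq, finrank_homogeneousSubmodule] at this
      exact this.false
  refine exponent_bound m (A := ∑ i, s i * (d i + n).choose n)
    (B := ∑ j, t j * (e j + n).choose n) (T := ∑ j, t j)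
    (wa := (d (Fin.last a) + n).choose n) (ub := (e (Fin.last b) + n).choose n) rfl
    (fun i => (hnf i).le) (hnf m) hratio ?_ (Nat.choose_pos (by omega)) ?_ ?_ ?_
  · exact Nat.choose_le_choose n (by have := hd.monotone (Fin.le_last m); omega)
  · rw [sum_mul]
    exact sum_le_sum fun j _ => Nat.mul_le_mul_left _
      (Nat.choose_le_choose n (by have := he.monotone (Fin.le_last j); omega))
  · refine le_trans ?_ (Nat.mul_le_mul_left _
      (sum_finrank_mul_blockSpan_le h v m fun j => (hde m j.1).le))
    have hsum : ∑ p : (j : Fin (b + 1)) × Fin (t j), Module.finrank F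
        (homogeneousSubmodule (Fin (n + 1)) F (e p.1 - d m) * blockSpan v m : Submodule F _) =
        ∑ j, t j * Module.finrank F
          (homogeneousSubmodule (Fin (n + 1)) F (e j - d m) * blockSpan v m : Submodule F _) :=
      (Fintype.sum_sigma _).trans (sum_congr rfl fun j _ => (sum_const (Module.finrank F
        (homogeneousSubmodule (Fin (n + 1)) F (e j - d m) * blockSpan v m :
          Submodule F _))).trans (by simp))
    rw [hsum, mul_sum, mul_sum, ← sum_add_distrib]
    refine sum_le_sum fun j _ => ?_
    -- A strict inequality of integers gains 1 in each row; summed over all rows this is the term T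
    -- of `exponent_bound`.
    have := finrank_mul_choose_lt (c := e j - d m) (by have := hde m j; omega) hlt hPm
    rw [show d m + (e j - d m) = e j by have := hde m j; omega] at this
    nlinarith [Nat.mul_le_mul_left (t j) (Nat.succ_le_of_lt this)]
  · push_cast
    exact hmax

/-- Over a sufficiently large finite field, some matrix of forms has maximal rank on global
sections. -/
theorem exists_maximalRank_of_finite (hd : StrictMono d) (he : StrictMono e)
    (hde : ∀ i j, d i < e j)
    (hmax : max (∑ i, (s i : ℚ) * ((d i + n).choose n : ℚ))
        (∑ j, (t j : ℚ) * ((e j + n).choose n : ℚ)) ≥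
      1 / 4 * ((d (Fin.last a) + n).choose n : ℚ) * ((e (Fin.last b) + n).choose n : ℚ) *
        ∑ i, ((d i + n).choose n : ℚ) ^ 2)
    (h : ∀ (j : (j : Fin (b + 1)) × Fin (t j)) (p : (i : Fin (a + 1)) × Fin (s i)),
      d p.1 ≤ e j.1) :
    ∃ N : ℕ, ∀ (F : Type u) [Field F] [Fintype F], N < Fintype.card F →
      ∃ M, Function.Injective (formMap F n h 0 M) ∨ Function.Surjective (formMap F n h 0 M) := by
  classical
  -- The number of possible dimension vectors times the constant 2^(∑ s_i) of the class sizes, plus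
  -- 1: the threshold of `exists_maximalRank_of_count`.
  refine ⟨Fintype.card (∀ i, Fin ((d i + n).choose n + 1)) * 2 ^ (∑ i, s i) + 1, ?_⟩
  intro F _ _ hF
  have hfin (c : ℕ) : Finite (homogeneousSubmodule (Fin (n + 1)) F c) := Module.finite_of_finite F
  have (c : ℕ) := Fintype.ofFinite (homogeneousSubmodule (Fin (n + 1)) F c)
  have hle (v : FormTuple F n (fun p : (i : Fin (a + 1)) × Fin (s i) => d p.1 + 0)) (i) :
      Module.finrank F (blockSpan v i) ≤ (d i + n).choose n := by
    rw [← finrank_homogeneousSubmodule F]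
    exact Submodule.finrank_mono (blockSpan_le v i)
  let A := ∑ i, s i * (d i + n).choose n
  have hA : Module.finrank F
      (FormTuple F n (fun p : (i : Fin (a + 1)) × Fin (s i) => d p.1 + 0)) = A := by
    rw [finrank_formTuple, Fintype.sum_sigma]; simp [A]
  have hB : Module.finrank F
      (FormTuple F n (fun p : (j : Fin (b + 1)) × Fin (t j) => e p.1 + 0)) =
        ∑ j, t j * (e j + n).choose n := by
    rw [finrank_formTuple, Fintype.sum_sigma]; simp
  refine exists_maximalRank_of_count (formMap F n h 0)
    (T := ∀ i, Fin ((d i + n).choose n + 1))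
    (fun v i => ⟨Module.finrank F (blockSpan v i), Nat.lt_succ_of_le (hle v i)⟩)
    -- When some block spans its whole space of forms the growth is not strict, but evaluation is
    -- then surjective, and the trivial bound q^A on the size of the class is enough.
    (fun p => if ∃ i, (p i : ℕ) = (d i + n).choose n then A else
      ∑ i, ((p i : ℕ) * ((d i + n).choose n - p i) + p i * s i))
    (K := 2 ^ (∑ i, s i)) (fun p => ?_) (fun v hv => ?_) hF
  · split_ifs with hp
    · refine (card_le_univ _).trans ?_
      rw [Module.card_eq_pow_finrank (K := F), hA]
      exact Nat.le_mul_of_pos_left _ (by positivity)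
    · refine le_trans ?_ (card_finrank_blockSpan_le (F := F) (n := n) (d := d) (s := s)
        (fun i => (p i : ℕ)))
      rw [Nat.subtype_card (univ.filter fun v : FormTuple F n _ =>
        ∀ i, Module.finrank F (blockSpan v i) = p i) (by simp)]
      refine card_le_card fun v hv => ?_
      simp only [mem_filter, mem_univ, true_and] at hv ⊢
      exact fun i => congrArg Fin.val (congrFun hv.1 i)
  · rw [hA, hB]
    dsimp only
    split_ifs with hp
    · obtain ⟨m, hm⟩ := hp
      have heq : blockSpan v m = homogeneousSubmodule (Fin (n + 1)) F (d m) :=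
        Submodule.eq_of_le_of_finrank_eq (blockSpan_le v m)
          (hm.trans (finrank_homogeneousSubmodule F n (d m)).symm)
      have h1 := sum_finrank_mul_blockSpan_le h v m fun j => (hde m j.1).le
      have h2 (j : (j : Fin (b + 1)) × Fin (t j)) :
          Module.finrank F (homogeneousSubmodule (Fin (n + 1)) F (e j.1 - d m) *
            blockSpan v m : Submodule F _) = (e j.1 + n).choose n := by
        rw [heq, homogeneousSubmodule_mul_eq, Nat.sub_add_cancel (hde m j.1).le,
          finrank_homogeneousSubmodule]
      simp only [h2, Fintype.sum_sigma, sum_const, smul_eq_mul, Finset.card_univ,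
        Fintype.card_fin] at h1
      omega
    · push Not at hp
      have := blockSpan_rank_bound hd he hde hmax h v hv fun i => lt_of_le_of_ne (hle v i) (hp i)
      omega

end FiniteField
end KernelBundle

namespace KernelBundle
open Finset MvPolynomial

/-! ### Maximal minors and change of the ground field. -/

section Minors
variable {F : Type*} [Field F] {ρ κ : Type*} [Fintype κ]

lemma exists_det_ne_zero_of_span_eq_top [DecidableEq κ] {ι : Type*} (v : ι → κ → F)
    (h : Submodule.span F (Set.range v) = ⊤) :
    ∃ f : κ → ι, (Matrix.of fun i => v (f i)).det ≠ 0 := by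
  obtain ⟨α, g, _, hspan, hli⟩ := exists_linearIndependent' F v
  have : Fintype α := @Fintype.ofFinite _ hli.finite
  have hcard : Fintype.card κ = Fintype.card α := by
    rw [← finrank_span_eq_card hli, hspan, h, finrank_top, Module.finrank_fintype_fun_eq_card]
  let ε := Fintype.equivOfCardEq hcard
  refine ⟨g ∘ ε, ?_⟩
  rw [← isUnit_iff_ne_zero, ← Matrix.isUnit_iff_isUnit_det, ← Matrix.linearIndependent_rows_iff_isUnit]
  exact hli.comp ε ε.injective

lemma exists_row_minor_of_injective [Finite ρ] [DecidableEq κ] (A : Matrix ρ κ F) (h : Function.Injective A.mulVecLin) :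
    ∃ f : κ → ρ, (A.submatrix f id).det ≠ 0 := by
  refine exists_det_ne_zero_of_span_eq_top (fun i => A i) (Submodule.eq_top_of_finrank_eq ?_)
  change Module.finrank F (Submodule.span F (Set.range A.row)) = _
  rw [← Matrix.rank_eq_finrank_span_row, Matrix.rank, LinearMap.finrank_range_of_inj h]

lemma exists_column_minor_of_surjective [Fintype ρ] [DecidableEq ρ] (A : Matrix ρ κ F) (h : Function.Surjective A.mulVecLin) :
    ∃ f : ρ → κ, (A.submatrix id f).det ≠ 0 := by
  obtain ⟨f, hf⟩ := exists_det_ne_zero_of_span_eq_top (fun i => A.transpose i)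
    (Submodule.eq_top_of_finrank_eq (by
      change Module.finrank F (Submodule.span F (Set.range A.col)) = _
      rw [← Matrix.rank_eq_finrank_span_cols, Matrix.rank, LinearMap.range_eq_top.mpr h,
        finrank_top]))
  refine ⟨f, fun h0 => hf ?_⟩
  rw [← h0, ← Matrix.det_transpose]
  rfl

lemma injective_of_row_minor [DecidableEq κ] (A : Matrix ρ κ F) (f : κ → ρ) (h : (A.submatrix f id).det ≠ 0) :
    Function.Injective A.mulVecLin := by
  rw [← LinearMap.ker_eq_bot, LinearMap.ker_eq_bot']
  intro x hx
  refine Matrix.eq_zero_of_mulVec_eq_zero h (funext fun i => ?_)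
  exact congrFun hx (f i)

lemma surjective_of_column_minor [Fintype ρ] [DecidableEq ρ] (A : Matrix ρ κ F) (f : ρ → κ)
    (h : (A.submatrix id f).det ≠ 0) : Function.Surjective A.mulVecLin := by
  rw [← LinearMap.range_eq_top]
  refine Submodule.eq_top_of_finrank_eq (le_antisymm (Submodule.finrank_le _) ?_)
  change _ ≤ A.rank
  refine le_trans (le_of_eq ?_) (Matrix.rank_submatrix_le A id f)
  rw [Matrix.rank_of_isUnit _ ((Matrix.isUnit_iff_isUnit_det _).mpr (isUnit_iff_ne_zero.mpr h)),
    Module.finrank_fintype_fun_eq_card]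

end Minors

section Coordinates
variable {F : Type*} [Field F] {n : ℕ} {I J : Type*} [Fintype I] {d : I → ℕ} {e : J → ℕ}

/-- The monomials of degree `c`. -/
abbrev Mon (n c : ℕ) : Type := {m : Fin (n + 1) →₀ ℕ // m.degree = c}

lemma finite_setOf_degree_eq (n c : ℕ) : {m : Fin (n + 1) →₀ ℕ | m.degree = c}.Finite := by
  rw [← initialMonomials_homogeneousSubmodule (F := ℚ) MonomialOrder.lex c]
  exact (ncard_initialMonomials MonomialOrder.lex _).1

noncomputable instance (n c : ℕ) : Fintype (Mon n c) := (finite_setOf_degree_eq n c).fintype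

lemma sum_monomial_coeff {c : ℕ} {f : MvPolynomial (Fin (n + 1)) F} (hf : f.IsHomogeneous c) :
    ∑ m : Mon n c, monomial m.1 (coeff m.1 f) = f := by
  classical
  ext u
  rw [coeff_sum]
  by_cases hu : u.degree = c
  · rw [sum_eq_single ⟨u, hu⟩]
    · simp
    · intro m _ hm
      rw [coeff_monomial, if_neg fun h => hm (Subtype.ext h)]
    · simp
  · rw [hf.coeff_eq_zero hu]
    exact sum_eq_zero fun m _ => by
      rw [coeff_monomial, if_neg fun h => hu (by rw [← h, m.2])]

/-- The coordinates of a tuple of forms with respect to the monomials. -/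
noncomputable def formCoords (d : I → ℕ) :
    FormTuple F n d ≃ₗ[F] ((i : I) × Mon n (d i) → F) where
  toFun f p := coeff p.2.1 (f p.1).1
  map_add' _ _ := by ext; simp
  map_smul' _ _ := by ext; simp
  invFun g i := ⟨∑ m : Mon n (d i), monomial m.1 (g ⟨i, m⟩), IsHomogeneous.sum _ _ _ fun m _ =>
    isHomogeneous_monomial _ m.2⟩
  left_inv f := by ext i : 2; exact sum_monomial_coeff (f i).2
  right_inv g := by
    classical
    ext ⟨i, m⟩
    simp only [coeff_sum, coeff_monomial]
    rw [sum_eq_single m (fun m' _ hm => if_neg fun h => hm (Subtype.ext h)) (by simp), if_pos rfl]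

/-- The matrix of a generic map `⨁ S_{d_i} → ⨁ S_{e_j}` in the monomial bases, with the
coefficients of the forms as variables. -/
noncomputable def genericMatrix (d : I → ℕ) (e : J → ℕ) (n : ℕ) :
    Matrix ((j : J) × Mon n (e j)) ((i : I) × Mon n (d i))
      (MvPolynomial (J × I × (Fin (n + 1) →₀ ℕ)) ℤ) := by
  classical
  exact fun q p => if p.2.1 ≤ q.2.1 then X (q.1, p.1, q.2.1 - p.2.1) else 0

/-- The generic matrix has a variable for every exponent vector, but only those of degree e_j - d_i
occur in its entries, so `c` is unconstrained elsewhere. -/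
lemma formCoords_formMap (h : ∀ j i, d i ≤ e j) (M : FormMatrix F n d e)
    (c : J × I × (Fin (n + 1) →₀ ℕ) → F)
    (hc : ∀ j i u, u.degree = e j - d i → c (j, i, u) = coeff u (M j i).1)
    (f : FormTuple F n (fun i => d i + 0)) :
    formCoords e (formMap F n h 0 M f) =
      ((genericMatrix d e n).map (aeval c)).mulVecLin (formCoords d f) := by
  classical
  ext ⟨j, m'⟩
  rw [Matrix.mulVecLin_apply, Matrix.mulVec, dotProduct, Fintype.sum_sigma]
  change coeff m'.1 (formMap F n h 0 M f j).1 = _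
  rw [formMap_apply_coe, coeff_sum]
  refine sum_congr rfl fun i _ => ?_
  conv_lhs => rw [← sum_monomial_coeff (f i).2, mul_sum, coeff_sum]
  refine sum_congr rfl fun m _ => ?_
  rw [coeff_mul_monomial']
  simp only [Matrix.map_apply, genericMatrix]
  split_ifs with hm
  · rw [aeval_X, hc]
    · rfl
    · have h1 := m'.2
      have h2 := m.2
      have h3 : (m'.1 - m.1).degree + m.1.degree = m'.1.degree := by
        rw [← map_add, tsub_add_cancel_of_le hm]
      dsimp only at h1 h2
      omega
  · simp

lemma mulVecLin_genericMatrix (h : ∀ j i, d i ≤ e j) (M : FormMatrix F n d e)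
    (c : J × I × (Fin (n + 1) →₀ ℕ) → F)
    (hc : ∀ j i u, u.degree = e j - d i → c (j, i, u) = coeff u (M j i).1) :
    ⇑((genericMatrix d e n).map (aeval c)).mulVecLin =
      formCoords e ∘ formMap F n h 0 M ∘ (formCoords d).symm := by
  funext x
  have := formCoords_formMap h M c hc ((formCoords d).symm x)
  rw [LinearEquiv.apply_symm_apply] at this
  exact this.symm

lemma det_map_aeval {ι ν : Type*} [Fintype ν] [DecidableEq ν] (c : ι → F)
    (B : Matrix ν ν (MvPolynomial ι ℤ)) : (B.map (aeval c)).det = aeval c B.det :=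
  (RingHom.map_det (aeval c : MvPolynomial ι ℤ →ₐ[ℤ] F).toRingHom B).symm

variable [Fintype J]

/-- Maximal rank over one field implies maximal rank over any infinite field of the same
characteristic, and over any infinite field of characteristic zero. -/
lemma exists_maximalRank_transfer {k : Type*} [Field k] [Infinite k]
    (hchar : ∀ z : ℤ, (z : k) = 0 → (z : F) = 0) (h : ∀ j i, d i ≤ e j)
    (hF : ∃ M, Function.Injective (formMap F n h 0 M) ∨ Function.Surjective (formMap F n h 0 M)) :
    ∃ M, Function.Injective (formMap k n h 0 M) ∨ Function.Surjective (formMap k n h 0 M) := by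
  classical
  obtain ⟨M, hM⟩ := hF
  let cF : J × I × (Fin (n + 1) →₀ ℕ) → F := fun p => coeff p.2.2 (M p.1 p.2.1).1
  have hMF := mulVecLin_genericMatrix h M cF fun _ _ _ _ => rfl
  -- An integer polynomial with a nonzero value over `F` has a coefficient that is nonzero in `F`,
  -- hence in `k` by `hchar`. Since `k` is infinite, the polynomial then takes a nonzero value over
  -- `k`.
  have key (P : MvPolynomial (J × I × (Fin (n + 1) →₀ ℕ)) ℤ) (hP : aeval cF P ≠ 0) :
      ∃ c : J × I × (Fin (n + 1) →₀ ℕ) → k, aeval c P ≠ 0 := by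
    by_contra! H
    refine hP ?_
    have h0 : map (Int.castRingHom k) P = 0 := MvPolynomial.funext fun x => by
      rw [map_zero, MvPolynomial.eval_map, ← H x]; rfl
    have h1 : map (Int.castRingHom F) P = 0 := by
      ext u
      have := congrArg (coeff u) h0
      rw [coeff_map, coeff_zero] at this ⊢
      exact hchar _ this
    have : aeval cF P = eval cF (map (Int.castRingHom F) P) := by rw [MvPolynomial.eval_map]; rfl
    rw [this, h1, map_zero]
  let Mk (c : J × I × (Fin (n + 1) →₀ ℕ) → k) : FormMatrix k n d e := fun j i =>
    ⟨∑ u : Mon n (e j - d i), monomial u.1 (c (j, i, u.1)), IsHomogeneous.sum _ _ _ fun u _ =>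
      isHomogeneous_monomial _ u.2⟩
  have hMk (c) := mulVecLin_genericMatrix h (Mk c) c fun j i u hu => by
    simp only [Mk, coeff_sum, coeff_monomial]
    rw [sum_eq_single ⟨u, hu⟩ (fun m' _ hm => if_neg fun h => hm (Subtype.ext h)) (by simp),
      if_pos rfl]
  rcases hM with hM | hM
  · obtain ⟨f, hf⟩ := exists_row_minor_of_injective ((genericMatrix d e n).map (aeval cF)) (by
      rw [hMF]
      exact (formCoords e).injective.comp (hM.comp (formCoords d).symm.injective))
    rw [Matrix.submatrix_map, det_map_aeval] at hf
    obtain ⟨c, hc⟩ := key _ hf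
    rw [← det_map_aeval, ← Matrix.submatrix_map] at hc
    have := injective_of_row_minor _ _ hc
    rw [hMk c] at this
    refine ⟨Mk c, Or.inl ?_⟩
    exact (Function.Injective.of_comp this).of_comp_right (formCoords d).symm.surjective
  · obtain ⟨f, hf⟩ := exists_column_minor_of_surjective ((genericMatrix d e n).map (aeval cF)) (by
      rw [hMF]
      exact (formCoords e).surjective.comp (hM.comp (formCoords d).symm.surjective))
    rw [Matrix.submatrix_map, det_map_aeval] at hf
    obtain ⟨c, hc⟩ := key _ hf
    rw [← det_map_aeval, ← Matrix.submatrix_map] at hc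
    have := surjective_of_column_minor _ _ hc
    rw [hMk c] at this
    refine ⟨Mk c, Or.inr ?_⟩
    exact (this.of_comp_left (formCoords e).injective).of_comp

end Coordinates

section InfiniteField
variable {n a b : ℕ} {d s : Fin (a + 1) → ℕ} {e t : Fin (b + 1) → ℕ}

/-- Over an infinite field, some matrix of forms has maximal rank on global sections. -/
theorem exists_maximalRank {k : Type*} [Field k] [Infinite k] (hd : StrictMono d) (he : StrictMono e)
    (hde : ∀ i j, d i < e j)
    (hmax : max (∑ i, (s i : ℚ) * ((d i + n).choose n : ℚ))
        (∑ j, (t j : ℚ) * ((e j + n).choose n : ℚ)) ≥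
      1 / 4 * ((d (Fin.last a) + n).choose n : ℚ) * ((e (Fin.last b) + n).choose n : ℚ) *
        ∑ i, ((d i + n).choose n : ℚ) ^ 2)
    (h : ∀ (j : (j : Fin (b + 1)) × Fin (t j)) (p : (i : Fin (a + 1)) × Fin (s i)),
      d p.1 ≤ e j.1) :
    ∃ M, Function.Injective (formMap k n h 0 M) ∨ Function.Surjective (formMap k n h 0 M) := by
  obtain ⟨N, hN⟩ := exists_maximalRank_of_finite hd he hde hmax h
  -- In characteristic zero every prime will do, because an integer that vanishes in `k` is 0; the
  -- prime 2 is taken.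
  obtain ⟨p, hp, hchar⟩ : ∃ p : ℕ, p.Prime ∧ ∀ z : ℤ, (z : k) = 0 → (p : ℤ) ∣ z := by
    rcases CharP.exists k with ⟨q, hq⟩
    rcases CharP.char_is_prime_or_zero k q with hp | rfl
    · exact ⟨q, hp, fun z hz => (CharP.intCast_eq_zero_iff k q z).mp hz⟩
    · refine ⟨2, Nat.prime_two, fun z hz => ?_⟩
      have := (CharP.intCast_eq_zero_iff k 0 z).mp hz
      rw [Nat.cast_zero, zero_dvd_iff] at this
      rw [this]; exact dvd_zero _
  have : Fact p.Prime := ⟨hp⟩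
  have := Fintype.ofFinite (GaloisField p (N + 1))
  refine exists_maximalRank_transfer (F := GaloisField p (N + 1)) (fun z hz => ?_) h
    (hN (GaloisField p (N + 1)) ?_)
  · exact (CharP.intCast_eq_zero_iff _ p z).mpr (hchar z hz)
  · rw [← Nat.card_eq_fintype_card, GaloisField.card p _ (Nat.succ_ne_zero N)]
    exact (Nat.lt_pow_self hp.one_lt).trans_le (Nat.pow_le_pow_right hp.pos (by omega))

end InfiniteField
end KernelBundle

namespace KernelBundle
open Finset MvPolynomial

/-! ### Openness of maximal rank. -/

section Openness
variable {k H V W : Type*} [Field k] [AddCommGroup H] [Module k H] [AddCommGroup V] [Module k V]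
  [AddCommGroup W] [Module k W] [Module.Finite k W]

/-- The polynomial is the determinant of the linear family `Θ` in coordinates; it is nonzero because
its value at `M₀` is 1. -/
lemma exists_polynomial_bijective (Θ : H →ₗ[k] W →ₗ[k] W) {m : ℕ} (b : Module.Basis (Fin m) k H)
    {M₀ : H} (h₀ : Θ M₀ = LinearMap.id) :
    ∃ p : MvPolynomial (Fin m) k, p ≠ 0 ∧
      ∀ M, MvPolynomial.eval (b.repr M) p ≠ 0 → Function.Bijective (Θ M) := by
  classical
  let c := Module.finBasis k W
  let P : Matrix _ _ (MvPolynomial (Fin m) k) :=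
    ∑ l, (X l : MvPolynomial (Fin m) k) • (LinearMap.toMatrix c c (Θ (b l))).map C
  have hP (M : H) : MvPolynomial.eval (b.repr M) P.det = LinearMap.det (Θ M) := by
    rw [RingHom.map_det, ← LinearMap.det_toMatrix c]
    congr 1
    conv_rhs => rw [← b.sum_repr M, map_sum, map_sum]
    ext i j
    simp [P, Matrix.sum_apply]
  refine ⟨P.det, fun h => ?_, fun M hM => ?_⟩
  · have := hP M₀
    rw [h, map_zero, h₀, LinearMap.det_id] at this
    exact zero_ne_one this
  · rw [hP] at hM
    exact (LinearEquiv.ofIsUnitDet (f := Θ M) (v := c) (v' := c) (by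
      rw [LinearMap.det_toMatrix]; exact isUnit_iff_ne_zero.mpr hM)).bijective

/-- Composition with a fixed right inverse of `Φ M₀` gives endomorphisms of `W` that are the
identity at `M₀`. Where the composite is bijective, `Φ M` is surjective. -/
lemma exists_polynomial_surjective (Φ : H →ₗ[k] V →ₗ[k] W) {m : ℕ} (b : Module.Basis (Fin m) k H)
    {M₀ : H} (h₀ : Function.Surjective (Φ M₀)) :
    ∃ p : MvPolynomial (Fin m) k, p ≠ 0 ∧
      ∀ M, MvPolynomial.eval (b.repr M) p ≠ 0 → Function.Surjective (Φ M) := by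
  obtain ⟨R, hR⟩ := (Φ M₀).exists_rightInverse_of_surjective (LinearMap.range_eq_top.mpr h₀)
  obtain ⟨p, hp, h⟩ := exists_polynomial_bijective ((LinearMap.lcomp k W R) ∘ₗ Φ) b hR
  exact ⟨p, hp, fun M hM => Function.Surjective.of_comp (h M hM).2⟩

omit [Module.Finite k W] in
lemma exists_polynomial_injective [Module.Finite k V] (Φ : H →ₗ[k] V →ₗ[k] W) {m : ℕ}
    (b : Module.Basis (Fin m) k H) {M₀ : H} (h₀ : Function.Injective (Φ M₀)) :
    ∃ p : MvPolynomial (Fin m) k, p ≠ 0 ∧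
      ∀ M, MvPolynomial.eval (b.repr M) p ≠ 0 → Function.Injective (Φ M) := by
  obtain ⟨L, hL⟩ := (Φ M₀).exists_leftInverse_of_injective (LinearMap.ker_eq_bot.mpr h₀)
  obtain ⟨p, hp, h⟩ := exists_polynomial_bijective ((LinearMap.llcomp k V W V L) ∘ₗ Φ) b hL
  exact ⟨p, hp, fun M hM => Function.Injective.of_comp (h M hM).1⟩

end Openness

/-! ### Surjectivity in high degrees. -/

section Surjectivity
variable {F : Type*} [Field F] {n : ℕ} {I J : Type*} [Fintype I] [Fintype J] {d : I → ℕ} {e : J → ℕ}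

omit [Fintype J] in
-- Every form of degree e_j + D + 1 is a combination of the variables with coefficients of degree
-- e_j + D, and these coefficients can be lifted.
lemma formMap_surjective_succ (h : ∀ j i, d i ≤ e j) {D : ℕ} {M : FormMatrix F n d e}
    (hM : Function.Surjective (formMap F n h D M)) :
    Function.Surjective (formMap F n h (D + 1) M) := by
  intro y
  have hy (j) : ∃ g : Fin (n + 1) → homogeneousSubmodule (Fin (n + 1)) F (e j + D),
      (y j).1 = ∑ l, (g l).1 * X l := by
    refine mem_mul_span_range _ _ ?_
    rw [← homogeneousSubmodule_one_eq_span_X, homogeneousSubmodule_mul_eq]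
    exact (y j).2
  choose g hg using hy
  choose f hf using fun l => hM fun j => g j l
  refine ⟨fun i => ⟨∑ l, (f l i).1 * X l, ?_⟩, ?_⟩
  · exact IsHomogeneous.sum _ _ (d i + D + 1) fun l _ =>
      IsHomogeneous.mul (f l i).2 (isHomogeneous_X F l)
  · ext j : 2
    rw [formMap_apply_coe, hg]
    simp_rw [mul_sum]
    rw [sum_comm]
    refine sum_congr rfl fun l _ => ?_
    have := congrArg Subtype.val (congrFun (hf l) j)
    rw [formMap_apply_coe] at this
    rw [← this, sum_mul]
    simp_rw [mul_assoc]

omit [Fintype J] in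
lemma formMap_surjective_of_le (h : ∀ j i, d i ≤ e j) {D D' : ℕ} (hD : D ≤ D')
    {M : FormMatrix F n d e} (hM : Function.Surjective (formMap F n h D M)) :
    Function.Surjective (formMap F n h D' M) := by
  induction hD with
  | refl => exact hM
  | step _ ih => exact formMap_surjective_succ h ih

omit [Fintype J] in
-- Degrees are compatible, so from any preimage one may keep the component of degree d_i + D of each
-- entry.
lemma exists_homogeneous_preimage (h : ∀ j i, d i ≤ e j) (D : ℕ) (M : FormMatrix F n d e)
    (y : FormTuple F n (fun j => e j + D)) (f : I → MvPolynomial (Fin (n + 1)) F)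
    (hf : ∀ j, ∑ i, (M j i).1 * f i = (y j).1) : ∃ f', formMap F n h D M f' = y := by
  refine ⟨fun i => ⟨homogeneousComponent (d i + D) (f i), homogeneousComponent_isHomogeneous _ _⟩, ?_⟩
  ext j : 2
  rw [formMap_apply_coe]
  have hy : homogeneousComponent (e j + D) (y j).1 = (y j).1 := by
    rw [homogeneousComponent_of_mem (y j).2, if_pos rfl]
  rw [← hy, ← hf j, map_sum]
  refine sum_congr rfl fun i _ => ?_
  have := DirectSum.coe_decompose_mul_add_of_left_mem (𝒜 := homogeneousSubmodule (Fin (n + 1)) F)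
    (j := d i + D) (b := f i) (M j i).2
  rw [← add_assoc, Nat.sub_add_cancel (h j i)] at this
  exact ((decomposition.decompose'_apply _ _).symm.trans (this.trans
    (congrArg ((M j i).1 * ·) (decomposition.decompose'_apply (f i) (d i + D))))).symm

/-- The elements annihilating the cokernel of a matrix of forms. -/
def cokernelAnnihilator (M : FormMatrix F n d e) : Ideal (MvPolynomial (Fin (n + 1)) F) where
  carrier := {g | ∀ y : J → MvPolynomial (Fin (n + 1)) F, ∃ f : I → MvPolynomial (Fin (n + 1)) F,
    ∀ j, ∑ i, (M j i).1 * f i = g * y j}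
  zero_mem' y := ⟨0, by simp⟩
  add_mem' := by
    intro g g' hg hg' y
    obtain ⟨f, hf⟩ := hg y
    obtain ⟨f', hf'⟩ := hg' y
    exact ⟨f + f', fun j => by simp [mul_add, sum_add_distrib, hf, hf', add_mul]⟩
  smul_mem' := by
    intro c g hg y
    obtain ⟨f, hf⟩ := hg (c • y)
    exact ⟨f, fun j => by rw [hf j, Pi.smul_apply, smul_eq_mul, smul_eq_mul]; ring⟩

/-- Cramer's rule: the adjugate of the chosen square submatrix gives the preimage. Coefficients of
equal columns are added up, so `σ` need not be injective. -/
lemma det_mem_cokernelAnnihilator [DecidableEq J] (M : FormMatrix F n d e) (σ : J → I) :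
    (Matrix.of fun j j' => (M j (σ j')).1).det ∈ cokernelAnnihilator M := by
  classical
  intro y
  set A := Matrix.of fun j j' => (M j (σ j')).1
  refine ⟨fun i => ∑ j' with σ j' = i, (A.adjugate.mulVec y) j', fun j => ?_⟩
  have h1 : A.mulVec (A.adjugate.mulVec y) j = A.det * y j := by
    rw [Matrix.mulVec_mulVec, Matrix.mul_adjugate, Matrix.smul_mulVec, Matrix.one_mulVec]
    rfl
  rw [← h1, Matrix.mulVec, dotProduct]
  simp_rw [mul_sum]
  rw [← sum_fiberwise_of_maps_to (t := univ) (g := σ) (fun _ _ => mem_univ _)]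
  refine sum_congr rfl fun i _ => sum_congr rfl fun j' hj' => ?_
  rw [← (mem_filter.mp hj').2]
  rfl

lemma exists_pow_dvd_of_degree (N : ℕ) (m : Fin (n + 1) →₀ ℕ) (hm : (n + 1) * N ≤ m.degree) :
    ∃ l, N ≤ m l := by
  by_contra! H
  rw [degree_eq_univ_sum] at hm
  have : ∑ l, m l < ∑ _l : Fin (n + 1), N :=
    sum_lt_sum_of_nonempty univ_nonempty fun l _ => H l
  simp at this
  omega

/-- If the N'-th power of each variable kills the cokernel, so does every monomial of degree at
least (n + 1) N', by the pigeonhole principle. Applied to the standard basis of the target, this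
gives surjectivity once all target degrees reach that bound. -/
lemma exists_formMap_surjective_of_radical (h : ∀ j i, d i ≤ e j) (M : FormMatrix F n d e)
    (hM : ∀ l, X l ∈ (cokernelAnnihilator M).radical) :
    ∃ D, Function.Surjective (formMap F n h D M) := by
  choose N hN using hM
  let N' := ∑ l, N l
  have hN' (l) : X l ^ N' ∈ cokernelAnnihilator M := by
    have hl : N l ≤ N' := single_le_sum (fun i _ => Nat.zero_le (N i)) (mem_univ l)
    rw [← Nat.sub_add_cancel hl, pow_add]
    exact Ideal.mul_mem_left _ _ (hN l)
  refine ⟨(n + 1) * N', fun y => ?_⟩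
  have hmon (j : J) (m : Fin (n + 1) →₀ ℕ) (hm : (n + 1) * N' ≤ m.degree) (c : F) :
      monomial m c ∈ cokernelAnnihilator M := by
    obtain ⟨l, hl⟩ := exists_pow_dvd_of_degree N' m hm
    have : m = (m - Finsupp.single l N') + Finsupp.single l N' := by
      rw [tsub_add_cancel_of_le (Finsupp.single_le_iff.mpr hl)]
    rw [this, ← mul_one c, ← monomial_mul, ← X_pow_eq_monomial]
    exact Ideal.mul_mem_left _ _ (hN' l)
  have hy (j) : (y j).1 ∈ cokernelAnnihilator M := by
    rw [← sum_monomial_coeff (y j).2]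
    exact sum_mem fun m _ => hmon j m.1 (by rw [m.2]; exact Nat.le_add_left _ _) _
  classical
  choose f hf using fun j => hy j (Pi.single j 1)
  refine exists_homogeneous_preimage h _ M y (fun i => ∑ j, f j i) fun j => ?_
  simp_rw [mul_sum]
  rw [sum_comm]
  simp_rw [hf]
  simp [Pi.single_apply]

/-- The band matrix with the powers of `X_l` on the `l`-th diagonal. -/
noncomputable def bandMatrix (d : I → ℕ) (e : J → ℕ) (n : ℕ) (F : Type*) [Field F] (ι : I → ℕ)
    (ν : J → ℕ) : FormMatrix F n d e := fun j i =>
  if h : ν j ≤ ι i ∧ ι i < ν j + (n + 1) then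
    ⟨X ⟨ι i - ν j, by omega⟩ ^ (e j - d i), isHomogeneous_X_pow _ _⟩ else 0

/-- Let P be a prime containing the annihilator, hence all maximal minors, and assume that it
contains the variables before X_l. Modulo P the square submatrix starting at column l is triangular
with powers of X_l on its diagonal, so P contains X_l. Having n more columns than rows leaves room
for all l ≤ n. -/
lemma bandMatrix_X_mem_radical (h : ∀ j i, d i < e j) (ι : I ≃ Fin (Fintype.card I))
    (ν : J ≃ Fin (Fintype.card J)) (hcard : Fintype.card J + n ≤ Fintype.card I)
    (l : Fin (n + 1)) :
    X l ∈ (cokernelAnnihilator (bandMatrix d e n F (fun i => ι i) (fun j => ν j))).radical := by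
  classical
  rw [Ideal.radical_eq_sInf, Ideal.mem_sInf]
  rintro P ⟨hP, hprime⟩
  obtain ⟨l, hl⟩ := l
  induction l using Nat.strong_induction_on with
  | _ l ih =>
  let σ : J → I := fun j => ι.symm ⟨ν j + l, by have := (ν j).2; omega⟩
  have hσ (j) : (ι (σ j) : ℕ) = ν j + l := by simp [σ]
  have hdet := hP (det_mem_cokernelAnnihilator (bandMatrix d e n F (fun i => ι i) (fun j => ν j)) σ)
  set A := Matrix.of fun j j' => (bandMatrix d e n F (fun i => ι i) (fun j => ν j) j (σ j')).1
  -- In row r and column r' + l the band matrix has a power of the variable with index r' + l - r,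
  -- or zero. Below the diagonal this index is less than l.
  let A' : Matrix (Fin (Fintype.card J)) (Fin (Fintype.card J)) (MvPolynomial (Fin (n + 1)) F ⧸ P) :=
    ((Ideal.Quotient.mk P).mapMatrix A).submatrix ν.symm ν.symm
  have hA' : A'.det = 0 := by
    rw [Matrix.det_submatrix_equiv_self, ← RingHom.map_det]
    exact Ideal.Quotient.eq_zero_iff_mem.mpr hdet
  rw [Matrix.det_of_isUpperTriangular] at hA'
  · obtain ⟨r, -, hr⟩ := prod_eq_zero_iff.mp hA'
    have hr' : (bandMatrix d e n F (fun i => ι i) (fun j => ν j) (ν.symm r) (σ (ν.symm r))).1 ∈ P :=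
      Ideal.Quotient.eq_zero_iff_mem.mp hr
    simp only [bandMatrix, hσ] at hr'
    rw [dif_pos ⟨by omega, by omega⟩] at hr'
    simp only [Nat.add_sub_cancel_left] at hr'
    exact hprime.mem_of_pow_mem _ hr'
  · intro r r' hrr'
    refine Ideal.Quotient.eq_zero_iff_mem.mpr ?_
    change (bandMatrix d e n F (fun i => ι i) (fun j => ν j) (ν.symm r) (σ (ν.symm r'))).1 ∈ P
    have hlt : (r' : ℕ) < r := hrr'
    simp only [bandMatrix, hσ, Equiv.apply_symm_apply]
    split_ifs with hc
    · refine Ideal.pow_mem_of_mem P (ih _ (by omega) _) _ ?_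
      have := h (ν.symm r) (σ (ν.symm r'))
      omega
    · exact P.zero_mem

/-- If there are at least `n` more columns than rows, some matrix of forms of positive degrees is
surjective in high degrees. -/
theorem exists_formMap_surjective (h : ∀ j i, d i < e j) (hcard : Fintype.card J + n ≤ Fintype.card I) :
    ∃ (M : FormMatrix F n d e) (D : ℕ),
      Function.Surjective (formMap F n (fun j i => (h j i).le) D M) :=
  ⟨_, exists_formMap_surjective_of_radical _ _
    (bandMatrix_X_mem_radical h (Fintype.equivFin I) (Fintype.equivFin J) hcard)⟩

end Surjectivity
end KernelBundle

namespace KernelBundle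
open TopologicalSpace Opposite MvPolynomial

noncomputable section
variable {n : ℕ} {k : Type u} [Field k]

/-! ### Rational sections of the line bundles. -/

section Regular

/-- The embedding of the polynomial ring into its fraction field. -/
abbrev toRat (f : MvPolynomial (Fin (n + 1)) k) : RatField n k := algebraMap _ (RatField n k) f

lemma toRat_injective : Function.Injective (toRat (n := n) (k := k)) :=
  IsFractionRing.injective (MvPolynomial (Fin (n + 1)) k) (RatField n k)

lemma toRat_ne_zero {f : MvPolynomial (Fin (n + 1)) k} : toRat f ≠ 0 ↔ f ≠ 0 := by
  rw [Ne, Ne, ← toRat_injective.eq_iff, toRat, toRat, map_zero]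

/-- The rational section `z` of `𝒪(d)` is regular at the point `x`. -/
def RegularAt (d : ℕ) (x : ProjectiveSpectrum (projGrading n k)) (z : RatField n k) : Prop :=
  ∃ (i : ℕ) (r s : MvPolynomial (Fin (n + 1)) k), r.IsHomogeneous (i + d) ∧ s.IsHomogeneous i ∧
    s ∉ x.asHomogeneousIdeal ∧ z = toRat r / toRat s

lemma one_notMem (x : ProjectiveSpectrum (projGrading n k)) :
    (1 : MvPolynomial (Fin (n + 1)) k) ∉ x.asHomogeneousIdeal :=
  (Ideal.ne_top_iff_one _).mp x.isPrime.ne_top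

lemma RegularAt.of_form {d : ℕ} (x : ProjectiveSpectrum (projGrading n k))
    {f : MvPolynomial (Fin (n + 1)) k} (hf : f.IsHomogeneous d) : RegularAt d x (toRat f) :=
  ⟨0, f, 1, by rwa [zero_add], isHomogeneous_one _ _, one_notMem x, by simp [toRat]⟩

lemma RegularAt.mul {d d' : ℕ} {x : ProjectiveSpectrum (projGrading n k)} {z z' : RatField n k}
    (h : RegularAt d x z) (h' : RegularAt d' x z') : RegularAt (d + d') x (z * z') := by
  obtain ⟨i, r, s, hr, hs, hsx, rfl⟩ := h
  obtain ⟨i', r', s', hr', hs', hsx', rfl⟩ := h'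
  refine ⟨i + i', r * r', s * s', ?_, hs.mul hs', mul_notMem x hsx hsx', ?_⟩
  · have := hr.mul hr'
    rwa [show i + d + (i' + d') = i + i' + (d + d') by ring] at this
  · simp only [toRat, map_mul]; rw [div_mul_div_comm]

lemma RegularAt.div_form {c d : ℕ} {x : ProjectiveSpectrum (projGrading n k)} {z : RatField n k}
    (h : RegularAt (c + d) x z) {g : MvPolynomial (Fin (n + 1)) k} (hg : g.IsHomogeneous c)
    (hgx : g ∉ x.asHomogeneousIdeal) : RegularAt d x (z / toRat g) := by
  obtain ⟨i, r, s, hr, hs, hsx, rfl⟩ := h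
  refine ⟨i + c, r, s * g, by rwa [add_assoc], hs.mul hg, mul_notMem x hsx hgx, ?_⟩
  simp only [toRat, map_mul]; rw [div_div]

lemma regularAt_of_mem_twistSections {d : ℕ}
    {U : Opens (ProjectiveSpectrum.top (projGrading n k))} (f : twistSections n k d U) (x : U) :
    RegularAt d x.1 (f.1 x) := by
  obtain ⟨V, hV, i, j, r, s, h⟩ := f.2 x
  exact ⟨j, r.1, s.1, r.2, s.2, (h ⟨x.1, hV⟩).1, (h ⟨x.1, hV⟩).2⟩

/-- A rational section that is regular on `U` is a section over `U`. -/
def twistMk {d : ℕ} (U : Opens (ProjectiveSpectrum.top (projGrading n k))) (z : RatField n k)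
    (hz : ∀ x ∈ U, RegularAt d x z) : twistSections n k d U :=
  ⟨fun _ => z, fun x => by
    obtain ⟨i, r, s, hr, hs, hsx, rfl⟩ := hz x.1 x.2
    exact ⟨U ⊓ ProjectiveSpectrum.basicOpen _ s, ⟨x.2, hsx⟩, Opens.infLELeft _ _, i, ⟨r, hr⟩,
      ⟨s, hs⟩, fun y => ⟨y.2.2, rfl⟩⟩⟩

variable (n k) in
/-- The generic point of projective space. -/
def genericPt : ProjectiveSpectrum (projGrading n k) where
  asHomogeneousIdeal := ⊥
  isPrime := Ideal.isPrime_bot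
  not_irrelevant_le h := by
    have h1 : (X 0 : MvPolynomial (Fin (n + 1)) k) ∈
        HomogeneousIdeal.irrelevant (projGrading n k) := by
      rw [HomogeneousIdeal.mem_irrelevant_iff, GradedRing.proj_apply,
        DirectSum.decompose_of_mem_ne (ℳ := projGrading n k) (isHomogeneous_X k 0) one_ne_zero]
    exact X_ne_zero (R := k) (0 : Fin (n + 1)) (h h1)

lemma notMem_genericPt {f : MvPolynomial (Fin (n + 1)) k} :
    f ∉ (genericPt n k).asHomogeneousIdeal ↔ f ≠ 0 := Iff.rfl

lemma genericPt_mem {U : Opens (ProjectiveSpectrum.top (projGrading n k))}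
    {x : ProjectiveSpectrum (projGrading n k)} (hx : x ∈ U) : genericPt n k ∈ U := by
  obtain ⟨_, ⟨f, rfl⟩, hfx, hfU⟩ :=
    (ProjectiveSpectrum.isTopologicalBasis_basic_opens (projGrading n k)).exists_subset_of_mem_open
      hx U.2
  exact hfU (notMem_genericPt.mpr fun h => hfx (h ▸ zero_mem _))

/-- Sections of `𝒪(d)` are constant as functions to the fraction field. -/
lemma twistSections_apply_eq {d : ℕ} {U : Opens (ProjectiveSpectrum.top (projGrading n k))}
    (f : twistSections n k d U) (x y : U) : f.1 x = f.1 y := by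
  have key (x : U) : f.1 x = f.1 ⟨genericPt n k, genericPt_mem x.2⟩ := by
    obtain ⟨V, hV, i, j, r, s, h⟩ := f.2 x
    have h1 := (h ⟨x.1, hV⟩).2
    have h2 := (h ⟨genericPt n k, genericPt_mem hV⟩).2
    exact h1.trans h2.symm
  rw [key x, key y]

lemma localToRat_injective (x : ProjectiveSpectrum (projGrading n k)) :
    Function.Injective (localToRat x) := by
  rw [injective_iff_map_eq_zero]
  intro a ha
  obtain ⟨c, rfl⟩ := HomogeneousLocalization.mk_surjective a
  rw [localToRat_mk, div_eq_zero_iff,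
    or_iff_left (algebraMap_ne_zero_of_notMem x c.den_mem)] at ha
  have h0 : (c.num : MvPolynomial (Fin (n + 1)) k) = 0 := toRat_injective (ha.trans (map_zero _).symm)
  refine HomogeneousLocalization.val_injective _ ?_
  rw [HomogeneousLocalization.val_mk, h0, Localization.mk_zero, HomogeneousLocalization.val_zero]

/-- A rational function that is regular on `U` is a section of the structure sheaf. -/
lemma exists_structureSheaf_section {U : Opens (ProjectiveSpectrum.top (projGrading n k))}
    (z : RatField n k) (hz : ∀ x ∈ U, RegularAt 0 x z) :
    ∃ r : (ProjectiveSpectrum.Proj.structureSheaf (projGrading n k)).1.obj (op U),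
      ∀ x : U, localToRat x.1 (r.1 x) = z := by
  have hloc (x : U) : ∃ a, localToRat x.1 a = z := by
    obtain ⟨i, r, s, hr, hs, hsx, hzx⟩ := hz x.1 x.2
    exact ⟨HomogeneousLocalization.mk ⟨i, ⟨r, hr⟩, ⟨s, hs⟩, hsx⟩,
      (localToRat_mk x.1 _).trans hzx.symm⟩
  choose g hg using hloc
  refine ⟨⟨g, fun x => ?_⟩, hg⟩
  obtain ⟨i, r, s, hr, hs, hsx, hzx⟩ := hz x.1 x.2
  refine ⟨U ⊓ ProjectiveSpectrum.basicOpen _ s, ⟨x.2, hsx⟩, Opens.infLELeft _ _, i, ⟨r, hr⟩,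
    ⟨s, hs⟩, fun y => y.2.2, fun y => localToRat_injective y.1 ?_⟩
  have h1 := hg ⟨y.1, y.2.1⟩
  have h2 := localToRat_mk y.1 ⟨i, ⟨r, hr⟩, ⟨s, hs⟩, y.2.2⟩
  exact h1.trans (hzx.trans h2.symm)

lemma structureSheaf_ext {U : Opens (ProjectiveSpectrum.top (projGrading n k))}
    {r r' : (ProjectiveSpectrum.Proj.structureSheaf (projGrading n k)).1.obj (op U)}
    (h : ∀ x : U, localToRat x.1 (r.1 x) = localToRat x.1 (r'.1 x)) : r = r' :=
  Subtype.ext (funext fun x => localToRat_injective x.1 (h x))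

lemma isHomogeneous_of_mul {q i : ℕ} {r s : MvPolynomial (Fin (n + 1)) k} (hs : s.IsHomogeneous i)
    (hs0 : s ≠ 0) (h : (r * s).IsHomogeneous (q + i)) : r.IsHomogeneous q := by
  have key (q' : ℕ) (hq' : q' ≠ q) : homogeneousComponent q' r = 0 := by
    have h1 := DirectSum.coe_decompose_mul_add_of_right_mem (𝒜 := projGrading n k)
      (i := q') (a := r) hs
    have h2 : (DirectSum.decompose (projGrading n k) (r * s) (q' + i) :
        MvPolynomial (Fin (n + 1)) k) = 0 :=
      DirectSum.decompose_of_mem_ne (ℳ := projGrading n k) h (by omega)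
    rw [h2] at h1
    have h3 := (mul_eq_zero.mp h1.symm).resolve_right hs0
    exact (decomposition.decompose'_apply r q').symm.trans h3
  rw [← sum_homogeneousComponent r]
  refine IsHomogeneous.sum _ _ _ fun q' _ => ?_
  by_cases hq : q' = q
  · exact hq ▸ homogeneousComponent_isHomogeneous q' r
  · rw [key q' hq]; exact isHomogeneous_zero _ _ _

/-- A rational section of `𝒪(d)` that is regular where the form `g` does not vanish is a form
divided by a power of `g`. -/
lemma exists_form_div_pow {d m : ℕ} (hm : 0 < m) {g : MvPolynomial (Fin (n + 1)) k}
    (hg : g.IsHomogeneous m) (hg0 : g ≠ 0) {z : RatField n k}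
    (hz : ∀ x ∈ ProjectiveSpectrum.basicOpen (projGrading n k) g, RegularAt d x z) :
    ∃ (N : ℕ) (r : MvPolynomial (Fin (n + 1)) k), r.IsHomogeneous (d + N * m) ∧
      z = toRat r / toRat g ^ N := by
  -- The ideal of denominators of z. A homogeneous prime that contains its homogeneous core but not
  -- g would be a point where z is regular, and a denominator there would contradict the
  -- containment.
  let J : Ideal (MvPolynomial (Fin (n + 1)) k) :=
    { carrier := {s | ∃ r, toRat r = toRat s * z}
      zero_mem' := ⟨0, by simp [toRat]⟩
      add_mem' := by
        rintro s s' ⟨r, hr⟩ ⟨r', hr'⟩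
        exact ⟨r + r', by simp only [toRat, map_add, add_mul] at *; rw [hr, hr']⟩
      smul_mem' := by
        rintro c s ⟨r, hr⟩
        exact ⟨c * r, by simp only [toRat, map_mul, smul_eq_mul, mul_assoc] at *; rw [hr]⟩ }
  have hrad : g ∈ (J.homogeneousCore (projGrading n k)).toIdeal.radical := by
    rw [Ideal.IsHomogeneous.radical_eq (HomogeneousIdeal.isHomogeneous _), Ideal.mem_sInf]
    rintro P ⟨hPhom, hJP, hP⟩
    by_contra hgP
    let x : ProjectiveSpectrum (projGrading n k) :=
      { asHomogeneousIdeal := ⟨P, hPhom⟩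
        isPrime := hP
        not_irrelevant_le := fun h => hgP (h (by
          rw [HomogeneousIdeal.mem_irrelevant_iff, GradedRing.proj_apply,
            DirectSum.decompose_of_mem_ne (ℳ := projGrading n k) hg hm.ne'])) }
    obtain ⟨i, r, s, hr, hs, hsx, hzrs⟩ := hz x hgP
    refine hsx (hJP (Ideal.mem_homogeneousCore_of_homogeneous_of_mem (𝒜 := projGrading n k)
      ⟨i, hs⟩ ⟨r, ?_⟩))
    rw [hzrs, mul_div_cancel₀]
    exact algebraMap_ne_zero_of_notMem x hsx
  obtain ⟨N, hN⟩ := hrad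
  obtain ⟨r, hr⟩ := Ideal.toIdeal_homogeneousCore_le _ _ hN
  refine ⟨N, r, ?_, ?_⟩
  -- The numerator found so far need not be homogeneous; its degree is read off from a homogeneous
  -- fraction for z at the generic point.
  · obtain ⟨i, r', s, hr', hs, hsx, hzrs⟩ := hz (genericPt n k) (notMem_genericPt.mpr hg0)
    have hs0 : s ≠ 0 := notMem_genericPt.mp hsx
    refine isHomogeneous_of_mul hs hs0 ?_
    have : r * s = g ^ N * r' := by
      apply toRat_injective
      have h1 : toRat s ≠ 0 := toRat_ne_zero.mpr hs0
      have h2 : toRat (r * s) = toRat r * toRat s := map_mul _ _ _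
      have h3 : toRat (g ^ N * r') = toRat (g ^ N) * toRat r' := map_mul _ _ _
      rw [h2, h3, hr, hzrs]
      field_simp
    rw [this]
    have := (hg.pow N).mul hr'
    rwa [show m * N + (i + d) = d + N * m + i by ring] at this
  · have h1 : toRat g ≠ 0 := toRat_ne_zero.mpr hg0
    have h2 : toRat (g ^ N) = toRat g ^ N := map_pow _ _ _
    rw [hr, h2]
    field_simp

end Regular
end
end KernelBundle

namespace KernelBundle
open TopologicalSpace Opposite MvPolynomial

noncomputable section
variable {n : ℕ} {k : Type u} [Field k]

/-! ### Sections as rational functions. -/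

section Values
variable {d : ℕ}

lemma mem_twistSections {U : Opens (ProjectiveSpectrum.top (projGrading n k))} (f : U → RatField n k)
    (hconst : ∀ x y, f x = f y) (hreg : ∀ x : U, RegularAt d x.1 (f x)) :
    f ∈ twistSections n k d U := by
  intro x
  obtain ⟨i, r, s, hr, hs, hsx, hz⟩ := hreg x
  exact ⟨U ⊓ ProjectiveSpectrum.basicOpen _ s, ⟨x.2, hsx⟩, Opens.infLELeft _ _, i, ⟨r, hr⟩,
    ⟨s, hs⟩, fun y => ⟨y.2.2, (hconst _ _).trans hz⟩⟩

/-- The value at `x` of a section of `𝒪(d)`, as a rational function. -/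
def val {U : (ProjSpace n k).Opens} (x : ProjSpace n k) (hx : x ∈ U) :
    Γ(twist n k d, U) →+ RatField n k where
  toFun f := (show twistSections n k d U from f).1 ⟨x, hx⟩
  map_zero' := rfl
  map_add' _ _ := rfl

variable {U V : (ProjSpace n k).Opens}

lemma val_eq_val (f : Γ(twist n k d, U)) {x y : ProjSpace n k} (hx : x ∈ U) (hy : y ∈ U) :
    val x hx f = val y hy f := twistSections_apply_eq _ _ _

lemma val_ext {f g : Γ(twist n k d, U)} (h : ∀ x hx, val x hx f = val x hx g) : f = g :=
  Subtype.ext (funext fun x => h x.1 x.2)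

lemma val_ext_of_mem {f g : Γ(twist n k d, U)} {x : ProjSpace n k} (hx : x ∈ U)
    (h : val x hx f = val x hx g) : f = g :=
  val_ext fun y hy => by rw [val_eq_val f hy hx, val_eq_val g hy hx, h]

lemma val_map (i : V ⟶ U) (f : Γ(twist n k d, U)) {x : ProjSpace n k} (hx : x ∈ V) :
    val x hx ((twist n k d).presheaf.map i.op f) = val x (i.le hx) f := rfl

lemma regularAt_val (f : Γ(twist n k d, U)) {x : ProjSpace n k} (hx : x ∈ U) :
    RegularAt d x (val x hx f) := regularAt_of_mem_twistSections (show twistSections n k d U from f) ⟨x, hx⟩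

/-- The value at `x` of a regular function, as a rational function. -/
def fval (x : ProjSpace n k) (hx : x ∈ U) : Γ(ProjSpace n k, U) →+* RatField n k :=
  (localToRat x).comp
    (AlgebraicGeometry.openToLocalization (projGrading n k) U x hx).hom

lemma val_smul (r : Γ(ProjSpace n k, U)) (f : Γ(twist n k d, U)) {x : ProjSpace n k} (hx : x ∈ U) :
    val x hx (r • f) = fval x hx r * val x hx f := rfl

lemma fval_ext {r r' : Γ(ProjSpace n k, U)} (h : ∀ x hx, fval x hx r = fval x hx r') : r = r' :=
  structureSheaf_ext fun x => h x.1 x.2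

lemma exists_fval_eq (z : RatField n k) (hz : ∀ x ∈ U, RegularAt 0 x z) :
    ∃ r : Γ(ProjSpace n k, U), ∀ x hx, fval x hx r = z := by
  obtain ⟨r, hr⟩ := exists_structureSheaf_section (U := U) z hz
  exact ⟨r, fun x hx => hr ⟨x, hx⟩⟩

lemma fval_constantOn (c : k) {x : ProjSpace n k} (hx : x ∈ U) :
    fval x hx (constantOn (op U) c : Γ(ProjSpace n k, U)) = toRat (C c) := by
  have h := localToRat_mk (k := k) x ⟨0, algebraMap k (projGrading n k 0) c, 1, one_notMem x⟩
  refine Eq.trans (b := localToRat x (constantAt x c)) rfl ?_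
  refine Eq.trans h ?_
  rw [show ((1 : projGrading n k 0) : MvPolynomial (Fin (n + 1)) k) = 1 from rfl, map_one, div_one]
  rfl

end Values

/-! ### Maps between line bundles are forms. -/

section MulHom
variable {d e : ℕ}

lemma mul_mem_twistSections (h : d ≤ e) {g : MvPolynomial (Fin (n + 1)) k}
    (hg : g.IsHomogeneous (e - d)) {U : Opens (ProjectiveSpectrum.top (projGrading n k))}
    (f : twistSections n k d U) : (fun x => toRat g * f.1 x) ∈ twistSections n k e U := by
  refine mem_twistSections _ (fun x y => by rw [twistSections_apply_eq f x y]) fun x => ?_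
  have := (RegularAt.of_form x.1 hg).mul (regularAt_of_mem_twistSections f x)
  rwa [Nat.sub_add_cancel h] at this

/-- Multiplication by a form of degree `e - d`, as a map `𝒪(d) ⟶ 𝒪(e)`. -/
def mulHom (h : d ≤ e) (g : homogeneousSubmodule (Fin (n + 1)) k (e - d)) :
    twist n k d ⟶ twist n k e :=
  SheafOfModules.Hom.mk (PresheafOfModules.homMk
    { app := fun U => AddCommGrpCat.ofHom
        (X := twistSections n k d U.unop) (Y := twistSections n k e U.unop)
        { toFun := fun f => ⟨_, mul_mem_twistSections h g.2 f⟩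
          map_zero' := Subtype.ext (funext fun x => mul_zero _)
          map_add' := fun f f' => Subtype.ext (funext fun x => mul_add _ _ _) }
      naturality := fun U V i => rfl }
    (fun U r m => by
      refine Subtype.ext (funext fun x => ?_)
      exact mul_left_comm _ _ _))

lemma val_mulHom (h : d ≤ e) (g : homogeneousSubmodule (Fin (n + 1)) k (e - d))
    {U : (ProjSpace n k).Opens} (f : Γ(twist n k d, U)) {x : ProjSpace n k} (hx : x ∈ U) :
    val x hx ((mulHom h g).app U f) = toRat g.1 * val x hx f := rfl

lemma exists_basicOpen_X_mem (x : ProjSpace n k) :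
    ∃ l, x ∈ Proj.basicOpen (projGrading n k) (X l) := by
  by_contra! H
  refine x.not_irrelevant_le fun f hf => ?_
  rw [HomogeneousIdeal.mem_irrelevant_iff, GradedRing.proj_apply] at hf
  have hf0 : coeff 0 f = 0 := by
    have h1 := (decomposition.decompose'_apply f 0).symm.trans hf
    rw [homogeneousComponent_zero, C_eq_zero] at h1
    exact h1
  have hX (l) : X l ∈ x.asHomogeneousIdeal.toIdeal := by
    by_contra hl
    exact H l hl
  rw [← support_sum_monomial_coeff f]
  refine Ideal.sum_mem _ fun m hm => ?_
  have hm0 : m ≠ 0 := fun h => (mem_support_iff.mp hm) (h ▸ hf0)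
  obtain ⟨l, hl⟩ := Finsupp.ne_iff.mp hm0
  exact Ideal.mem_of_dvd _ ((X_dvd_monomial).mpr (Or.inr hl)) (hX l)

/-- A rational section of `𝒪(c)` that is regular everywhere is a form of degree `c`. -/
lemma exists_form_of_regularAt {c : ℕ} {z : RatField n k}
    (hz : ∀ x : ProjSpace n k, RegularAt c x z) :
    ∃ g : homogeneousSubmodule (Fin (n + 1)) k c, toRat g.1 = z := by
  choose N r hr hzr using fun l : Fin (n + 1) => exists_form_div_pow one_pos (isHomogeneous_X k l)
    (X_ne_zero l) fun x _ => hz x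
  have hX (l : Fin (n + 1)) : toRat (X l : MvPolynomial (Fin (n + 1)) k) ≠ 0 :=
    toRat_ne_zero.mpr (X_ne_zero l)
  have hdvd : (X 0 ^ N 0 : MvPolynomial (Fin (n + 1)) k) ∣ r 0 := by
    rw [X_pow_eq_monomial, monomial_one_dvd_iff_modMonomial_eq_zero]
    ext u
    rw [coeff_zero]
    by_cases hu : Finsupp.single 0 (N 0) ≤ u
    · exact coeff_modMonomial_of_le _ hu
    rw [coeff_modMonomial_of_not_le _ hu]
    rw [Finsupp.single_le_iff, not_le] at hu
    by_contra hc
    -- With a single variable there is no second chart to compare with. There the degree c + N_0 of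
    -- the numerator already gives the divisibility. For n > 0, comparison with the chart of the
    -- variable with index 1 shows it.
    rcases Nat.eq_zero_or_pos n with rfl | hn
    · have h1 := (hr 0).degree_eq_sum_deg_support (mem_support_iff.mpr hc)
      have h2 : u.degree = c + N 0 * 1 := h1.symm
      rw [degree_eq_univ_sum] at h2
      simp at h2
      omega
    · let l : Fin (n + 1) := ⟨1, by omega⟩
      have hl : l ≠ 0 := fun h => by simpa [l] using congrArg Fin.val h
      have heq : X l ^ N l * r 0 = X 0 ^ N 0 * r l := by
        apply toRat_injective
        have h1 := (hzr 0).symm.trans (hzr l)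
        rw [div_eq_div_iff (pow_ne_zero _ (hX 0)) (pow_ne_zero _ (hX l))] at h1
        simp only [toRat, map_mul, map_pow] at h1 ⊢
        rw [mul_comm, h1, mul_comm]
      have h2 := congrArg (coeff (Finsupp.single l (N l) + u)) heq
      rw [X_pow_eq_monomial, coeff_monomial_mul, one_mul, X_pow_eq_monomial,
        coeff_monomial_mul', if_neg] at h2
      · exact hc h2
      · rw [Finsupp.single_le_iff, not_le, Finsupp.add_apply, Finsupp.single_apply, if_neg hl]
        simpa using hu
  obtain ⟨g, hg⟩ := hdvd
  refine ⟨⟨g, ?_⟩, ?_⟩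
  · refine isHomogeneous_of_mul (isHomogeneous_X_pow 0 (N 0)) (pow_ne_zero _ (X_ne_zero 0)) ?_
    rw [mul_comm, ← hg]
    simpa using hr 0
  · have : toRat (X 0 ^ N 0 * g) = toRat (X 0) ^ N 0 * toRat g := by simp only [toRat, map_mul, map_pow]
    rw [hzr 0, show toRat (r 0) = _ from (congrArg toRat hg).trans this,
      mul_div_cancel_left₀ _ (pow_ne_zero _ (hX 0))]

variable (n k d) in
/-- The section `x_l ^ d` of `𝒪(d)` over an open set. -/
def powSection (l : Fin (n + 1)) (U : (ProjSpace n k).Opens) : Γ(twist n k d, U) :=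
  twistMk U (toRat (X l ^ d)) fun x _ => RegularAt.of_form x (isHomogeneous_X_pow l d)

lemma val_powSection (l : Fin (n + 1)) {U : (ProjSpace n k).Opens} {x : ProjSpace n k} (hx : x ∈ U) :
    val x hx (powSection n k d l U) = toRat (X l ^ d) := rfl

/-- Where `x_l` does not vanish, `𝒪(d)` is generated by `x_l ^ d`. -/
lemma exists_smul_powSection_eq (l : Fin (n + 1)) {U : (ProjSpace n k).Opens}
    (hU : U ≤ Proj.basicOpen (projGrading n k) (X l)) (f : Γ(twist n k d, U)) :
    ∃ r : Γ(ProjSpace n k, U), r • powSection n k d l U = f := by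
  have hX : toRat (X l ^ d : MvPolynomial (Fin (n + 1)) k) ≠ 0 :=
    toRat_ne_zero.mpr (pow_ne_zero _ (X_ne_zero l))
  rcases isEmpty_or_nonempty U with hE | ⟨⟨y, hy⟩⟩
  · exact ⟨0, val_ext fun x hx => (hE.false ⟨x, hx⟩).elim⟩
  obtain ⟨r, hr⟩ := exists_fval_eq (U := U) (val y hy f / toRat (X l ^ d)) fun x hx => by
    rw [val_eq_val f hy hx]
    refine RegularAt.div_form (c := d) (by simpa using regularAt_val f hx) (isHomogeneous_X_pow l d) ?_
    intro h
    exact hU hx (x.isPrime.mem_of_pow_mem _ h)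
  refine ⟨r, val_ext_of_mem hy ?_⟩
  rw [val_smul, val_powSection, hr, div_mul_cancel₀ _ hX]

lemma smul_powSection_injective (l : Fin (n + 1)) {U : (ProjSpace n k).Opens}
    {r r' : Γ(ProjSpace n k, U)} (h : r • powSection n k d l U = r' • powSection n k d l U) :
    r = r' := by
  have hX : toRat (X l ^ d : MvPolynomial (Fin (n + 1)) k) ≠ 0 :=
    toRat_ne_zero.mpr (pow_ne_zero _ (X_ne_zero l))
  refine fval_ext fun x hx => ?_
  have := congrArg (val x hx) h
  rw [val_smul, val_smul, val_powSection] at this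
  exact mul_right_cancel₀ hX this

/-- Every map `𝒪(d) ⟶ 𝒪(e)` is multiplication by a form. -/
lemma mulHom_surjective (h : d ≤ e) :
    Function.Surjective (mulHom (n := n) (k := k) (d := d) (e := e) h) := by
  intro φ
  have hX (l : Fin (n + 1)) : toRat (X l ^ d : MvPolynomial (Fin (n + 1)) k) ≠ 0 :=
    toRat_ne_zero.mpr (pow_ne_zero _ (X_ne_zero l))
  let D (l : Fin (n + 1)) : (ProjSpace n k).Opens := Proj.basicOpen (projGrading n k) (X l)
  have hη (l) : genericPt n k ∈ D l := notMem_genericPt.mpr (X_ne_zero l)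
  -- The multiplier of φ on the l-th chart, read off from the generator x_l ^ d. The multipliers
  -- agree generically, so they define one rational section of O(e - d) that is regular everywhere.
  let H (l : Fin (n + 1)) : RatField n k :=
    val (genericPt n k) (hη l) (φ.app (D l) (powSection n k d l (D l))) / toRat (X l ^ d)
  have key (l) {U : (ProjSpace n k).Opens} (hU : U ≤ D l) (f : Γ(twist n k d, U))
      {x : ProjSpace n k} (hx : x ∈ U) : val x hx (φ.app U f) = H l * val x hx f := by
    obtain ⟨r, rfl⟩ := exists_smul_powSection_eq l hU f
    have h1 : powSection n k d l U =
        (twist n k d).presheaf.map (homOfLE hU).op (powSection n k d l (D l)) := rfl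
    have h2 : φ.app U ((twist n k d).presheaf.map (homOfLE hU).op (powSection n k d l (D l))) =
        (twist n k e).presheaf.map (homOfLE hU).op (φ.app (D l) (powSection n k d l (D l))) :=
      ConcreteCategory.congr_hom (φ.mapPresheaf.naturality (homOfLE hU).op) _
    rw [Scheme.Modules.Hom.app_smul, val_smul, val_smul, h1, h2, val_map, val_map, val_powSection,
      val_eq_val _ _ (hη l)]
    simp only [H]
    field_simp [hX l]
  have hH (l m) : H l = H m := by
    have h1 := key l (U := D l ⊓ D m) inf_le_left (powSection n k d l _) ⟨hη l, hη m⟩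
    have h2 := key m (U := D l ⊓ D m) inf_le_right (powSection n k d l _) ⟨hη l, hη m⟩
    exact mul_right_cancel₀ (hX l) (h1.symm.trans h2)
  have hreg (x : ProjSpace n k) : RegularAt (e - d) x (H 0) := by
    obtain ⟨l, hl⟩ := exists_basicOpen_X_mem x
    rw [hH 0 l]
    have h1 := regularAt_val (φ.app (D l) (powSection n k d l (D l))) hl
    rw [val_eq_val _ hl (hη l)] at h1
    have h2 : RegularAt (d + (e - d)) x
        (val (genericPt n k) (hη l) (φ.app (D l) (powSection n k d l (D l)))) := by
      rwa [Nat.add_sub_cancel' h]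
    exact h2.div_form (isHomogeneous_X_pow l d) fun h => hl (x.isPrime.mem_of_pow_mem _ h)
  obtain ⟨g, hg⟩ := exists_form_of_regularAt hreg
  refine ⟨g, Scheme.Modules.hom_ext _ _ fun U => ?_⟩
  ext f
  refine val_ext fun x hx => ?_
  obtain ⟨l, hl⟩ := exists_basicOpen_X_mem x
  have h1 : φ.app (U ⊓ D l) ((twist n k d).presheaf.map (homOfLE inf_le_left).op f) =
      (twist n k e).presheaf.map (homOfLE inf_le_left).op (φ.app U f) :=
    ConcreteCategory.congr_hom (φ.mapPresheaf.naturality (homOfLE inf_le_left).op) f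
  have hx' : x ∈ U ⊓ D l := ⟨hx, hl⟩
  have h2 := key l inf_le_right ((twist n k d).presheaf.map (homOfLE inf_le_left).op f) hx'
  rw [h1, hH l 0, ← hg] at h2
  exact h2.symm

end MulHom
end
end KernelBundle

namespace KernelBundle
open TopologicalSpace Opposite MvPolynomial

/-! ### Sections of direct sums, componentwise. -/

section BiproductSections
variable {X : Scheme.{u}}

lemma app_sum {F G : X.Modules} {ι : Type*} (s : Finset ι) (φ : ι → (F ⟶ G)) {U : X.Opens}
    (v : Γ(F, U)) : (∑ i ∈ s, φ i).app U v = ∑ i ∈ s, (φ i).app U v := by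
  classical
  induction s using Finset.induction_on with
  | empty => simp only [Finset.sum_empty]; rfl
  | insert i s hi ih =>
    rw [Finset.sum_insert hi, Finset.sum_insert hi, ← ih]
    rfl

lemma app_map {F G : X.Modules} {U V : X.Opens} (φ : F ⟶ G) (i : V ⟶ U) (v : Γ(F, U)) :
    φ.app V (F.presheaf.map i.op v) = G.presheaf.map i.op (φ.app U v) :=
  ConcreteCategory.congr_hom (φ.mapPresheaf.naturality i.op) v

variable [HasFiniteBiproducts X.Modules] {I : Type} [Fintype I] (F : I → X.Modules)

/-- The `i`-th component of a section of a direct sum. -/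
noncomputable def coord (i : I) {U : X.Opens} : Γ(⨁ F, U) →+ Γ(F i, U) :=
  ((biproduct.π F i).app U).hom

variable {F} {U V : X.Opens}

lemma sum_ι_coord (v : Γ(⨁ F, U)) : ∑ i, (biproduct.ι F i).app U (coord F i v) = v := by
  have h := congrArg (fun φ : (⨁ F) ⟶ ⨁ F => φ.app U v) (biproduct.total (f := F))
  rw [app_sum] at h
  exact h

lemma coord_ext {v w : Γ(⨁ F, U)} (h : ∀ i, coord F i v = coord F i w) : v = w := by
  rw [← sum_ι_coord v, ← sum_ι_coord w]
  simp only [h]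

lemma exists_coord_eq (f : ∀ i, Γ(F i, U)) : ∃ v : Γ(⨁ F, U), ∀ i, coord F i v = f i := by
  classical
  refine ⟨∑ i, (biproduct.ι F i).app U (f i), fun i => ?_⟩
  rw [map_sum, Finset.sum_eq_single i]
  · exact congrArg (fun φ : F i ⟶ F i => φ.app U (f i)) (biproduct.ι_π_self F i)
  · intro j _ hj
    exact congrArg (fun φ : F j ⟶ F i => φ.app U (f j)) (biproduct.ι_π_ne F hj)
  · exact fun h => (h (Finset.mem_univ i)).elim

lemma coord_map (j : I) (i : V ⟶ U) (v : Γ(⨁ F, U)) :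
    coord F j ((⨁ F).presheaf.map i.op v) = (F j).presheaf.map i.op (coord F j v) :=
  app_map _ _ _

lemma coord_smul (j : I) (r : Γ(X, U)) (v : Γ(⨁ F, U)) : coord F j (r • v) = r • coord F j v :=
  Scheme.Modules.Hom.app_smul _ _ _

lemma coord_matrix {J : Type} [Fintype J] {G : J → X.Modules} (m : ∀ i j, F i ⟶ G j)
    (v : Γ(⨁ F, U)) (j : J) :
    coord G j ((biproduct.matrix m).app U v) = ∑ i, (m i j).app U (coord F i v) := by
  have h := congrArg (fun φ : (⨁ F) ⟶ G j => φ.app U v) (biproduct.matrix_π m j)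
  simp only [biproduct.desc_eq, app_sum] at h
  exact h

end BiproductSections

noncomputable section
variable {n : ℕ} {k : Type u} [Field k]

/-! ### Maps of sums of line bundles as matrices of forms. -/

section MatrixHom
variable {d e : ℕ}

variable (n k) in
/-- The generic point of projective space, as a point of the scheme. -/
def gen : ProjSpace n k := genericPt n k

/-- The constant `c` as a regular function on `U`. -/
def constOn (U : (ProjSpace n k).Opens) (c : k) : Γ(ProjSpace n k, U) := constantOn (op U) c

lemma fval_constOn (c : k) {U : (ProjSpace n k).Opens} {x : ProjSpace n k} (hx : x ∈ U) :
    fval x hx (constOn U c) = toRat (C c) := fval_constantOn c hx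

lemma mulHom_add (h : d ≤ e) (g g' : homogeneousSubmodule (Fin (n + 1)) k (e - d)) :
    mulHom h (g + g') = mulHom h g + mulHom h g' := by
  ext U f
  refine val_ext fun x hx => ?_
  refine (val_mulHom h _ f hx).trans ?_
  refine Eq.trans ?_ (map_add (val x hx) ((mulHom h g).app U f) ((mulHom h g').app U f)).symm
  rw [val_mulHom, val_mulHom, ← add_mul]
  exact congrArg (· * _) (map_add _ _ _)

lemma toRat_smul (c : k) (g : MvPolynomial (Fin (n + 1)) k) : toRat (c • g) = toRat (C c) * toRat g := by
  rw [smul_eq_C_mul]; exact map_mul _ _ _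

lemma smul_app_apply {F G : (ProjSpace n k).Modules} (c : k) (φ : F ⟶ G) {U : (ProjSpace n k).Opens}
    (v : Γ(F, U)) : (c • φ).app U v = constOn U c • φ.app U v := rfl

lemma mulHom_smul (h : d ≤ e) (c : k) (g : homogeneousSubmodule (Fin (n + 1)) k (e - d)) :
    mulHom h (c • g) = c • mulHom h g := by
  ext U f
  refine val_ext fun x hx => ?_
  refine (val_mulHom h _ f hx).trans ?_
  rw [smul_app_apply, val_smul, fval_constOn, val_mulHom, ← mul_assoc]
  exact congrArg (· * _) (toRat_smul c g.1)

lemma mulHom_injective (h : d ≤ e) :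
    Function.Injective (mulHom (n := n) (k := k) (d := d) (e := e) h) := by
  intro g g' hg
  have hη : gen n k ∈ (⊤ : (ProjSpace n k).Opens) := trivial
  have h1 := congrArg (fun φ : twist n k d ⟶ twist n k e =>
    val (gen n k) hη (φ.app ⊤ (powSection n k d 0 ⊤))) hg
  simp only [val_mulHom, val_powSection] at h1
  exact Subtype.ext (toRat_injective (mul_right_cancel₀
    (toRat_ne_zero.mpr (pow_ne_zero _ (X_ne_zero 0))) h1))

variable {I J : Type} [Fintype I] [Fintype J] {δ : I → ℕ} {ε : J → ℕ}

/-- The map `⨁ 𝒪(δᵢ) ⟶ ⨁ 𝒪(εⱼ)` given by a matrix of forms. -/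
def matrixHom (h : ∀ j i, δ i ≤ ε j) (M : FormMatrix k n δ ε) :
    (⨁ fun i => twist n k (δ i)) ⟶ ⨁ fun j => twist n k (ε j) :=
  biproduct.matrix fun i j => mulHom (h j i) (M j i)

lemma val_coord_matrixHom (h : ∀ j i, δ i ≤ ε j) (M : FormMatrix k n δ ε)
    {U : (ProjSpace n k).Opens} (v : Γ(⨁ fun i => twist n k (δ i), U)) (j : J)
    {x : ProjSpace n k} (hx : x ∈ U) :
    val x hx (coord (fun j => twist n k (ε j)) j ((matrixHom h M).app U v)) =
      ∑ i, toRat (M j i).1 * val x hx (coord (fun i => twist n k (δ i)) i v) := by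
  rw [matrixHom, coord_matrix, map_sum]
  rfl

lemma hom_ext_components {F : I → (ProjSpace n k).Modules} {G : J → (ProjSpace n k).Modules}
    {φ ψ : (⨁ F) ⟶ ⨁ G}
    (h : ∀ i j, biproduct.ι F i ≫ φ ≫ biproduct.π G j = biproduct.ι F i ≫ ψ ≫ biproduct.π G j) :
    φ = ψ :=
  biproduct.hom_ext' _ _ fun i => biproduct.hom_ext _ _ fun j => by simpa using h i j

lemma ι_matrix_π {F : I → (ProjSpace n k).Modules} {G : J → (ProjSpace n k).Modules}
    (m : ∀ i j, F i ⟶ G j) (i : I) (j : J) :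
    biproduct.ι F i ≫ biproduct.matrix m ≫ biproduct.π G j = m i j := by
  simp

lemma comp_smul_comp {F G G' F' : (ProjSpace n k).Modules} (c : k) (φ : F ⟶ G) (α : F' ⟶ F)
    (β : G ⟶ G') : α ≫ (c • φ) ≫ β = c • (α ≫ φ ≫ β) := by
  ext U v
  exact Scheme.Modules.Hom.app_smul β _ _

/-- The maps `⨁ 𝒪(δᵢ) ⟶ ⨁ 𝒪(εⱼ)` are the matrices of forms of degrees `εⱼ - δᵢ`. -/
def matrixHomEquiv (h : ∀ j i, δ i ≤ ε j) :
    FormMatrix k n δ ε ≃ₗ[k] ((⨁ fun i => twist n k (δ i)) ⟶ ⨁ fun j => twist n k (ε j)) :=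
  LinearEquiv.ofBijective
    { toFun := matrixHom h
      map_add' := fun M M' => hom_ext_components fun i j => by
        rw [Preadditive.add_comp, Preadditive.comp_add]
        simp only [matrixHom, ι_matrix_π]
        exact mulHom_add _ _ _
      map_smul' := fun c M => hom_ext_components fun i j => by
        rw [RingHom.id_apply, comp_smul_comp]
        simp only [matrixHom, ι_matrix_π]
        exact mulHom_smul _ _ _ }
    ⟨fun M M' hM => funext fun j => funext fun i => mulHom_injective (h j i) (by
        have := congrArg (fun φ => biproduct.ι (fun i => twist n k (δ i)) i ≫ φ ≫
          biproduct.π (fun j => twist n k (ε j)) j) hM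
        simpa [matrixHom] using this),
      fun φ => by
        choose M hM using fun (j : J) (i : I) => mulHom_surjective (h j i)
          (biproduct.components φ i j)
        refine ⟨M, ?_⟩
        refine Eq.trans ?_ (biproduct.components_matrix φ)
        change biproduct.matrix _ = _
        congr
        funext i j
        exact hM j i⟩

end MatrixHom

/-! ### Global sections and sections over principal open sets. -/

section GlobalSections
variable {d : ℕ}

/-- The section of `𝒪(d)` given by a form of degree `d`. -/
def ofForm (U : (ProjSpace n k).Opens) (g : homogeneousSubmodule (Fin (n + 1)) k d) :
    Γ(twist n k d, U) :=
  twistMk U (toRat g.1) fun x _ => RegularAt.of_form x g.2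

lemma val_ofForm {U : (ProjSpace n k).Opens} (g : homogeneousSubmodule (Fin (n + 1)) k d)
    {x : ProjSpace n k} (hx : x ∈ U) : val x hx (ofForm U g) = toRat g.1 := rfl

lemma ofForm_surjective : Function.Surjective (ofForm (n := n) (k := k) (d := d) ⊤) := by
  intro f
  have hη : gen n k ∈ (⊤ : (ProjSpace n k).Opens) := trivial
  obtain ⟨g, hg⟩ := exists_form_of_regularAt (z := val (gen n k) hη f) fun x => by
    rw [val_eq_val f hη (show x ∈ (⊤ : (ProjSpace n k).Opens) from trivial)]
    exact regularAt_val f _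
  exact ⟨g, val_ext_of_mem hη hg⟩

variable {I J : Type} [Fintype I] [Fintype J] {δ : I → ℕ} {ε : J → ℕ}

lemma exists_ofForm_eq_coord (v : Γ(⨁ fun i => twist n k (δ i), ⊤)) :
    ∃ f : FormTuple k n δ, ∀ i, coord (fun i => twist n k (δ i)) i v = ofForm ⊤ (f i) := by
  choose f hf using fun i => ofForm_surjective (coord (fun i => twist n k (δ i)) i v)
  exact ⟨f, fun i => (hf i).symm⟩

/-- On global sections the map of bundles is `formMap` in degree shift 0, so injectivity and
surjectivity can be read off from forms. -/
lemma coord_matrixHom_ofForm (h : ∀ j i, δ i ≤ ε j) (M : FormMatrix k n δ ε)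
    {v : Γ(⨁ fun i => twist n k (δ i), ⊤)} {f : FormTuple k n δ}
    (hf : ∀ i, coord (fun i => twist n k (δ i)) i v = ofForm ⊤ (f i)) (j : J) :
    coord (fun j => twist n k (ε j)) j ((matrixHom h M).app ⊤ v) = ofForm ⊤ (formMap k n h 0 M f j) := by
  have hη : gen n k ∈ (⊤ : (ProjSpace n k).Opens) := trivial
  refine val_ext_of_mem hη ?_
  rw [val_coord_matrixHom, val_ofForm, formMap_apply_coe]
  simp only [hf, val_ofForm, toRat, map_sum, map_mul]

lemma matrixHom_app_top_injective (h : ∀ j i, δ i ≤ ε j) {M : FormMatrix k n δ ε}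
    (hM : Function.Injective (formMap k n h 0 M)) : Function.Injective ((matrixHom h M).app ⊤) := by
  have hη : gen n k ∈ (⊤ : (ProjSpace n k).Opens) := trivial
  intro v w hvw
  obtain ⟨f, hf⟩ := exists_ofForm_eq_coord v
  obtain ⟨g, hg⟩ := exists_ofForm_eq_coord w
  have hfg : f = g := hM <| funext fun j => Subtype.ext <| toRat_injective <| by
    have h1 := coord_matrixHom_ofForm h M hf j
    rw [hvw, coord_matrixHom_ofForm h M hg j] at h1
    exact (congrArg (val _ hη) h1).symm
  exact coord_ext fun i => by rw [hf, hg, hfg]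

lemma matrixHom_app_top_surjective (h : ∀ j i, δ i ≤ ε j) {M : FormMatrix k n δ ε}
    (hM : Function.Surjective (formMap k n h 0 M)) : Function.Surjective ((matrixHom h M).app ⊤) := by
  intro w
  obtain ⟨g, hg⟩ := exists_ofForm_eq_coord w
  obtain ⟨f, hf⟩ := hM g
  obtain ⟨v, hv⟩ := exists_coord_eq (U := ⊤) (F := fun i => twist n k (δ i)) fun i => ofForm ⊤ (f i)
  exact ⟨v, coord_ext fun j => by rw [coord_matrixHom_ofForm h M hv j, hf, hg]⟩

/-- If a matrix of forms is surjective in high degrees, it is surjective on sections over principal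
open sets. -/
lemma matrixHom_app_surjective (h : ∀ j i, δ i ≤ ε j) {M : FormMatrix k n δ ε} {D : ℕ}
    (hM : Function.Surjective (formMap k n h D M)) {m : ℕ} (hm : 0 < m)
    {g : MvPolynomial (Fin (n + 1)) k} (hg : g.IsHomogeneous m) (hg0 : g ≠ 0)
    {W : (ProjSpace n k).Opens} (hW : ∀ x : ProjSpace n k, x ∈ W ↔ g ∉ x.asHomogeneousIdeal) :
    Function.Surjective ((matrixHom h M).app W) := by
  intro w
  have hη : gen n k ∈ W := (hW _).mpr (notMem_genericPt.mpr hg0)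
  have hgr : toRat g ≠ 0 := toRat_ne_zero.mpr hg0
  have hreg (j : J) := exists_form_div_pow hm hg hg0
    (z := val (gen n k) hη (coord (fun j => twist n k (ε j)) j w)) fun x hx => by
      rw [val_eq_val _ hη ((hW x).mpr hx)]
      exact regularAt_val _ _
  choose N r hr hz using hreg
  -- A common exponent for g: it exceeds every pole order, and since m > 0 the degree shift N' m is
  -- at least D.
  let N' := D + ∑ j, N j
  have hN (j) : N j ≤ N' :=
    (Finset.single_le_sum (fun j _ => Nat.zero_le (N j)) (Finset.mem_univ j)).trans (Nat.le_add_left _ _)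
  have hD : D ≤ N' * m := (Nat.le_add_right _ _).trans (Nat.le_mul_of_pos_right _ hm)
  obtain ⟨f, hf⟩ := formMap_surjective_of_le h hD hM fun j => ⟨r j * g ^ (N' - N j), by
    have h1 := (hr j).mul (hg.pow (N' - N j))
    have h2 : N j * m + m * (N' - N j) = N' * m := by
      rw [mul_comm m, ← add_mul, Nat.add_sub_cancel' (hN j)]
    rwa [add_assoc, h2] at h1⟩
  obtain ⟨v, hv⟩ := exists_coord_eq (U := W) (F := fun i => twist n k (δ i)) fun i =>
    show Γ(twist n k (δ i), W) from twistMk W (toRat (f i).1 / toRat (g ^ N')) fun x hx => RegularAt.div_form (c := N' * m) (by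
      rw [add_comm]; exact RegularAt.of_form x (f i).2) (by rw [mul_comm]; exact hg.pow N')
      fun hx' => (hW x).mp hx (x.isPrime.mem_of_pow_mem _ hx')
  refine ⟨v, coord_ext fun j => val_ext_of_mem hη ?_⟩
  rw [val_coord_matrixHom, hz j]
  have hv' (i) : val (gen n k) hη (coord (fun i => twist n k (δ i)) i v) =
      toRat (f i).1 / toRat (g ^ N') := by rw [hv]; rfl
  have h1 := congrArg (fun y => toRat (y j).1) hf
  simp only [formMap_apply_coe, toRat, map_sum, map_mul, map_pow] at h1
  have h3 : toRat g ^ N' = toRat g ^ (N j) * toRat g ^ (N' - N j) := by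
    rw [← pow_add, Nat.add_sub_cancel' (hN j)]
  have h2 : toRat (g ^ N') = toRat g ^ N' := map_pow _ _ _
  simp only [hv', mul_div_assoc', ← Finset.sum_div, h2]
  rw [show ∑ i, toRat (M j i).1 * toRat (f i).1 = toRat (r j) * toRat g ^ (N' - N j) from h1, h3,
    mul_div_mul_right _ _ (pow_ne_zero _ hgr)]

end GlobalSections
end
end KernelBundle

namespace KernelBundle
open TopologicalSpace Opposite

noncomputable section
variable {n : ℕ} {k : Type u} [Field k]

/-! ### The Čech complex in coordinates. -/

section Cech
variable {p : ℕ}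

variable (k) in
/-- The intersection of the open sets `D₊(x_l)` for `l` in the range of `α`. -/
def cechOpen (α : Fin (p + 1) → Fin (n + 1)) : (ProjSpace n k).Opens :=
  ∏ᶜ fun a => Proj.basicOpen (projGrading n k) (MvPolynomial.X (α a))

lemma mem_cechOpen {α : Fin (p + 1) → Fin (n + 1)} {x : ProjSpace n k} :
    x ∈ cechOpen k α ↔ ∀ a, (MvPolynomial.X (α a) : MvPolynomial (Fin (n + 1)) k) ∉
      x.asHomogeneousIdeal := by
  constructor
  · intro hx a
    exact (Pi.π (fun a => Proj.basicOpen (projGrading n k) (MvPolynomial.X (α a))) a).le hx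
  · intro hx
    let g : MvPolynomial (Fin (n + 1)) k := ∏ a, MvPolynomial.X (α a)
    have hle : Proj.basicOpen (projGrading n k) g ≤ cechOpen k α :=
      (Pi.lift fun a => homOfLE fun y hy h => hy
        (Ideal.mem_of_dvd _ (Finset.dvd_prod_of_mem _ (Finset.mem_univ a)) h)).le
    refine hle fun h => ?_
    obtain ⟨a, -, ha⟩ := (x.isPrime.prod_mem_iff).mp h
    exact hx a ha

lemma cechOpen_le_succAbove (β : Fin (p + 2) → Fin (n + 1)) (i : Fin (p + 2)) :
    cechOpen k β ≤ cechOpen k (β ∘ i.succAbove) := fun _ hx =>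
  mem_cechOpen.mpr fun a => mem_cechOpen.mp hx (i.succAbove a)

variable (F : (ProjSpace n k).Modules)

/-- The sections of a module over the intersections of the cover. -/
abbrev cechSections (α : Fin (p + 1) → Fin (n + 1)) : ModuleCat.{u} k :=
  ((sectionsFunctor n k).obj F).obj (op (cechOpen k α))

/-- The projection of Čech cochains onto the sections over an intersection of the cover. -/
def cechπ (α : Fin (p + 1) → Fin (n + 1)) : (cechComplex F).X p ⟶ cechSections F α :=
  Pi.π (cechSections F) α

/-- The component of a Čech cochain on an intersection of the cover. -/
def cechCoord (α : Fin (p + 1) → Fin (n + 1)) : (cechComplex F).X p →+ Γ(F, cechOpen k α) :=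
  AddMonoidHomClass.toAddMonoidHom (cechπ F α).hom

variable {F}

lemma cechCoord_ext {f g : (cechComplex F).X p} (h : ∀ α, cechCoord F α f = cechCoord F α g) :
    f = g := by
  have key (f : (cechComplex F).X p) (α) :
      ((ModuleCat.piIsoPi (cechSections F)).hom f : ∀ α, cechSections F α) α = cechCoord F α f :=
    ModuleCat.piIsoPi_hom_ker_subtype_apply (cechSections F) α f
  have h1 : (ModuleCat.piIsoPi (cechSections F)).hom f = (ModuleCat.piIsoPi (cechSections F)).hom g :=
    funext fun α => ((key f α).trans (h α)).trans (key g α).symm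
  exact (ModuleCat.piIsoPi (cechSections F)).toLinearEquiv.injective h1

lemma exists_cechCoord_eq (f : ∀ α, Γ(F, cechOpen k α)) :
    ∃ c : (cechComplex F).X p, ∀ α, cechCoord F α c = f α :=
  ⟨(ModuleCat.piIsoPi (cechSections F)).inv (f : ∀ α, cechSections F α), fun α =>
    ModuleCat.piIsoPi_inv_kernel_ι_apply (cechSections F) α f⟩

lemma cechComplex_d_cechπ (β : Fin (p + 2) → Fin (n + 1)) :
    (cechComplex F).d p (p + 1) ≫ cechπ F β =
      ∑ i : Fin (p + 2), (-1 : ℤ) ^ (i : ℕ) • (cechπ F (β ∘ i.succAbove) ≫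
        ((sectionsFunctor n k).obj F).map (homOfLE (cechOpen_le_succAbove β i)).op) := by
  let E := (FormalCoproduct.mk _ fun i : Fin (n + 1) =>
    Proj.basicOpen (projGrading n k) (MvPolynomial.X i : MvPolynomial (Fin (n + 1)) k)).cech
  let Y := (FormalCoproduct.cosimplicialObjectFunctor E).obj ((sectionsFunctor n k).obj F)
  have hd : (cechComplex F).d p (p + 1) = AlgebraicTopology.AlternatingCofaceMapComplex.objD Y p :=
    CochainComplex.of_d (fun p => Y.obj (SimplexCategory.mk p)) (AlgebraicTopology.AlternatingCofaceMapComplex.objD Y) p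
  rw [hd, AlgebraicTopology.AlternatingCofaceMapComplex.objD]
  refine (Preadditive.sum_comp _ _ _).trans (Finset.sum_congr rfl fun i _ => ?_)
  refine (Preadditive.zsmul_comp _ _ _).trans (congrArg _ ?_)
  exact Pi.lift_π _ _

lemma cechCoord_d (f : (cechComplex F).X p) (β : Fin (p + 2) → Fin (n + 1)) :
    cechCoord F β ((cechComplex F).d p (p + 1) f) =
      ∑ i : Fin (p + 2), (-1 : ℤ) ^ (i : ℕ) •
        F.presheaf.map (homOfLE (cechOpen_le_succAbove β i)).op (cechCoord F (β ∘ i.succAbove) f) := by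
  have h := congrArg (fun φ : (cechComplex F).X p ⟶ cechSections F β => φ.hom f)
    (cechComplex_d_cechπ (F := F) β)
  simp only [ModuleCat.hom_sum, ModuleCat.hom_zsmul, LinearMap.sum_apply, LinearMap.smul_apply] at h
  exact h

/-- The map of Čech complexes induced by a map of modules. -/
def cechMap {F G : (ProjSpace n k).Modules} (φ : F ⟶ G) : cechComplex F ⟶ cechComplex G :=
  (cechComplexFunctor fun i : Fin (n + 1) =>
    Proj.basicOpen (projGrading n k) (MvPolynomial.X i)).map ((sectionsFunctor n k).map φ)

lemma cechCoord_map {G : (ProjSpace n k).Modules} (φ : F ⟶ G) (f : (cechComplex F).X p)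
    (α : Fin (p + 1) → Fin (n + 1)) :
    cechCoord G α ((cechMap φ).f p f) = φ.app _ (cechCoord F α f) := by
  have h : (cechMap φ).f p ≫ cechπ G α =
      cechπ F α ≫ ((sectionsFunctor n k).map φ).app (op (cechOpen k α)) := Limits.Pi.map_π (f := cechSections F) (g := cechSections G)
        (fun α => ((sectionsFunctor n k).map φ).app (op (cechOpen k α))) α
  exact congrArg (fun ψ : (cechComplex F).X p ⟶ cechSections G α => ψ.hom f) h

end Cech
end
end KernelBundle

namespace KernelBundle
open TopologicalSpace Opposite MvPolynomial

noncomputable section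
variable {n : ℕ} {k : Type u} [Field k]

/-! ### Laurent polynomials. -/

section Laurent

lemma RegularAt.add {d : ℕ} {x : ProjectiveSpectrum (projGrading n k)} {z z' : RatField n k}
    (h : RegularAt d x z) (h' : RegularAt d x z') : RegularAt d x (z + z') := by
  obtain ⟨i, r, s, hr, hs, hsx, rfl⟩ := h
  obtain ⟨i', r', s', hr', hs', hsx', rfl⟩ := h'
  refine ⟨i + i', r * s' + s * r', s * s', ?_, hs.mul hs', mul_notMem x hsx hsx', ?_⟩
  · have h1 := hr.mul hs'
    have h2 := hs.mul hr'
    rw [show i + d + i' = i + i' + d by ring] at h1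
    rw [← add_assoc] at h2
    exact h1.add h2
  · have h1 : toRat s ≠ 0 := algebraMap_ne_zero_of_notMem x hsx
    have h2 : toRat s' ≠ 0 := algebraMap_ne_zero_of_notMem x hsx'
    rw [div_add_div _ _ h1 h2]
    simp only [toRat, map_add, map_mul]

lemma RegularAt.zero {d : ℕ} (x : ProjectiveSpectrum (projGrading n k)) :
    RegularAt d x (0 : RatField n k) := by
  simpa [toRat] using RegularAt.of_form x (isHomogeneous_zero (Fin (n + 1)) k d)

lemma RegularAt.smul {d : ℕ} {x : ProjectiveSpectrum (projGrading n k)} {z : RatField n k}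
    (h : RegularAt d x z) (c : k) : RegularAt d x (c • z) := by
  have h1 := (RegularAt.of_form x (isHomogeneous_C (Fin (n + 1)) c)).mul h
  rw [zero_add] at h1
  rwa [← IsScalarTower.algebraMap_smul (MvPolynomial (Fin (n + 1)) k) c z, Algebra.smul_def]

lemma RegularAt.sum {d : ℕ} {x : ProjectiveSpectrum (projGrading n k)} {ι : Type*} (s : Finset ι)
    {z : ι → RatField n k} (h : ∀ i ∈ s, RegularAt d x (z i)) : RegularAt d x (∑ i ∈ s, z i) := by
  classical
  induction s using Finset.induction_on with
  | empty => simpa using RegularAt.zero x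
  | insert i s hi ih =>
    rw [Finset.sum_insert hi]
    exact (h i (Finset.mem_insert_self i s)).add
      (ih fun j hj => h j (Finset.mem_insert_of_mem hj))

lemma toRat_X_ne_zero (l : Fin (n + 1)) : toRat (X l : MvPolynomial (Fin (n + 1)) k) ≠ 0 :=
  toRat_ne_zero.mpr (X_ne_zero l)

variable (k) in
/-- The Laurent monomial with exponent vector `u`. -/
def laurentMonomial (u : Fin (n + 1) → ℤ) : RatField n k :=
  ∏ l, toRat (X l : MvPolynomial (Fin (n + 1)) k) ^ u l

lemma laurentMonomial_add (u v : Fin (n + 1) → ℤ) :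
    laurentMonomial k (u + v) = laurentMonomial k u * laurentMonomial k v := by
  rw [laurentMonomial, laurentMonomial, laurentMonomial, ← Finset.prod_mul_distrib]
  exact Finset.prod_congr rfl fun l _ => zpow_add₀ (toRat_X_ne_zero l) _ _

lemma laurentMonomial_natCast (m : Fin (n + 1) →₀ ℕ) :
    laurentMonomial k (fun l => (m l : ℤ)) = toRat (monomial m (1 : k)) := by
  rw [laurentMonomial, monomial_eq, C_1, one_mul, Finsupp.prod_fintype _ _ (by simp)]
  simp only [zpow_natCast, toRat, map_prod, map_pow]

variable (n k) in
/-- Laurent polynomials as rational functions. -/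
def laurent : ((Fin (n + 1) → ℤ) →₀ k) →ₗ[k] RatField n k :=
  Finsupp.linearCombination k (laurentMonomial k)

lemma laurent_eq_sum (c : (Fin (n + 1) → ℤ) →₀ k) :
    laurent n k c = ∑ u ∈ c.support, c u • laurentMonomial k u := rfl

lemma toRat_smul_eq_smul (c : k) (g : MvPolynomial (Fin (n + 1)) k) : toRat (c • g) = c • toRat g := by
  rw [toRat, toRat, ← IsScalarTower.algebraMap_smul (MvPolynomial (Fin (n + 1)) k) c
    (algebraMap _ (RatField n k) g), Algebra.smul_def, map_mul, Algebra.smul_def]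

/-- Multiplication by a high power of the product of all variables clears the finitely many negative
exponents and reduces the claim to the independence of monomials. -/
lemma laurent_injective : Function.Injective (laurent n k) := by
  rw [injective_iff_map_eq_zero]
  intro c hc
  let N : ℕ := ∑ u ∈ c.support, ∑ l, (u l).natAbs
  have hN {u} (hu : u ∈ c.support) (l) : 0 ≤ u l + N := by
    have h1 : (u l).natAbs ≤ ∑ l, (u l).natAbs :=
      Finset.single_le_sum (f := fun l => (u l).natAbs) (fun _ _ => Nat.zero_le _) (Finset.mem_univ l)
    have h2 : ∑ l, (u l).natAbs ≤ N :=
      Finset.single_le_sum (f := fun u => ∑ l, (u l).natAbs) (fun _ _ => Nat.zero_le _) hu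
    omega
  let τ (u : Fin (n + 1) → ℤ) : Fin (n + 1) →₀ ℕ :=
    Finsupp.equivFunOnFinite.symm fun l => (u l + N).toNat
  have hτ {u} (hu : u ∈ c.support) : (fun l => (τ u l : ℤ)) = u + fun _ => (N : ℤ) := by
    funext l
    simpa [τ] using hN hu l
  have h0 : ∑ u ∈ c.support, c u • (monomial (τ u) (1 : k)) = 0 := by
    apply toRat_injective
    rw [show toRat (0 : MvPolynomial (Fin (n + 1)) k) = 0 from map_zero _]
    have h1 : laurentMonomial k (fun _ => (N : ℤ)) * laurent n k c = 0 := by rw [hc, mul_zero]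
    rw [laurent_eq_sum, Finset.mul_sum] at h1
    refine Eq.trans ?_ h1
    rw [show toRat (∑ u ∈ c.support, c u • (monomial (τ u) (1 : k))) =
      ∑ u ∈ c.support, toRat (c u • (monomial (τ u) (1 : k))) from map_sum _ _ _]
    refine Finset.sum_congr rfl fun u hu => ?_
    rw [toRat_smul_eq_smul, ← laurentMonomial_natCast, hτ hu, laurentMonomial_add, mul_smul_comm, mul_comm]
  ext u
  by_contra hu
  have hu' : u ∈ c.support := Finsupp.mem_support_iff.mpr hu
  have h1 := congrArg (coeff (τ u)) h0
  rw [coeff_sum, coeff_zero, Finset.sum_eq_single u] at h1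
  · simp only [coeff_smul, coeff_monomial, if_true, smul_eq_mul, mul_one] at h1
    exact hu h1
  · intro v hv hvu
    rw [coeff_smul, coeff_monomial, if_neg, smul_zero]
    intro h
    apply hvu
    have h2 : (fun l => (τ v l : ℤ)) = fun l => (τ u l : ℤ) := by rw [h]
    rw [hτ hv, hτ hu'] at h2
    exact add_right_cancel h2
  · exact fun h => (h hu').elim

/-- The exponents of the Laurent monomials of degree `d` with poles only along the coordinate
hyperplanes in `A`. -/
def exponents (d : ℕ) (A : Finset (Fin (n + 1))) : Set (Fin (n + 1) → ℤ) :=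
  {u | ∑ l, u l = d ∧ ∀ l ∉ A, 0 ≤ u l}

lemma regularAt_laurentMonomial {d : ℕ} {A : Finset (Fin (n + 1))} {u : Fin (n + 1) → ℤ}
    (hu : u ∈ exponents d A) {x : ProjectiveSpectrum (projGrading n k)}
    (hx : ∀ l ∈ A, (X l : MvPolynomial (Fin (n + 1)) k) ∉ x.asHomogeneousIdeal) :
    RegularAt d x (laurentMonomial k u) := by
  have hprod (f : Fin (n + 1) → ℕ) : (∏ l, (X l : MvPolynomial (Fin (n + 1)) k) ^ f l).IsHomogeneous
      (∑ l, f l) := IsHomogeneous.prod _ _ _ fun l _ => isHomogeneous_X_pow l _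
  refine ⟨∑ l, (-u l).toNat, ∏ l, X l ^ (u l).toNat, ∏ l, X l ^ (-u l).toNat, ?_, hprod _, ?_, ?_⟩
  · have h : ∑ l, (u l).toNat = ∑ l, (-u l).toNat + d := by
      zify
      rw [← hu.1, ← Finset.sum_add_distrib]
      exact Finset.sum_congr rfl fun l _ => by omega
    rw [← h]
    exact hprod _
  · intro h
    obtain ⟨l, -, hl⟩ := (x.isPrime.prod_mem_iff).mp h
    by_cases hlA : l ∈ A
    · exact hx l hlA (x.isPrime.mem_of_pow_mem _ hl)
    · have h1 : (-u l).toNat = 0 := by have := hu.2 l hlA; omega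
      rw [h1, pow_zero] at hl
      exact one_notMem x hl
  · rw [show toRat (∏ l, (X l : MvPolynomial (Fin (n + 1)) k) ^ (u l).toNat) =
        ∏ l, toRat (X l) ^ (u l).toNat by simp only [toRat, map_prod, map_pow],
      show toRat (∏ l, (X l : MvPolynomial (Fin (n + 1)) k) ^ (-u l).toNat) =
        ∏ l, toRat (X l) ^ (-u l).toNat by simp only [toRat, map_prod, map_pow],
      laurentMonomial, ← Finset.prod_div_distrib]
    refine Finset.prod_congr rfl fun l _ => ?_
    rw [← zpow_natCast, ← zpow_natCast, ← zpow_sub₀ (toRat_X_ne_zero l)]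
    congr 1
    omega

lemma regularAt_laurent {d : ℕ} {A : Finset (Fin (n + 1))} {c : (Fin (n + 1) → ℤ) →₀ k}
    (hc : c ∈ Finsupp.supported k k (exponents d A)) {x : ProjectiveSpectrum (projGrading n k)}
    (hx : ∀ l ∈ A, (X l : MvPolynomial (Fin (n + 1)) k) ∉ x.asHomogeneousIdeal) :
    RegularAt d x (laurent n k c) :=
  RegularAt.sum _ fun _ hu => (regularAt_laurentMonomial (hc hu) hx).smul _

/-- The rational sections of `𝒪(d)` that are regular where the coordinates in `A` do not vanish are
Laurent polynomials. -/
lemma exists_laurent_eq {d : ℕ} {A : Finset (Fin (n + 1))} (hA : A.Nonempty) {z : RatField n k}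
    (hz : ∀ x : ProjectiveSpectrum (projGrading n k),
      (∀ l ∈ A, (X l : MvPolynomial (Fin (n + 1)) k) ∉ x.asHomogeneousIdeal) → RegularAt d x z) :
    ∃ c ∈ Finsupp.supported k k (exponents d A), laurent n k c = z := by
  let g : MvPolynomial (Fin (n + 1)) k := ∏ l ∈ A, X l
  have hg : g.IsHomogeneous A.card := by
    have := IsHomogeneous.prod A (fun l => (X l : MvPolynomial (Fin (n + 1)) k)) (fun _ => 1)
      fun l _ => isHomogeneous_X k l
    simpa using this
  have hg0 : g ≠ 0 := Finset.prod_ne_zero_iff.mpr fun l _ => X_ne_zero l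
  obtain ⟨N, r, hr, rfl⟩ := exists_form_div_pow (Finset.card_pos.mpr hA) hg hg0 (z := z)
    fun x hx => hz x fun l hl h => hx (Ideal.mem_of_dvd _ (Finset.dvd_prod_of_mem _ hl) h)
  let w : Fin (n + 1) → ℤ := fun l => if l ∈ A then (N : ℤ) else 0
  have hw : toRat g ^ N = laurentMonomial k w := by
    simp only [g, toRat, map_prod]
    rw [← Finset.prod_pow, laurentMonomial, ← Finset.prod_subset (Finset.subset_univ A)]
    · exact Finset.prod_congr rfl fun l hl => by simp [w, hl, toRat]
    · intro l _ hl
      simp [w, hl]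
  refine ⟨∑ m ∈ r.support, Finsupp.single (fun l => (m l : ℤ) - w l) (coeff m r), ?_, ?_⟩
  · refine Submodule.sum_mem _ fun m hm => Finsupp.single_mem_supported k _ ⟨?_, ?_⟩
    · have h1 : m.degree = d + N * A.card := by
        have := hr (mem_support_iff.mp hm)
        rwa [Finsupp.degree_eq_weight_one]
      rw [degree_eq_univ_sum] at h1
      rw [Finset.sum_sub_distrib, ← Nat.cast_sum, h1]
      simp [w, mul_comm]
    · intro l hl
      simp [w, hl]
  · rw [map_sum]
    have h1 : toRat r = ∑ m ∈ r.support, coeff m r • laurentMonomial k (fun l => (m l : ℤ)) := by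
      conv_lhs => rw [r.as_sum]
      rw [show toRat (∑ m ∈ r.support, monomial m (coeff m r)) =
        ∑ m ∈ r.support, toRat (monomial m (coeff m r)) from map_sum _ _ _]
      refine Finset.sum_congr rfl fun m _ => ?_
      rw [laurentMonomial_natCast, ← toRat_smul_eq_smul, smul_monomial, smul_eq_mul, mul_one]
    have hw0 : laurentMonomial k w ≠ 0 := Finset.prod_ne_zero_iff.mpr fun l _ =>
      zpow_ne_zero _ (toRat_X_ne_zero l)
    rw [hw, h1, Finset.sum_div]
    refine Finset.sum_congr rfl fun m _ => ?_
    rw [laurent, Finsupp.linearCombination_single, smul_div_assoc]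
    congr 1
    rw [eq_div_iff hw0, ← laurentMonomial_add]
    congr 1
    funext l
    exact sub_add_cancel _ _

end Laurent

/-! ### Vanishing of the higher cohomology of O(d) for d ≥ 0. -/

section Homotopy

/-- `j` is the first index where `u` is nonnegative. -/
def IsFirstNonneg (u : Fin (n + 1) → ℤ) (j : Fin (n + 1)) : Prop := 0 ≤ u j ∧ ∀ i < j, u i < 0

/-- Because d ≥ 0, the exponents of a Laurent monomial of degree d cannot all be negative. Choosing
the first nonnegative one splits Laurent polynomials into n + 1 parts, one for each variable. -/
lemma existsUnique_isFirstNonneg {d : ℕ} {A : Finset (Fin (n + 1))} {u : Fin (n + 1) → ℤ}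
    (hu : u ∈ exponents d A) : ∃! j, IsFirstNonneg u j := by
  classical
  have hne : ∃ j, 0 ≤ u j := by
    by_contra! h
    have h1 : ∑ l, u l < 0 := Finset.sum_neg (fun l _ => h l) Finset.univ_nonempty
    rw [hu.1] at h1
    omega
  refine ⟨Fin.find _ hne, ⟨Fin.find_spec hne, fun i hi => not_le.mp (Fin.find_min hne hi)⟩, ?_⟩
  intro j hj
  rcases lt_trichotomy j (Fin.find _ hne) with h | h | h
  · exact (Fin.find_min hne h hj.1).elim
  · exact h
  · exact ((hj.2 _ h).not_ge (Fin.find_spec hne)).elim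

open scoped Classical in
/-- The Čech complex of `𝒪(d)` is exact in positive degrees. -/
lemma exists_cech_preimage {d p : ℕ} {f : (Fin (p + 2) → Fin (n + 1)) → RatField n k}
    (hf : ∀ (α : Fin (p + 2) → Fin (n + 1)) (x : ProjectiveSpectrum (projGrading n k)),
      (∀ a, (X (α a) : MvPolynomial (Fin (n + 1)) k) ∉ x.asHomogeneousIdeal) → RegularAt d x (f α))
    (hd : ∀ β : Fin (p + 3) → Fin (n + 1),
      ∑ i : Fin (p + 3), (-1 : ℤ) ^ (i : ℕ) • f (β ∘ i.succAbove) = 0) :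
    ∃ g : (Fin (p + 1) → Fin (n + 1)) → RatField n k,
      (∀ (γ : Fin (p + 1) → Fin (n + 1)) (x : ProjectiveSpectrum (projGrading n k)),
        (∀ a, (X (γ a) : MvPolynomial (Fin (n + 1)) k) ∉ x.asHomogeneousIdeal) →
          RegularAt d x (g γ)) ∧
      ∀ α : Fin (p + 2) → Fin (n + 1),
        f α = ∑ i : Fin (p + 2), (-1 : ℤ) ^ (i : ℕ) • g (α ∘ i.succAbove) := by
  let A {q : ℕ} (α : Fin (q + 1) → Fin (n + 1)) : Finset (Fin (n + 1)) := Finset.univ.image α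
  choose c hc hcf using fun α => exists_laurent_eq (d := d) (A := A α) ((Finset.univ_nonempty).image α)
    (z := f α) fun x hx => hf α x fun a => hx _ (Finset.mem_image_of_mem _ (Finset.mem_univ a))
  have hdc (β : Fin (p + 3) → Fin (n + 1)) :
      ∑ i : Fin (p + 3), (-1 : ℤ) ^ (i : ℕ) • c (β ∘ i.succAbove) = 0 := by
    apply laurent_injective
    rw [map_sum, map_zero, ← hd β]
    exact Finset.sum_congr rfl fun i _ => by rw [map_zsmul, hcf]
  -- The projection onto the monomials whose first nonnegative exponent is the j-th.
  let π (j : Fin (n + 1)) : ((Fin (n + 1) → ℤ) →₀ k) →+ ((Fin (n + 1) → ℤ) →₀ k) :=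
    Finsupp.filterAddHom fun u => IsFirstNonneg u j
  have hπ {A' : Finset (Fin (n + 1))} {b : (Fin (n + 1) → ℤ) →₀ k}
      (hb : b ∈ Finsupp.supported k k (exponents d A')) : ∑ j, π j b = b := by
    ext u
    rw [Finsupp.finsetSum_apply]
    by_cases hu : b u = 0
    · rw [hu]
      refine Finset.sum_eq_zero fun j _ => ?_
      simp only [π, Finsupp.filterAddHom, AddMonoidHom.coe_mk, ZeroHom.coe_mk, Finsupp.filter_apply, hu,
        ite_self]
    · obtain ⟨j, hj, huniq⟩ := existsUnique_isFirstNonneg (hb (Finsupp.mem_support_iff.mpr hu))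
      rw [Finset.sum_eq_single j]
      · exact Finsupp.filter_apply_pos _ _ hj
      · exact fun i _ hi => Finsupp.filter_apply_neg _ _ fun h => hi (huniq i h)
      · exact fun h => (h (Finset.mem_univ j)).elim
  -- The contracting homotopy: on the j-th part, the index j is put in front of γ.
  let b (γ : Fin (p + 1) → Fin (n + 1)) : (Fin (n + 1) → ℤ) →₀ k :=
    ∑ j, π j (c (Fin.cons j γ))
  have hb (γ : Fin (p + 1) → Fin (n + 1)) : b γ ∈ Finsupp.supported k k (exponents d (A γ)) := by
    refine Submodule.sum_mem _ fun j _ => fun u hu => ?_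
    rw [Finset.mem_coe, Finsupp.mem_support_iff] at hu
    have hj : IsFirstNonneg u j := by
      by_contra h
      exact hu (Finsupp.filter_apply_neg _ _ h)
    have hu' : u ∈ (c (Fin.cons j γ)).support := by
      rw [Finsupp.mem_support_iff]
      intro h
      exact hu ((Finsupp.filter_apply_pos (fun u => IsFirstNonneg u j) _ hj).trans h)
    refine ⟨(hc _ hu').1, fun l hl => ?_⟩
    -- The open set of (j, γ) also inverts x_j, but the j-th part has no pole along x_j = 0. Thus
    -- the value extends over the open set of γ.
    by_cases hlj : l = j
    · exact hlj ▸ hj.1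
    · refine (hc _ hu').2 l fun h => ?_
      obtain ⟨a, -, ha⟩ := Finset.mem_image.mp h
      induction a using Fin.cases with
      | zero => exact hlj ha.symm
      | succ a => exact hl (Finset.mem_image.mpr ⟨a, Finset.mem_univ a, ha⟩)
  refine ⟨fun γ => laurent n k (b γ), fun γ x hx => regularAt_laurent (hb γ) fun l hl => ?_, fun α => ?_⟩
  · obtain ⟨a, -, rfl⟩ := Finset.mem_image.mp hl
    exact hx a
  -- The cocycle condition on (j, α), solved for its first term, holds for every j; it is used on
  -- the j-th part only.
  · have h1 (j : Fin (n + 1)) : c α = ∑ i : Fin (p + 2), (-1 : ℤ) ^ (i : ℕ) •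
        c (Fin.cons j (α ∘ i.succAbove)) := by
      have h2 := hdc (Fin.cons j α)
      rw [Fin.sum_univ_succ] at h2
      have h3 : (Fin.cons j α : Fin (p + 3) → Fin (n + 1)) ∘ (0 : Fin (p + 3)).succAbove = α := rfl
      have h4 (i : Fin (p + 2)) : (Fin.cons j α : Fin (p + 3) → Fin (n + 1)) ∘ i.succ.succAbove =
          Fin.cons j (α ∘ i.succAbove) := by
        funext a
        induction a using Fin.cases with
        | zero => simp
        | succ a => simp
      simp only [h3, h4, Fin.val_zero, pow_zero, one_smul, Fin.val_succ, pow_succ, mul_neg, mul_one,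
        neg_smul, Finset.sum_neg_distrib] at h2
      exact (eq_neg_of_add_eq_zero_left h2).trans (neg_neg _)
    rw [← hcf α, ← hπ (hc α)]
    simp_rw [← map_zsmul (laurent n k), ← map_sum (laurent n k)]
    congr 1
    simp only [b, Finset.smul_sum]
    rw [Finset.sum_comm]
    refine Finset.sum_congr rfl fun j _ => ?_
    conv_lhs => rw [h1 j]
    rw [map_sum]
    exact Finset.sum_congr rfl fun i _ => map_zsmul _ _ _

end Homotopy
end
end KernelBundle

namespace KernelBundle
open TopologicalSpace Opposite

noncomputable section

/-! ### Sections of a kernel. -/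

section KernelSections
variable {X : Scheme.{u}} {F G : X.Modules} (φ : F ⟶ G) (U : X.Opens)

variable (X) in
/-- The functor of sections over an open set. -/
abbrev sectionsOver : X.Modules ⥤ Ab.{u} :=
  Scheme.Modules.toPresheaf X ⋙ (evaluation X.Opensᵒᵖ Ab).obj (op U)

instance : (sectionsOver X U).PreservesZeroMorphisms where
  map_zero _ _ := rfl

instance : PreservesLimits (sectionsOver X U) := by
  have : PreservesLimits ((evaluation X.Opensᵒᵖ Ab.{u}).obj (op U)) := inferInstance
  exact comp_preservesLimits (Scheme.Modules.toPresheaf X) ((evaluation X.Opensᵒᵖ Ab.{u}).obj (op U))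

lemma app_injective_of_mono [Mono φ] : Function.Injective (φ.app U) :=
  (AddCommGrpCat.mono_iff_injective _).mp (inferInstanceAs (Mono ((sectionsOver X U).map φ)))

/-- Taking sections over an open set preserves limits, in particular kernels. -/
lemma exists_kernel_ι_app_eq {v : Γ(F, U)} (hv : φ.app U v = 0) :
    ∃ w : Γ(kernel φ, U), (kernel.ι φ).app U w = v := by
  have h := (ShortComplex.exact_of_f_is_kernel (ShortComplex.mk _ _ (kernel.condition φ))
    (kernelIsKernel φ)).map_of_mono_of_preservesKernel (sectionsOver X U)
    (inferInstanceAs (Mono (kernel.ι φ))) inferInstance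
  exact (ShortComplex.ab_exact_iff _).mp h v hv

lemma app_kernel_ι_app (w : Γ(kernel φ, U)) : φ.app U ((kernel.ι φ).app U w) = 0 :=
  congrArg (fun ψ : kernel φ ⟶ G => ψ.app U w) (kernel.condition φ)

end KernelSections

variable {n : ℕ} {k : Type u} [Field k]

/-! ### Acyclicity of sums of line bundles. -/

section Acyclic

lemma gen_mem_cechOpen {p : ℕ} (α : Fin (p + 1) → Fin (n + 1)) : gen n k ∈ cechOpen k α :=
  mem_cechOpen.mpr fun _ => notMem_genericPt.mpr (MvPolynomial.X_ne_zero _)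

lemma cechMap_d {F G : (ProjSpace n k).Modules} (φ : F ⟶ G) {p q : ℕ} (f : (cechComplex F).X p) :
    (cechComplex G).d p q ((cechMap φ).f p f) = (cechMap φ).f q ((cechComplex F).d p q f) :=
  ConcreteCategory.congr_hom ((cechMap φ).comm p q) f

/-- Values at the generic point turn Čech cochains into families of rational functions, to which
`exists_cech_preimage` applies. Cochains are indexed by all tuples, repetitions included, so the
complex does not stop at degree n and exactness is needed in every positive degree. -/
lemma exists_cechComplex_twist_d_eq {d p : ℕ} (f : (cechComplex (twist n k d)).X (p + 1))
    (hf : (cechComplex (twist n k d)).d (p + 1) (p + 2) f = 0) :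
    ∃ g, (cechComplex (twist n k d)).d p (p + 1) g = f := by
  have hval {q : ℕ} (h : (cechComplex (twist n k d)).X q) (β : Fin (q + 2) → Fin (n + 1)) :
      val (gen n k) (gen_mem_cechOpen β) (cechCoord _ β ((cechComplex (twist n k d)).d q (q + 1) h)) =
        ∑ i : Fin (q + 2), (-1 : ℤ) ^ (i : ℕ) • val (gen n k) (gen_mem_cechOpen (β ∘ i.succAbove))
          (cechCoord _ (β ∘ i.succAbove) h) := by
    rw [cechCoord_d, map_sum]
    exact Finset.sum_congr rfl fun i _ => map_zsmul _ _ _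
  obtain ⟨g, hg, hgf⟩ := exists_cech_preimage (d := d)
    (f := fun α => val (gen n k) (gen_mem_cechOpen α) (cechCoord _ α f))
    (fun α x hx => by
      rw [val_eq_val _ (gen_mem_cechOpen α) (mem_cechOpen.mpr hx)]
      exact regularAt_val _ _)
    fun β => by
      have h1 := hval f β
      rw [hf, map_zero, map_zero] at h1
      exact h1.symm
  obtain ⟨c, hc⟩ := exists_cechCoord_eq (F := twist n k d) (p := p) fun γ =>
    twistMk (cechOpen k γ) (g γ) fun x hx => hg γ x (mem_cechOpen.mp hx)
  refine ⟨c, cechCoord_ext fun α => val_ext_of_mem (gen_mem_cechOpen α) ?_⟩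
  rw [hval, hgf α]
  refine Finset.sum_congr rfl fun i _ => ?_
  rw [hc]
  rfl

variable {I : Type} [Fintype I] {δ : I → ℕ}

lemma coord_cechCoord {p : ℕ} {F : I → (ProjSpace n k).Modules} (f : (cechComplex (⨁ F)).X p)
    (α : Fin (p + 1) → Fin (n + 1)) (i : I) :
    coord F i (cechCoord _ α f) = cechCoord _ α ((cechMap (biproduct.π F i)).f p f) :=
  (cechCoord_map _ _ _).symm

lemma exists_cechComplex_d_eq {p : ℕ}
    (f : (cechComplex (⨁ fun i => twist n k (δ i))).X (p + 1))
    (hf : (cechComplex (⨁ fun i => twist n k (δ i))).d (p + 1) (p + 2) f = 0) :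
    ∃ g, (cechComplex (⨁ fun i => twist n k (δ i))).d p (p + 1) g = f := by
  let F (i : I) := twist n k (δ i)
  have hi (i : I) := exists_cechComplex_twist_d_eq ((cechMap (biproduct.π F i)).f _ f) (by
    rw [cechMap_d, hf, map_zero])
  choose g hg using hi
  choose c hc using fun γ : Fin (p + 1) → Fin (n + 1) =>
    exists_coord_eq (F := F) fun i => cechCoord _ γ (g i)
  obtain ⟨c', hc'⟩ := exists_cechCoord_eq (F := ⨁ F) c
  have h1 (i : I) : (cechMap (biproduct.π F i)).f _ c' = g i := cechCoord_ext fun γ => by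
    rw [← coord_cechCoord, hc', hc]
  refine ⟨c', cechCoord_ext fun α => coord_ext fun i => ?_⟩
  refine (coord_cechCoord (F := F) _ α i).trans (Eq.trans ?_ (coord_cechCoord (F := F) f α i).symm)
  rw [← cechMap_d, h1, hg]

lemma isZero_cohomology_succ (p : ℕ) :
    IsZero (cohomology (⨁ fun i => twist n k (δ i)) (p + 1)) := by
  rw [← HomologicalComplex.exactAt_iff_isZero_homology, HomologicalComplex.exactAt_iff' _ p _ (p + 2)
    (by simp) (by simp), ShortComplex.moduleCat_exact_iff]
  exact exists_cechComplex_d_eq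

end Acyclic

/-! ### The short exact sequence of Čech complexes. -/

section ShortExact
variable {F G : (ProjSpace n k).Modules} (M : F ⟶ G)

lemma cechMap_kernel_ι (p : ℕ) (f : (cechComplex (kernel M)).X p) :
    (cechMap M).f p ((cechMap (kernel.ι M)).f p f) = 0 :=
  cechCoord_ext fun α => by
    rw [cechCoord_map, cechCoord_map, app_kernel_ι_app, map_zero]

/-- The sequence of Čech complexes of `ker M ⟶ F ⟶ G`. -/
def cechSequence : ShortComplex (CochainComplex (ModuleCat.{u} k) ℕ) :=
  ShortComplex.mk (cechMap (kernel.ι M)) (cechMap M) (HomologicalComplex.hom_ext _ _ fun p =>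
    ModuleCat.hom_ext (LinearMap.ext (cechMap_kernel_ι M p)))

/-- Cochains are families of sections over intersections of the cover. On each of these, sections
are left exact, and surjectivity of `M` is assumed. -/
lemma cechSequence_shortExact
    (hM : ∀ (p : ℕ) (α : Fin (p + 1) → Fin (n + 1)), Function.Surjective (M.app (cechOpen k α))) :
    (cechSequence M).ShortExact := by
  refine HomologicalComplex.shortExact_of_degreewise_shortExact _ fun p => ?_
  have := (ModuleCat.mono_iff_injective ((cechMap (kernel.ι M)).f p)).mpr fun f g h =>
    cechCoord_ext fun α => app_injective_of_mono (kernel.ι M) (cechOpen k α) (by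
      rw [← cechCoord_map, ← cechCoord_map, h])
  have := (ModuleCat.epi_iff_surjective ((cechMap M).f p)).mpr fun g => by
    choose f hf using fun α => hM p α (cechCoord _ α g)
    obtain ⟨c, hc⟩ := exists_cechCoord_eq f
    exact ⟨c, cechCoord_ext fun α => by rw [cechCoord_map, hc, hf]⟩
  refine ShortComplex.ShortExact.mk' ?_ (by assumption) (by assumption)
  rw [ShortComplex.moduleCat_exact_iff]
  change ∀ f : (cechComplex F).X p, (cechMap M).f p f = 0 →
    ∃ g : (cechComplex (kernel M)).X p, (cechMap (kernel.ι M)).f p g = f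
  intro f hf
  choose g hg using fun α => exists_kernel_ι_app_eq M (cechOpen k α) (v := cechCoord _ α f) (by
    rw [← cechCoord_map, hf, map_zero])
  obtain ⟨c, hc⟩ := exists_cechCoord_eq g
  exact ⟨c, cechCoord_ext fun α => by rw [cechCoord_map, hc, hg]⟩

end ShortExact
end
end KernelBundle

namespace KernelBundle
open TopologicalSpace Opposite

noncomputable section
variable {n : ℕ} {k : Type u} [Field k]

/-! ### Zeroth cohomology and global sections. -/

section GlobalSections
variable {F G : (ProjSpace n k).Modules}

/-- Degree zero Čech cocycles are global sections. -/
lemma existsUnique_gluing_cech {f : (cechComplex F).X 0} (hf : (cechComplex F).d 0 1 f = 0) :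
    ∃! v : Γ(F, ⊤), ∀ α : Fin 1 → Fin (n + 1),
      F.presheaf.map (homOfLE (le_top : cechOpen k α ≤ ⊤)).op v = cechCoord F α f := by
  refine TopCat.Sheaf.existsUnique_gluing' ⟨F.presheaf, F.isSheaf⟩
    (fun α : Fin 1 → Fin (n + 1) => cechOpen k α) ⊤ (fun α => homOfLE le_top) ?_ _ ?_
  · intro x _
    obtain ⟨l, hl⟩ := exists_basicOpen_X_mem x
    exact Opens.mem_iSup.mpr ⟨fun _ => l, mem_cechOpen.mpr fun _ => hl⟩
  · intro α β
    -- The order is chosen so that omitting entry 0 leaves α and omitting entry 1 leaves β.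
    let γ : Fin 2 → Fin (n + 1) := ![β 0, α 0]
    have hγ : cechOpen k α ⊓ cechOpen k β ≤ cechOpen k γ := fun x hx => mem_cechOpen.mpr fun a => by
      fin_cases a
      · exact mem_cechOpen.mp hx.2 0
      · exact mem_cechOpen.mp hx.1 0
    have h0 : γ ∘ (0 : Fin 2).succAbove = α := by
      funext a; fin_cases a; rfl
    have h1 : γ ∘ (1 : Fin 2).succAbove = β := by
      funext a; fin_cases a; rfl
    have h := cechCoord_d f γ
    rw [hf, map_zero, Fin.sum_univ_two] at h
    have key {α' β' : Fin 1 → Fin (n + 1)} (hα : α' = α) (hβ : β' = β) (h2 : cechOpen k γ ≤ cechOpen k α')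
        (h3 : cechOpen k γ ≤ cechOpen k β')
        (h4 : F.presheaf.map (homOfLE h2).op (cechCoord F α' f) =
          F.presheaf.map (homOfLE h3).op (cechCoord F β' f)) :
        F.presheaf.map (homOfLE (inf_le_left : cechOpen k α ⊓ cechOpen k β ≤ _)).op (cechCoord F α f) =
          F.presheaf.map (homOfLE (inf_le_right : cechOpen k α ⊓ cechOpen k β ≤ _)).op
            (cechCoord F β f) := by
      subst hα hβ
      have h5 := congrArg (F.presheaf.map (homOfLE hγ).op) h4
      rw [← ConcreteCategory.comp_apply, ← ConcreteCategory.comp_apply, ← F.presheaf.map_comp,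
        ← F.presheaf.map_comp] at h5
      exact h5
    refine key h0 h1 (cechOpen_le_succAbove γ 0) (cechOpen_le_succAbove γ 1) ?_
    simp only [Fin.val_zero, Fin.val_one, pow_zero, pow_one, one_smul, neg_smul] at h
    exact (sub_eq_zero.mp ((sub_eq_add_neg _ _).trans h.symm))

/-- The degree zero Čech cocycle of a global section. -/
lemma exists_cechCocycle (v : Γ(F, ⊤)) : ∃ f : (cechComplex F).X 0, (cechComplex F).d 0 1 f = 0 ∧
    ∀ α : Fin 1 → Fin (n + 1),
      cechCoord F α f = F.presheaf.map (homOfLE (le_top : cechOpen k α ≤ ⊤)).op v := by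
  obtain ⟨f, hf⟩ := exists_cechCoord_eq (F := F) (p := 0) fun α =>
    F.presheaf.map (homOfLE (le_top : cechOpen k α ≤ ⊤)).op v
  refine ⟨f, cechCoord_ext fun β => ?_, hf⟩
  rw [cechCoord_d, Fin.sum_univ_two, hf, hf, map_zero, ← ConcreteCategory.comp_apply,
    ← ConcreteCategory.comp_apply, ← F.presheaf.map_comp, ← F.presheaf.map_comp]
  simp only [Fin.val_zero, Fin.val_one, pow_zero, pow_one, one_smul, neg_smul]
  exact add_neg_cancel _

lemma exists_iCycles_eq {f : (cechComplex F).X 0} (hf : (cechComplex F).d 0 1 f = 0) :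
    ∃ z : (cechComplex F).cycles 0, (cechComplex F).iCycles 0 z = f := by
  have h := ShortComplex.exact_of_f_is_kernel (ShortComplex.mk _ _ ((cechComplex F).iCycles_d 0 1))
    ((cechComplex F).cyclesIsKernel 0 1 (by simp))
  exact (ShortComplex.moduleCat_exact_iff _).mp h f hf

lemma iCycles_injective : Function.Injective ((cechComplex F).iCycles 0) :=
  (ModuleCat.mono_iff_injective _).mp inferInstance

lemma iCycles_d_eq_zero (z : (cechComplex F).cycles 0) :
    (cechComplex F).d 0 1 ((cechComplex F).iCycles 0 z) = 0 :=
  ConcreteCategory.congr_hom ((cechComplex F).iCycles_d 0 1) z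

lemma iCycles_cyclesMap (φ : F ⟶ G) (z : (cechComplex F).cycles 0) :
    (cechComplex G).iCycles 0 (HomologicalComplex.cyclesMap (cechMap φ) 0 z) =
      (cechMap φ).f 0 ((cechComplex F).iCycles 0 z) :=
  ConcreteCategory.congr_hom (HomologicalComplex.cyclesMap_i (cechMap φ) 0) z

lemma mono_cyclesMap (φ : F ⟶ G) (hφ : Function.Injective (φ.app ⊤)) :
    Mono (HomologicalComplex.cyclesMap (cechMap φ) 0) := by
  rw [ModuleCat.mono_iff_injective]
  intro z z' h
  apply iCycles_injective
  obtain ⟨v, hv, -⟩ := existsUnique_gluing_cech (iCycles_d_eq_zero z)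
  obtain ⟨v', hv', -⟩ := existsUnique_gluing_cech (iCycles_d_eq_zero z')
  obtain ⟨w, -, hw⟩ := existsUnique_gluing_cech (iCycles_d_eq_zero
    (HomologicalComplex.cyclesMap (cechMap φ) 0 z))
  have hvv : v = v' := hφ (by
    rw [hw (φ.app ⊤ v) fun α => ?_, hw (φ.app ⊤ v') fun α => ?_]
    · beta_reduce
      rw [← app_map, hv', h, iCycles_cyclesMap, cechCoord_map]
    · beta_reduce
      rw [← app_map, hv, iCycles_cyclesMap, cechCoord_map])
  refine cechCoord_ext fun α => ?_
  rw [← hv, ← hv', hvv]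

lemma epi_cyclesMap (φ : F ⟶ G) (hφ : Function.Surjective (φ.app ⊤)) :
    Epi (HomologicalComplex.cyclesMap (cechMap φ) 0) := by
  rw [ModuleCat.epi_iff_surjective]
  intro z
  obtain ⟨w, hw, -⟩ := existsUnique_gluing_cech (iCycles_d_eq_zero z)
  obtain ⟨v, rfl⟩ := hφ w
  obtain ⟨f, hf, hfv⟩ := exists_cechCocycle v
  obtain ⟨y, rfl⟩ := exists_iCycles_eq hf
  refine ⟨y, iCycles_injective (cechCoord_ext fun α => ?_)⟩
  rw [iCycles_cyclesMap, cechCoord_map, hfv, app_map, hw]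

/-- The map induced on zeroth cohomology. -/
abbrev cohomologyMap (φ : F ⟶ G) (i : ℕ) : cohomology F i ⟶ cohomology G i :=
  HomologicalComplex.homologyMap (cechMap φ) i

lemma cohomologyMap_zero_eq (φ : F ⟶ G) : cohomologyMap φ 0 =
    (cechComplex F).isoHomologyπ₀.inv ≫ HomologicalComplex.cyclesMap (cechMap φ) 0 ≫
      (cechComplex G).isoHomologyπ₀.hom := by
  rw [← Category.assoc, ← CochainComplex.isoHomologyπ₀_inv_naturality, Category.assoc, Iso.inv_hom_id,
    Category.comp_id]

lemma mono_cohomologyMap_zero (φ : F ⟶ G) (hφ : Function.Injective (φ.app ⊤)) :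
    Mono (cohomologyMap φ 0) := by
  have := mono_cyclesMap φ hφ
  rw [cohomologyMap_zero_eq]
  infer_instance

lemma epi_cohomologyMap_zero (φ : F ⟶ G) (hφ : Function.Surjective (φ.app ⊤)) :
    Epi (cohomologyMap φ 0) := by
  have := epi_cyclesMap φ hφ
  rw [cohomologyMap_zero_eq]
  infer_instance

end GlobalSections

/-! ### Finiteness of the zeroth cohomology. -/

section Finiteness
variable {I : Type} [Fintype I] {δ : I → ℕ}

lemma toRat_C_mul (c : k) (z : RatField n k) : toRat (MvPolynomial.C c) * z = c • z := by
  rw [← IsScalarTower.algebraMap_smul (MvPolynomial (Fin (n + 1)) k) c z, Algebra.smul_def]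
  rfl

/-- The rational function representing a component of a Čech cochain with values in a direct sum of
line bundles. -/
def cechValue {p : ℕ} (α : Fin (p + 1) → Fin (n + 1)) (i : I) :
    (cechComplex (⨁ fun i => twist n k (δ i))).X p →ₗ[k] RatField n k where
  toFun f := val (gen n k) (gen_mem_cechOpen α) (coord (fun i => twist n k (δ i)) i (cechCoord _ α f))
  map_add' f g := by simp only [map_add]
  map_smul' c f := by
    have h : cechCoord (⨁ fun i => twist n k (δ i)) α (c • f) =
        constOn (cechOpen k α) c • cechCoord (⨁ fun i => twist n k (δ i)) α f :=
      (cechπ (⨁ fun i => twist n k (δ i)) α).hom.map_smul c f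
    rw [h, coord_smul, val_smul, fval_constOn, toRat_C_mul]
    rfl

instance finite_cohomology_zero : Module.Finite k (cohomology (⨁ fun i => twist n k (δ i)) 0) := by
  let F := ⨁ fun i => twist n k (δ i)
  -- The forms of degree δ_i inside the fraction field. All components of a zero-cocycle lie there,
  -- so cocycles embed in a finite product of these finite-dimensional spaces.
  let S (i : I) : Submodule k (RatField n k) :=
    (MvPolynomial.homogeneousSubmodule (Fin (n + 1)) k (δ i)).map
      (IsScalarTower.toAlgHom k (MvPolynomial (Fin (n + 1)) k) (RatField n k)).toLinearMap
  have hS (z : (cechComplex F).cycles 0) (α : Fin 1 → Fin (n + 1)) (i : I) :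
      cechValue α i ((cechComplex F).iCycles 0 z) ∈ S i := by
    obtain ⟨v, hv, -⟩ := existsUnique_gluing_cech (iCycles_d_eq_zero z)
    obtain ⟨g, hg⟩ := exists_ofForm_eq_coord v
    refine ⟨(g i).1, (g i).2, ?_⟩
    have h1 := congrArg (fun w => val (gen n k) (gen_mem_cechOpen α)
      (coord (fun i => twist n k (δ i)) i w)) (hv α)
    refine Eq.trans ?_ h1
    exact (congrArg (val _ _) ((coord_map (F := fun i => twist n k (δ i)) i _ v).trans
      (congrArg _ (hg i)))).symm
  let L : (cechComplex F).cycles 0 →ₗ[k] ∀ (_ : Fin 1 → Fin (n + 1)) (i : I), S i :=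
    LinearMap.pi fun α => LinearMap.pi fun i =>
      LinearMap.codRestrict (S i) (cechValue α i ∘ₗ ((cechComplex F).iCycles 0).hom) fun z => hS z α i
  have hL : Function.Injective L := fun z z' h => iCycles_injective <|
    cechCoord_ext fun α => coord_ext fun i => val_ext_of_mem (gen_mem_cechOpen α) <|
      congrArg Subtype.val (congrFun (congrFun h α) i)
  have (i : I) : Module.Finite k (S i) := Module.Finite.map _ _
  have : Module.Finite k (∀ (_ : Fin 1 → Fin (n + 1)) (i : I), S i) := Module.Finite.pi
  have : Module.Finite k ((cechComplex F).cycles 0) := Module.Finite.of_injective L hL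
  exact Module.Finite.equiv (cechComplex F).isoHomologyπ₀.toLinearEquiv

end Finiteness

/-! ### Cohomology of the kernel. -/

section Kernel
variable {I J : Type} [Fintype I] [Fintype J] {δ : I → ℕ} {ε : J → ℕ}

/-- The cohomology of the kernel of a map of direct sums of line bundles that is surjective on the
intersections of the standard cover and has maximal rank on global sections. -/
theorem cohomology_kernel (M : (⨁ fun i => twist n k (δ i)) ⟶ ⨁ fun j => twist n k (ε j))
    (hM : ∀ (p : ℕ) (α : Fin (p + 1) → Fin (n + 1)), Function.Surjective (M.app (cechOpen k α)))
    (hrank : HasMaximalRankOnSections M) :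
    (∀ i, Module.Finite k (cohomology (kernel M) i)) ∧
      (hDim (kernel M) 0 : ℤ) = max (eulerChar (kernel M)) 0 ∧
      (hDim (kernel M) 1 : ℤ) = max (-eulerChar (kernel M)) 0 ∧
      ∀ i, 2 ≤ i → hDim (kernel M) i = 0 := by
  have hS := cechSequence_shortExact M hM
  have hmono : Mono (cohomologyMap (kernel.ι M) 0) := by
    have := (ModuleCat.mono_iff_injective ((cechMap (kernel.ι M)).f 0)).mpr fun f g h =>
      cechCoord_ext fun α => app_injective_of_mono (kernel.ι M) (cechOpen k α) (by
        rw [← cechCoord_map, ← cechCoord_map, h])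
    exact HomologicalComplex.mono_homologyMap_of_mono_of_not_rel _ 0 (by simp)
  -- H^{p+2} of the kernel lies between H^{p+1} of the target and H^{p+2} of the source, which both
  -- vanish.
  have hzero (p : ℕ) : IsZero (cohomology (kernel M) (p + 2)) := by
    refine (hS.homology_exact₁ (p + 1) (p + 2) (by simp)).isZero_of_both_zeros ?_ ?_
    · exact (isZero_cohomology_succ p).eq_of_src _ _
    · exact (isZero_cohomology_succ (p + 1)).eq_of_tgt _ _
  -- The connecting map from H⁰ of the target is onto H¹ of the kernel, since H¹ of the source
  -- vanishes.
  let D : cohomology (⨁ fun j => twist n k (ε j)) 0 ⟶ cohomology (kernel M) 1 := hS.δ 0 1 (by simp)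
  have hepi : Epi D := hS.epi_δ 0 1 (by simp) (isZero_cohomology_succ 0)
  have hfin (i : ℕ) : Module.Finite k (cohomology (kernel M) i) := by
    match i with
    | 0 =>
      exact Module.Finite.of_injective (cohomologyMap (kernel.ι M) 0).hom
        ((ModuleCat.mono_iff_injective _).mp hmono)
    | 1 =>
      exact Module.Finite.of_surjective D.hom
        ((ModuleCat.epi_iff_surjective _).mp hepi)
    | p + 2 =>
      have := ModuleCat.subsingleton_of_isZero (hzero p)
      infer_instance
  have hDim_zero {i : ℕ} (h : IsZero (cohomology (kernel M) i)) : hDim (kernel M) i = 0 := by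
    have := ModuleCat.subsingleton_of_isZero h
    exact Module.finrank_zero_of_subsingleton
  have hge (i : ℕ) (hi : 2 ≤ i) : hDim (kernel M) i = 0 := by
    obtain ⟨p, rfl⟩ := Nat.exists_eq_add_of_le' hi
    exact hDim_zero (hzero p)
  -- The connecting map vanishes on the image of H⁰(M), so it is zero when that map is onto; being
  -- an epimorphism as well, it forces its target to vanish.
  have hone (h : Function.Surjective (M.app ⊤)) : hDim (kernel M) 1 = 0 := by
    have := epi_cohomologyMap_zero M h
    refine hDim_zero ?_
    rw [IsZero.iff_id_eq_zero, ← cancel_epi D, ← cancel_epi (cohomologyMap M 0),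
      comp_zero, comp_zero, Category.comp_id]
    exact hS.comp_δ 0 1 (by simp)
  have hor : hDim (kernel M) 0 = 0 ∨ hDim (kernel M) 1 = 0 := by
    rcases hrank with h | h
    · have := mono_cohomologyMap_zero M h
      refine Or.inl (hDim_zero ?_)
      rw [IsZero.iff_id_eq_zero, ← cancel_mono (cohomologyMap (kernel.ι M) 0),
        ← cancel_mono (cohomologyMap M 0), zero_comp, zero_comp, Category.id_comp]
      exact (ShortComplex.map (cechSequence M) (HomologicalComplex.homologyFunctor _ _ 0)).zero
    · exact Or.inr (hone h)
  have hχ : eulerChar (kernel M) = hDim (kernel M) 0 - hDim (kernel M) 1 := by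
    rw [eulerChar]
    rcases n with _ | n
    -- For n = 0 the Euler characteristic stops at h⁰. The single chart is the whole space, so `M`
    -- is surjective on global sections and h¹ vanishes.
    · have htop : cechOpen k (fun _ : Fin 1 => (0 : Fin 1)) = ⊤ := by
        refine top_le_iff.mp fun x _ => mem_cechOpen.mpr fun _ => ?_
        obtain ⟨l, hl⟩ := exists_basicOpen_X_mem x
        rwa [show l = 0 from Fin.ext (by omega)] at hl
      rw [hone (htop ▸ hM 0 fun _ => 0)]
      simp
    · rw [Finset.sum_range_succ', Finset.sum_range_succ', Finset.sum_eq_zero fun i _ => ?_]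
      · simp [add_comm, sub_eq_add_neg]
      · rw [hge (i + 1 + 1) (by omega)]
        simp
  refine ⟨hfin, ?_, ?_, hge⟩
  · rw [hχ]
    rcases hor with h | h <;> rw [h] <;> simp
  · rw [hχ]
    rcases hor with h | h <;> rw [h] <;> simp

end Kernel
end
end KernelBundle

namespace KernelBundle
open TopologicalSpace Opposite

noncomputable section

/-! ### Free modules, and bases of kernels. -/

section FreeModules
variable {X : Scheme.{u}}

variable (X) in
/-- The structure sheaf as a module over itself. -/
abbrev structureModule : X.Modules := SheafOfModules.unit X.ringCatSheaf

/-- The map from the structure sheaf given by a global section. -/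
def ofSection (F : X.Modules) (v : Γ(F, ⊤)) : structureModule X ⟶ F :=
  SheafOfModules.Hom.mk (PresheafOfModules.homMk
    { app := fun U => AddCommGrpCat.ofHom (X := Γ(X, U.unop)) (Y := Γ(F, U.unop))
        { toFun := fun r => r • F.presheaf.map (homOfLE (le_top : U.unop ≤ ⊤)).op v
          map_zero' := zero_smul _ _
          map_add' := fun r s => add_smul r s _ }
      naturality := fun U V i => by
        ext (r : Γ(X, U.unop))
        have h := Scheme.Modules.map_smul F i.unop r (F.presheaf.map (homOfLE (le_top : U.unop ≤ ⊤)).op v)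
        rw [← ConcreteCategory.comp_apply, ← F.presheaf.map_comp] at h
        exact h.symm }
    (fun U r m => mul_smul (α := Γ(X, U.unop)) r m
      (F.presheaf.map (homOfLE (le_top : U.unop ≤ ⊤)).op v)))

/-- A module with a basis of global sections is free. -/
lemma nonempty_iso_free (F : X.Modules) {r : ℕ} (v : Fin r → Γ(F, ⊤))
    (h : ∀ U : X.Opens, Function.Bijective fun c : Fin r → Γ(X, U) =>
      ∑ i, c i • F.presheaf.map (homOfLE (le_top : U ≤ ⊤)).op (v i)) :
    Nonempty (F ≅ (SheafOfModules.free (R := X.ringCatSheaf) (ULift.{u} (Fin r)) : X.Modules)) := by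
  have : HasFiniteBiproducts X.Modules := Abelian.hasFiniteBiproducts
  let φ : (⨁ fun _ : Fin r => structureModule X) ⟶ F := biproduct.desc fun i => ofSection F (v i)
  have hφ (U : X.Opens) (w) : φ.app U w =
      ∑ i, (show Γ(X, U) from coord (fun _ : Fin r => structureModule X) i w) •
        F.presheaf.map (homOfLE (le_top : U ≤ ⊤)).op (v i) := by
    simp only [φ, biproduct.desc_eq, app_sum]
    rfl
  have hiso : IsIso φ := by
    rw [Scheme.Modules.Hom.isIso_iff_isIso_app]
    intro U
    rw [ConcreteCategory.isIso_iff_bijective]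
    constructor
    · intro w w' hw
      rw [hφ, hφ] at hw
      have := (h U).1 hw
      exact coord_ext fun i => congrFun this i
    · intro z
      obtain ⟨c, hc⟩ := (h U).2 z
      obtain ⟨w, hw⟩ := exists_coord_eq (F := fun _ : Fin r => structureModule X) (U := U) c
      refine ⟨w, (hφ U w).trans (Eq.trans ?_ hc)⟩
      simp only [hw]
  exact ⟨(asIso φ).symm ≪≫ biproduct.isoCoproduct _ ≪≫
    (Sigma.reindex Equiv.ulift.{u} fun _ : Fin r => structureModule X).symm⟩

end FreeModules

section Frames
variable {X : Scheme.{u}} {I : Type*} [Fintype I]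

/-- The sections `e i` of `F` form a basis of `F` over `U`. -/
def IsFrame (F : X.Modules) (U : X.Opens) (e : I → Γ(F, U)) : Prop :=
  ∀ (W : X.Opens) (h : W ≤ U), Function.Bijective fun c : I → Γ(X, W) =>
    ∑ i, c i • F.presheaf.map (homOfLE h).op (e i)

lemma res_res {F : X.Modules} {U V W : X.Opens} (h : V ≤ U) (h' : W ≤ V) (v : Γ(F, U)) :
    F.presheaf.map (homOfLE h').op (F.presheaf.map (homOfLE h).op v) =
      F.presheaf.map (homOfLE (h'.trans h)).op v := by
  rw [← ConcreteCategory.comp_apply, ← F.presheaf.map_comp]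
  rfl

lemma IsFrame.nonempty_iso_free {F : X.Modules} {U : X.Opens} {r : ℕ} {e : Fin r → Γ(F, U)}
    (he : IsFrame F U e) : Nonempty (F.restrict U.ι ≅
      (SheafOfModules.free (R := U.toScheme.ringCatSheaf) (ULift.{u} (Fin r)) : U.toScheme.Modules)) := by
  have hle (W : U.toScheme.Opens) : U.ι ''ᵁ W ≤ U := by
    simpa using Scheme.Hom.image_mono U.ι (le_top : W ≤ ⊤)
  refine KernelBundle.nonempty_iso_free (F.restrict U.ι)
    (fun i => F.presheaf.map (homOfLE (hle ⊤)).op (e i)) fun W => ?_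
  have h1 := he _ (hle W)
  have h2 : Function.Bijective (Pi.map fun (_ : Fin r) (c : Γ(U.toScheme, W)) => (U.ι.appIso W).inv c) :=
    Function.Bijective.piMap fun _ => (U.ι.appIso W).symm.commRingCatIsoToRingEquiv.bijective
  refine Eq.mp (congrArg Function.Bijective (funext fun c => ?_)) (h1.comp h2)
  refine Finset.sum_congr rfl fun i _ => ?_
  have h3 : F.presheaf.map (homOfLE (hle W)).op (e i) =
      (F.restrict U.ι).presheaf.map (homOfLE (le_top : W ≤ ⊤)).op
        (F.presheaf.map (homOfLE (hle ⊤)).op (e i)) := by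
    exact (res_res (hle ⊤) (Scheme.Hom.image_mono U.ι (le_top : W ≤ ⊤)) (e i)).symm
  rw [h3]
  rfl

/-- The restriction of regular functions. -/
abbrev resHom {U W : X.Opens} (h : W ≤ U) : Γ(X, U) →+* Γ(X, W) :=
  (X.presheaf.map (homOfLE h).op).hom

lemma res_sum_smul {F : X.Modules} {U W : X.Opens} (h : W ≤ U) (c : I → Γ(X, U)) (e : I → Γ(F, U)) :
    F.presheaf.map (homOfLE h).op (∑ i, c i • e i) =
      ∑ i, resHom h (c i) • F.presheaf.map (homOfLE h).op (e i) := by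
  rw [map_sum]
  exact Finset.sum_congr rfl fun i _ => Scheme.Modules.map_smul _ _ _ _

lemma app_sum_smul {F G : X.Modules} (φ : F ⟶ G) {U : X.Opens} (c : I → Γ(X, U)) (e : I → Γ(F, U)) :
    φ.app U (∑ i, c i • e i) = ∑ i, c i • φ.app U (e i) := by
  rw [map_sum]
  exact Finset.sum_congr rfl fun i _ => Scheme.Modules.Hom.app_smul _ _ _

lemma resHom_resHom {U V W : X.Opens} (h : V ≤ U) (h' : W ≤ V) (a : Γ(X, U)) :
    resHom h' (resHom h a) = resHom (h'.trans h) a := by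
  rw [← ConcreteCategory.comp_apply, ← X.presheaf.map_comp]
  rfl

lemma resHom_refl {U : X.Opens} (a : Γ(X, U)) : resHom (le_refl U) a = a :=
  congrArg (fun φ => φ a) (X.presheaf.map_id (op U))

/-- A matrix with an invertible maximal minor has a basis of its kernel indexed by the remaining
columns. -/
lemma exists_kernel_basis {R : Type*} [CommRing R] {J : Type*} [Fintype J] [DecidableEq J]
    [DecidableEq I] (A : Matrix J I R) (σ : J → I) (hσ : IsUnit (A.submatrix id σ).det) :
    ∃ z : I → I → R, (∀ i, A.mulVec (z i) = 0) ∧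
      ∀ i, ∀ i' ∉ Set.range σ, z i i' = if i = i' then 1 else 0 := by
  let B := A.submatrix id σ
  -- The column i is expressed in the columns chosen by `σ`; subtracting this combination from the
  -- i-th unit vector gives a vector of the kernel.
  let w (i : I) : J → R := B⁻¹.mulVec (A.col i)
  refine ⟨fun i i' => (if i = i' then 1 else 0) - ∑ j, if σ j = i' then w i j else 0, fun i => ?_,
    fun i i' hi' => ?_⟩
  · have h1 : B.mulVec (w i) = A.col i := by
      rw [Matrix.mulVec_mulVec, Matrix.mul_nonsing_inv _ hσ, Matrix.one_mulVec]
    funext j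
    have h2 := congrFun h1 j
    simp only [Matrix.mulVec, dotProduct, mul_sub, Finset.sum_sub_distrib, Pi.zero_apply,
      Finset.mul_sum, mul_ite, mul_one, mul_zero, Finset.sum_ite_eq, Finset.mem_univ, if_true]
    rw [Finset.sum_comm]
    simp only [Finset.sum_ite_eq, Finset.mem_univ, if_true]
    rw [sub_eq_zero]
    exact h2.symm
  · rw [sub_eq_self]
    exact Finset.sum_eq_zero fun j _ => if_neg fun h => hi' ⟨j, h⟩

/-- The kernel of a surjective map between modules with bases locally has a basis. -/
lemma exists_isFrame_kernel {J : Type*} [Fintype J] {F G : X.Modules} (M : F ⟶ G) {U : X.Opens}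
    {e : I → Γ(F, U)} {f : J → Γ(G, U)} (he : IsFrame F U e) (hf : IsFrame G U f)
    (hM : Function.Surjective (M.app U)) {x : X} (hx : x ∈ U) :
    ∃ (V : X.Opens) (r : ℕ) (g : Fin r → Γ(kernel M, V)), x ∈ V ∧ IsFrame (kernel M) V g := by
  classical
  have hid {F : X.Modules} (v : Γ(F, U)) : F.presheaf.map (homOfLE (le_refl U)).op v = v := by
    exact congrArg (fun φ => φ v) (F.presheaf.map_id (op U))
  choose A hA using fun i => (hf U le_rfl).2 (M.app U (e i))
  choose v hv using fun j => hM (f j)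
  choose C hC using fun j => (he U le_rfl).2 (v j)
  simp only [hid] at hA hC
  let AM : Matrix J I Γ(X, U) := fun j i => A i j
  have hMW {W : X.Opens} (h : W ≤ U) (c : I → Γ(X, W)) :
      M.app W (∑ i, c i • F.presheaf.map (homOfLE h).op (e i)) =
        ∑ j, (AM.map (resHom h)).mulVec c j • G.presheaf.map (homOfLE h).op (f j) := by
    rw [app_sum_smul]
    simp only [app_map, ← hA, res_sum_smul, Finset.smul_sum, smul_smul, Matrix.mulVec, dotProduct,
      Finset.sum_smul]
    rw [Finset.sum_comm]
    refine Finset.sum_congr rfl fun j _ => Finset.sum_congr rfl fun i _ => ?_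
    rw [mul_comm]
    rfl
  have hAC : AM * Matrix.of (fun i j => C j i) = 1 := by
    have hAM : AM.map (resHom le_rfl) = AM := Matrix.ext fun j i => resHom_refl _
    have hcol (j : J) : AM.mulVec (C j) = Pi.single j 1 := by
      have h1 := hMW le_rfl (C j)
      simp only [hid, hAM, hC, hv] at h1
      refine (hf U le_rfl).1 ?_
      simp only [hid, ← h1]
      rw [Finset.sum_eq_single j]
      · simp
      · exact fun i _ hi => by simp [hi]
      · simp
    ext j j'
    refine (congrFun (hcol j') j).trans ?_
    rw [Pi.single_apply, Matrix.one_apply]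
  -- By `hAC` the matrix of `M` has a right inverse over Γ(X, U), so it stays surjective in the
  -- residue field at x. A maximal minor is therefore nonzero at x, and V is the locus where it is
  -- invertible.
  let ev := (X.evaluation U x hx).hom
  obtain ⟨σ, hσ⟩ := exists_column_minor_of_surjective (AM.map ev) (by
    intro y
    refine ⟨((Matrix.of fun i j => C j i).map ev).mulVec y, ?_⟩
    rw [Matrix.mulVecLin_apply, Matrix.mulVec_mulVec, ← Matrix.map_mul, hAC]
    simp)
  have hσinj : Function.Injective σ := by
    intro j j' h
    by_contra hne
    exact hσ (Matrix.det_zero_of_column_eq hne fun l => by simp [h])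
  let D := (AM.submatrix id σ).det
  have hD : ev D ≠ 0 := by
    rwa [RingHom.map_det, RingHom.mapMatrix_apply, ← Matrix.submatrix_map]
  let V := X.basicOpen D
  have hVU : V ≤ U := X.basicOpen_le D
  have hxV : x ∈ V := (X.evaluation_ne_zero_iff_mem_basicOpen x hx D).mp hD
  have hunit : IsUnit (resHom hVU D) := RingedSpace.isUnit_res_basicOpen _ D
  obtain ⟨z, hz, hzK⟩ := exists_kernel_basis (AM.map (resHom hVU)) σ (by
    rw [Matrix.submatrix_map, ← RingHom.mapMatrix_apply, ← RingHom.map_det]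
    exact hunit)
  let K := {i // i ∉ Set.range σ}
  have hMW0 {W : X.Opens} (h : W ≤ U) (c : I → Γ(X, W)) :
      M.app W (∑ i, c i • F.presheaf.map (homOfLE h).op (e i)) = 0 ↔
        (AM.map (resHom h)).mulVec c = 0 := by
    rw [hMW]
    constructor
    · intro h0
      refine (hf W h).1 (h0.trans ?_)
      simp
    · intro h0
      simp [h0]
  choose g hg using fun i : I => exists_kernel_ι_app_eq M V ((hMW0 hVU (z i)).mpr (hz i))
  let r := Fintype.card K
  let κ : Fin r ≃ K := (Fintype.equivFin K).symm
  refine ⟨V, r, fun l => g (κ l).1, hxV, fun W hWV => ?_⟩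
  have hWU : W ≤ U := hWV.trans hVU
  let zW (i : I) : I → Γ(X, W) := fun i' => resHom hWV (z i i')
  have hAMW : (AM.map (resHom hVU)).map (resHom hWV) = AM.map (resHom hWU) :=
    Matrix.ext fun j i => resHom_resHom _ _ _
  have hzW (i : I) : (AM.map (resHom hWU)).mulVec (zW i) = 0 := by
    funext j
    have h1 := congrArg (resHom hWV) (congrFun (hz i) j)
    rw [RingHom.map_mulVec, Pi.zero_apply, map_zero, hAMW] at h1
    exact h1
  have hzWK (i : I) (i' : I) (hi' : i' ∉ Set.range σ) : zW i i' = if i = i' then 1 else 0 := by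
    simp only [zW, hzK i i' hi']
    split <;> simp
  have hι (y : Fin r → Γ(X, W)) : (kernel.ι M).app W
      (∑ l, y l • (kernel M).presheaf.map (homOfLE hWV).op (g (κ l).1)) =
        ∑ i, (∑ l, y l • zW (κ l).1) i • F.presheaf.map (homOfLE hWU).op (e i) := by
    rw [app_sum_smul]
    simp only [app_map, hg, res_sum_smul, res_res, Finset.smul_sum, smul_smul, Finset.sum_apply,
      Pi.smul_apply, smul_eq_mul, Finset.sum_smul]
    exact Finset.sum_comm
  have hsumK (y : Fin r → Γ(X, W)) (l : Fin r) : (∑ l, y l • zW (κ l).1) (κ l).1 = y l := by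
    rw [Finset.sum_apply, Finset.sum_eq_single l]
    · simp [hzWK _ _ (κ l).2]
    · intro l' _ hl'
      have : (κ l').1 ≠ (κ l).1 := fun h => hl' (κ.injective (Subtype.ext h))
      simp [hzWK _ _ (κ l).2, this]
    · simp
  constructor
  · intro y y' h
    funext l
    have h1 := congrArg ((kernel.ι M).app W) h
    simp only [hι] at h1
    have h2 := (he W hWU).1 h1
    rw [← hsumK y l, h2, hsumK y' l]
  · intro w
    obtain ⟨c, hc⟩ := (he W hWU).2 ((kernel.ι M).app W w)
    have hc0 : (AM.map (resHom hWU)).mulVec c = 0 := by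
      rw [← hMW0 hWU]
      exact (congrArg (M.app W) hc).trans (app_kernel_ι_app M W w)
    let y (l : Fin r) := c (κ l).1
    refine ⟨y, app_injective_of_mono (kernel.ι M) W ?_⟩
    refine (hι y).trans (Eq.trans ?_ hc)
    -- The difference lies in the kernel and vanishes off the columns of `σ`, so the invertible
    -- minor makes it vanish altogether.
    let c' := c - ∑ l, y l • zW (κ l).1
    suffices hc' : c' = 0 by rw [← sub_eq_zero.mp hc']
    have h1 : (AM.map (resHom hWU)).mulVec c' = 0 := by
      rw [Matrix.mulVec_sub, hc0, Matrix.mulVec_sum]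
      simp [Matrix.mulVec_smul, hzW]
    have h2 (i : I) (hi : i ∉ Set.range σ) : c' i = 0 := by
      have := hsumK y (κ.symm ⟨i, hi⟩)
      rw [Equiv.apply_symm_apply] at this
      simp [c', this, y]
    have h3 : ((AM.map (resHom hWU)).submatrix id σ).mulVec (c' ∘ σ) = 0 := by
      funext j
      refine Eq.trans ?_ (congrFun h1 j)
      refine Finset.sum_of_injOn σ hσinj.injOn (by simp) (fun i _ hi => ?_) fun _ _ => rfl
      rw [h2 i (by simpa using hi), mul_zero]
    have h4 : IsUnit ((AM.map (resHom hWU)).submatrix id σ).det := by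
      rw [← hAMW, Matrix.submatrix_map, Matrix.submatrix_map, ← RingHom.mapMatrix_apply,
        ← RingHom.map_det, ← RingHom.mapMatrix_apply, ← RingHom.map_det]
      exact hunit.map _
    have h5 : c' ∘ σ = 0 := by
      rw [← Matrix.one_mulVec (c' ∘ σ), ← Matrix.nonsing_inv_mul _ h4, ← Matrix.mulVec_mulVec, h3,
        Matrix.mulVec_zero]
    funext i
    by_cases hi : i ∈ Set.range σ
    · obtain ⟨j, rfl⟩ := hi
      exact congrFun h5 j
    · exact h2 i hi

end Frames
end
end KernelBundle

namespace KernelBundle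
open TopologicalSpace Opposite

noncomputable section
variable {n : ℕ} {k : Type u} [Field k]

/-! ### Local freeness of the kernel. -/

section LocallyFree
variable {I J : Type} [Fintype I] [Fintype J] {δ : I → ℕ} {ε : J → ℕ}

/-- Where x_l is invertible, x_l ^ δ_i generates the i-th summand. -/
lemma exists_isFrame_sum_twist (δ : I → ℕ) (l : Fin (n + 1)) :
    ∃ e : I → Γ(⨁ fun i => twist n k (δ i), Proj.basicOpen (projGrading n k) (MvPolynomial.X l)),
      IsFrame (⨁ fun i => twist n k (δ i)) _ e := by
  classical
  let F (i : I) := twist n k (δ i)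
  let U : (ProjSpace n k).Opens := Proj.basicOpen (projGrading n k) (MvPolynomial.X l)
  choose e he using fun i : I => exists_coord_eq (F := F) (U := U) fun i' =>
    if i' = i then powSection n k (δ i') l U else 0
  refine ⟨e, fun W h => ?_⟩
  have hcoord (c : I → Γ(ProjSpace n k, W)) (i : I) :
      coord F i (∑ i, c i • (⨁ F).presheaf.map (homOfLE h).op (e i)) =
        c i • powSection n k (δ i) l W := by
    rw [map_sum, Finset.sum_eq_single i]
    · rw [coord_smul, coord_map, he, if_pos rfl]
      rfl
    · intro i' _ hi'
      rw [coord_smul, coord_map, he, if_neg hi'.symm, map_zero, smul_zero]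
    · simp
  constructor
  · intro c c' hc
    funext i
    refine smul_powSection_injective (d := δ i) l ?_
    rw [← hcoord c i, ← hcoord c' i]
    exact congrArg _ hc
  · intro v
    choose c hc using fun i => exists_smul_powSection_eq (d := δ i) l h (coord F i v)
    exact ⟨c, coord_ext fun i => (hcoord c i).trans (hc i)⟩

/-- The kernel of a map of direct sums of line bundles that is surjective over the standard cover is
locally free. -/
theorem isVectorBundle_kernel (M : (⨁ fun i => twist n k (δ i)) ⟶ ⨁ fun j => twist n k (ε j))
    (hM : ∀ l : Fin (n + 1), Function.Surjective
      (M.app (Proj.basicOpen (projGrading n k) (MvPolynomial.X l)))) :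
    IsVectorBundle (kernel M) := by
  intro x
  obtain ⟨l, hl⟩ := exists_basicOpen_X_mem x
  obtain ⟨e, he⟩ := exists_isFrame_sum_twist (k := k) δ l
  obtain ⟨f, hf⟩ := exists_isFrame_sum_twist (k := k) ε l
  obtain ⟨V, r, g, hxV, hg⟩ := exists_isFrame_kernel M he hf (hM l) hl
  exact ⟨V, r, hxV, hg.nonempty_iso_free⟩

lemma matrixHom_app_cechOpen_surjective (h : ∀ j i, δ i ≤ ε j) {M : FormMatrix k n δ ε} {D : ℕ}
    (hM : Function.Surjective (formMap k n h D M)) {p : ℕ} (α : Fin (p + 1) → Fin (n + 1)) :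
    Function.Surjective ((matrixHom h M).app (cechOpen k α)) := by
  have hg := MvPolynomial.IsHomogeneous.prod Finset.univ
    (fun a => (MvPolynomial.X (α a) : MvPolynomial (Fin (n + 1)) k)) (fun _ => 1)
    fun a _ => MvPolynomial.isHomogeneous_X k (α a)
  refine matrixHom_app_surjective h hM (by simp) hg
    (Finset.prod_ne_zero_iff.mpr fun a _ => MvPolynomial.X_ne_zero _) fun x => ?_
  rw [mem_cechOpen]
  constructor
  · intro hx h
    obtain ⟨a, -, ha⟩ := (x.isPrime.prod_mem_iff).mp h
    exact hx a ha
  · exact fun hx a h => hx (Ideal.mem_of_dvd _ (Finset.dvd_prod_of_mem _ (Finset.mem_univ a)) h)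

lemma matrixHom_app_basicOpen_surjective (h : ∀ j i, δ i ≤ ε j) {M : FormMatrix k n δ ε} {D : ℕ}
    (hM : Function.Surjective (formMap k n h D M)) (l : Fin (n + 1)) :
    Function.Surjective ((matrixHom h M).app
      (Proj.basicOpen (projGrading n k) (MvPolynomial.X l))) :=
  matrixHom_app_surjective h hM one_pos (MvPolynomial.isHomogeneous_X k l)
    (MvPolynomial.X_ne_zero l) fun _ => Iff.rfl

end LocallyFree

/-! ### General maps and the main theorem. -/

section General
variable {I J : Type} [Fintype I] [Fintype J] {δ : I → ℕ} {ε : J → ℕ}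

/-- A property of matrices of forms that holds outside the zero locus of a polynomial holds for a
general map of direct sums of line bundles. -/
lemma forGeneral_of_polynomial (h : ∀ j i, δ i ≤ ε j)
    {P : ((⨁ fun i => twist n k (δ i)) ⟶ ⨁ fun j => twist n k (ε j)) → Prop} {m : ℕ}
    (b : Module.Basis (Fin m) k (FormMatrix k n δ ε)) {p : MvPolynomial (Fin m) k} (hp : p ≠ 0)
    (hP : ∀ M, MvPolynomial.eval (b.repr M) p ≠ 0 → P (matrixHom h M)) :
    ForGeneral k P := by
  refine ⟨m, b.map (matrixHomEquiv h), p, hp, fun φ hφ => ?_⟩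
  obtain ⟨M, rfl⟩ := (matrixHomEquiv h).surjective φ
  refine hP M ?_
  simpa using hφ

end General
end
end KernelBundle

theorem theorem2p6 {k : Type u} [Field k] [IsAlgClosed k] (n : ℕ) {a b : ℕ}
    (d s : Fin (a + 1) → ℕ) (e t : Fin (b + 1) → ℕ)
    (hd : StrictMono d) (he : StrictMono e) (hde : d (Fin.last a) < e 0)
    (hmax : max (∑ i, (s i : ℚ) * ((d i + n).choose n : ℚ))
        (∑ j, (t j : ℚ) * ((e j + n).choose n : ℚ)) ≥
      1 / 4 * ((d (Fin.last a) + n).choose n : ℚ) * ((e (Fin.last b) + n).choose n : ℚ) *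
        ∑ i, ((d i + n).choose n : ℚ) ^ 2) :
    KernelBundle.ForGeneral k
      (fun M : KernelBundle.lineBundleSum n k d s ⟶ KernelBundle.lineBundleSum n k e t =>
        KernelBundle.HasMaximalRankOnSections M ∧
        (∑ j, t j + n ≤ ∑ i, s i →
          KernelBundle.IsVectorBundle (kernel M) ∧
          (∀ i, Module.Finite k (KernelBundle.cohomology (kernel M) i)) ∧
          (KernelBundle.hDim (kernel M) 0 : ℤ) = max (KernelBundle.eulerChar (kernel M)) 0 ∧
          (KernelBundle.hDim (kernel M) 1 : ℤ) = max (-KernelBundle.eulerChar (kernel M)) 0 ∧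
          ∀ i, 2 ≤ i → KernelBundle.hDim (kernel M) i = 0)) := by
  let I := (i : Fin (a + 1)) × Fin (s i)
  let J := (j : Fin (b + 1)) × Fin (t j)
  let δ : I → ℕ := fun p => d p.1
  let ε : J → ℕ := fun q => e q.1
  have hlt (i : Fin (a + 1)) (j : Fin (b + 1)) : d i < e j :=
    (hd.monotone (Fin.le_last i)).trans_lt (hde.trans_le (he.monotone (Fin.zero_le j)))
  have h (j : J) (i : I) : δ i ≤ ε j := (hlt i.1 j.1).le
  have hcardI : Fintype.card I = ∑ i, s i := by simp [I]
  have hcardJ : Fintype.card J = ∑ j, t j := by simp [J]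
  let B := Module.finBasis k (KernelBundle.FormMatrix k n δ ε)
  have h₁ : ∃ p : MvPolynomial _ k, p ≠ 0 ∧ ∀ M, MvPolynomial.eval (B.repr M) p ≠ 0 →
      KernelBundle.HasMaximalRankOnSections (KernelBundle.matrixHom h M) := by
    obtain ⟨M₀, hM₀ | hM₀⟩ := KernelBundle.exists_maximalRank (k := k) hd he hlt hmax h
    · obtain ⟨p, hp, hpM⟩ := KernelBundle.exists_polynomial_injective _ B hM₀
      exact ⟨p, hp, fun M hM => Or.inl (KernelBundle.matrixHom_app_top_injective h (hpM M hM))⟩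
    · obtain ⟨p, hp, hpM⟩ := KernelBundle.exists_polynomial_surjective _ B hM₀
      exact ⟨p, hp, fun M hM => Or.inr (KernelBundle.matrixHom_app_top_surjective h (hpM M hM))⟩
  -- Surjectivity in the single degree shift D found for `M₀` is an open condition on `M`. If there
  -- are too few columns nothing is claimed, and the polynomial 1 serves.
  have h₂ : ∃ p : MvPolynomial _ k, p ≠ 0 ∧ ∀ M, MvPolynomial.eval (B.repr M) p ≠ 0 →
      ∑ j, t j + n ≤ ∑ i, s i → ∃ D, Function.Surjective (KernelBundle.formMap k n h D M) := by
    by_cases hcard : ∑ j, t j + n ≤ ∑ i, s i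
    · obtain ⟨M₀, D, hM₀⟩ := KernelBundle.exists_formMap_surjective (F := k) (n := n) (d := δ) (e := ε)
        (fun j i => hlt i.1 j.1) (by rwa [hcardI, hcardJ])
      obtain ⟨p, hp, hpM⟩ := KernelBundle.exists_polynomial_surjective _ B hM₀
      exact ⟨p, hp, fun M hM _ => ⟨D, hpM M hM⟩⟩
    · exact ⟨1, one_ne_zero, fun _ _ hc => (hcard hc).elim⟩
  obtain ⟨p₁, hp₁, hp₁M⟩ := h₁
  obtain ⟨p₂, hp₂, hp₂M⟩ := h₂
  -- The product of the two polynomials is nonzero, and outside its zero locus both conditions hold.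
  refine KernelBundle.forGeneral_of_polynomial h B (mul_ne_zero hp₁ hp₂) fun M hM => ?_
  rw [map_mul] at hM
  have hrank := hp₁M M (left_ne_zero_of_mul hM)
  refine ⟨hrank, fun hcard => ?_⟩
  obtain ⟨D, hD⟩ := hp₂M M (right_ne_zero_of_mul hM) hcard
  exact ⟨KernelBundle.isVectorBundle_kernel _ (KernelBundle.matrixHom_app_basicOpen_surjective h hD),
    KernelBundle.cohomology_kernel _
      (fun _ α => KernelBundle.matrixHom_app_cechOpen_surjective h hD α) hrank⟩
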